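/- **Setting.** Let $\mathbb S=\mathbb R/\mathbb Z$ with Lebesgue measure, $e_0=1$, $e_k=\sqrt2\cos(2\pi k\,\cdot)$ ($k\ge1$), $\lambda\in(1/2,1)$, $T>0$. Let $(\Omega,\mathcal A,\mathbb F,\mathbb P)$ be a complete filtered probability space satisfying the usual conditions, carrying independent $\mathbb F$-Brownian motions $(B^k)_{k\ge0}$, with $\mathbb F$ generated by $\mathcal F_0$ and $(B^k)_k$; put $W_t=\sum_{k\ge 0}(1\vee k)^{-\lambda}B^k_t\,e_k$, an $L^2(\mathbb S)$-valued process. A function $\mathbb S\to[-\infty,\infty]$ is *non-decreasing* if it is symmetric about $0$ and non-increasing on $[-1/2,0]$; $U^2(\mathbb S)\subset L^2(\mathbb S)$ is the set of (classes of) square-integrable non-decreasing functions, each evaluated pointwise through its canonical version, which is symmetric, right-continuous at $0$ and left-continuous on $(0,1/2]$. $\mathcal P_2(\mathbb R)$ is the set of probability measures on $\mathbb R$ with finite second moment, with the Wasserstein distance $\mathbb W_2$. $H^2_{\rm sym}(\mathbb S)$ is the space of symmetric functions in $H^2(\mathbb S)$ and $H^{-2}_{\rm sym}(\mathbb S)$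 its dual. **Fields.** $\mathcal C$ is the class of measurable $\mathcal V:[0,T]\times\mathbb S\times\mathcal P_2(\mathbb R)\to\mathbb R$ for which there is $C\ge0$ with $|\mathcal V|\le C$, with $\mathcal V(t,\cdot,\mu)$ (the canonical version of) an element of $U^2(\mathbb S)$ for all $(t,\mu)$, and with $\int_{\mathbb S}|\mathcal V(t,x,\mu)-\mathcal V(t,x,\nu)|^2dx\le C\,\mathbb W_2^2(\mu,\nu)$ for all $t,\mu,\nu$. **State equation.** For $\mathcal V\in\mathcal C$ and a deterministic $X_0\in U^2(\mathbb S)$, a solution of the rearranged stochastic heat equation (SHE) driven by $\mathcal V$ is a pair $(X_t,\eta_t)_{0\le t\le T}$ such that: 1. $X$ is continuous, $\mathbb F$-adapted, with values in $U^2(\mathbb S)$ and initial value $X_0$; 2. $\eta$ is continuous, $\mathbb F$-adapted, with values in $H^{-2}_{\rm sym}(\mathbb S)$, $\eta_0=0$, and almost surely $t\mapsto\langle\eta_t,u\rangle$ is non-decreasing on $[0,T]$ for every $u\in H^2_{\rm sym}(\mathbb S)\cap U^2(\mathbb S)$; 3. almost surely, for all $u\in H^2_{\rm sym}(\mathbb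 S)$ and $t\in[0,T]$, $$\langle X_t-X_0,u\rangle=-\int_0^t\langle\mathcal V(r,\cdot,\mathrm{Leb}\circ X_r^{-1}),u\rangle\,dr+\int_0^t\langle X_r,\Delta u\rangle\,dr+\langle W_t,u\rangle+\langle\eta_t,u\rangle;$$ 4. for all $t\in[0,T]$, $\lim_{\varepsilon\downarrow0}\mathbb E\bigl[\int_0^te^{\varepsilon\Delta}X_r\cdot d\eta_r\bigr]=0$ (the integral being a limit of Riemann sums, integrable for small $\varepsilon$). **Mean field game.** Let $f,g:\mathbb R\times\mathcal P_2(\mathbb R)\to\mathbb R$ be measurable, with $|f(x,\mu)|,|g(x,\mu)|\le C(1+x^2+\int y^2d\mu(y))^{1/2}$, differentiable in $x$, with $\partial_xf,\partial_xg$ bounded, non-decreasing in $x$ and jointly Lipschitz continuous in $(x,\mu)$. Given $\mathcal V\in\mathcal C$ and the solution $X$ that it drives, admissible pairs are the $\mathbb F$-progressively measurable random fields $(\Gamma,\gamma)$ on $[0,T]\times\mathbb S$ with $\mathbb E\int_0^T\!\int_{\mathbb S}|\gamma_t(x)|^2dx\,dt<\infty$ and, almost surely, for a.e. $x$ and all $t\in[0,T]$,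 $$\Gamma_t(x)=X_t(x)+\int_0^t\bigl(\gamma_s(x)+\mathcal V(s,x,\mathrm{Leb}\circ X_s^{-1})\bigr)ds.$$ The cost is $$J(\gamma;X)=\mathbb E\int_{\mathbb S}\Bigl[g(\Gamma_T(x),\mathrm{Leb}\circ X_T^{-1})+\int_0^T\bigl(f(\Gamma_t(x),\mathrm{Leb}\circ X_t^{-1})+\tfrac12|\gamma_t(x)|^2\bigr)dt\Bigr]dx .$$ The field $\mathcal V$ *forms a mean field equilibrium* if $\bigl(X_t(x),-\mathcal V(t,x,\mathrm{Leb}\circ X_t^{-1})\bigr)$ is admissible and minimizes $J$ among admissible pairs. **Proposition.** Let $\mathcal V\in\mathcal C$, let $X_0\in U^2(\mathbb S)$ be deterministic, and let $(X,\eta)$ be the solution of the rearranged SHE driven by $\mathcal V$ with initial condition $X_0$. Then $\mathcal V$ forms a mean field equilibrium if and only if, for almost every $t\in[0,T]$, $\mathbb P$-almost surely, for all $x\in\mathbb S$, $$\mathcal V\bigl(t,x,\mathrm{Leb}\circ X_t^{-1}\bigr)=\mathbb E\Bigl[\partial_xg\bigl(X_T(x),\mathrm{Leb}\circ X_T^{-1}\bigr)+\int_t^T\partial_xf\bigl(X_s(x),\mathrm{Leb}\circ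 X_s^{-1}\bigr)ds\,\Big|\,\mathcal F_t\Bigr].$$ Here the right-hand side, as a random field in $x$, is taken in its version whose realizations are canonical versions of elements of $U^2(\mathbb S)$, and $\partial_xf(\cdot,\mu),\partial_xg(\cdot,\mu)$ are extended to $\pm\infty$ by their limits (canonical versions may be infinite at $x=0$ and $x=1/2$). -/

import Mathlib

open MeasureTheory ProbabilityTheory Filter Topology
open scoped NNReal ENNReal

noncomputable section

namespace RSHE

/-! ### The circle, periodic quantile functions and their canonical versions -/

/-- `L²(𝕊)`, where `𝕊 = ℝ/ℤ` carries the Lebesgue measure (of total mass one). -/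
abbrev L2 : Type := Lp ℝ 2 (volume : Measure UnitAddCircle)

instance instIsProbabilityMeasureCircle :
    IsProbabilityMeasure (volume : Measure UnitAddCircle) := ⟨UnitAddCircle.measure_univ⟩

/-- The class in `L²(𝕊)` of a continuous function. -/
def toL2 (φ : C(UnitAddCircle, ℝ)) : L2 := ContinuousMap.toLp (E := ℝ) 2 volume ℝ φ

/-- A function on `𝕊` with values in `[-∞, ∞]` is called non-decreasing if it is symmetric with
respect to `0` and non-increasing on `[-1/2, 0]`. -/
def IsNondecreasing (h : UnitAddCircle → EReal) : Prop :=
  (∀ x, h (-x) = h x) ∧ AntitoneOn (fun r : ℝ => h (r : UnitAddCircle)) (Set.Icc (-1 / 2) 0)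

/-- `U²(𝕊)`: square-integrable functions with a version that is non-decreasing. -/
def U2 : Set L2 :=
  {u | ∃ h : UnitAddCircle → EReal, IsNondecreasing h ∧ ∀ᵐ x, ((u x : ℝ) : EReal) = h x}

/-- One-sided continuity of canonical versions: right-continuous at `0`, left-continuous on
`(0, 1/2]`. -/
def IsCanonical {Y : Type*} [TopologicalSpace Y] (h : UnitAddCircle → Y) : Prop :=
  ContinuousWithinAt (fun r : ℝ => h (r : UnitAddCircle)) (Set.Ici 0) 0 ∧
    ∀ r ∈ Set.Ioc (0 : ℝ) (1 / 2),
      ContinuousWithinAt (fun s : ℝ => h (s : UnitAddCircle)) (Set.Iic r) r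

/-- The real-valued function `h` on `𝕊` is (the canonical version of) an element of `U²(𝕊)`. It is
used for bounded functions only, for which square-integrability is automatic. -/
def IsCanonicalNondecreasing (h : UnitAddCircle → ℝ) : Prop :=
  IsNondecreasing (fun x => (h x : EReal)) ∧ IsCanonical h

/-- The value at `x` of the canonical version of an element of `U²(𝕊)`: the limit of the averages
over `[x - δ, x]` if `x ∈ (0, 1/2] + ℤ`, and over `[x, x + δ]` if `x ∈ (-1/2, 0] + ℤ`. The limits
are taken in `[-∞, ∞]`; the value may be infinite only at `0` and at `1/2`. -/
def canonicalValue (u : L2) (x : UnitAddCircle) : EReal :=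
  let r : ℝ := (AddCircle.equivIoc (1 : ℝ) (-1 / 2) x : ℝ)
  if 0 < r then
    limUnder (𝓝[>] (0 : ℝ)) fun δ : ℝ =>
      ((δ⁻¹ * ∫ s in (r - δ)..r, u (s : UnitAddCircle) : ℝ) : EReal)
  else
    limUnder (𝓝[>] (0 : ℝ)) fun δ : ℝ =>
      ((δ⁻¹ * ∫ s in r..(r + δ), u (s : UnitAddCircle) : ℝ) : EReal)

/-- The extension of a (bounded and monotone) function on `ℝ` to `[-∞, ∞]` by its limits. -/
def extendEReal (φ : ℝ → ℝ) (z : EReal) : ℝ :=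
  if z = ⊤ then limUnder atTop φ else if z = ⊥ then limUnder atBot φ else φ z.toReal

/-! ### Probability measures with a finite second moment -/

/-- `𝒫₂(ℝ)`, with the σ-algebra generated by the evaluations `μ ↦ μ(A)`. -/
abbrev P2 : Type := {μ : Measure ℝ // IsProbabilityMeasure μ ∧ MemLp id 2 μ}

/-- The `2`-Wasserstein distance. -/
def W2 (μ ν : P2) : ℝ :=
  √(⨅ π ∈ {π : Measure (ℝ × ℝ) | π.map Prod.fst = μ.1 ∧ π.map Prod.snd = ν.1},
    ∫⁻ p, edist p.1 p.2 ^ 2 ∂π).toReal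

/-- The image `Leb ∘ u⁻¹` of the Lebesgue measure of `𝕊` by `u ∈ L²(𝕊)`. -/
def law (u : L2) : P2 :=
  ⟨(volume : Measure UnitAddCircle).map u,
    Measure.isProbabilityMeasure_map (Lp.aestronglyMeasurable u).aemeasurable,
    (memLp_map_measure_iff aestronglyMeasurable_id
      (Lp.aestronglyMeasurable u).aemeasurable).2 (by simpa using Lp.memLp u)⟩

/-! ### The cosine basis, the space `H²_sym(𝕊)` and the heat semigroup -/

/-- `v ∈ L²(𝕊)` is the weak derivative of `u ∈ L²(𝕊)`: `∫ u φ' = - ∫ v φ` for every smooth `φ`. -/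
def IsWeakDeriv (u v : L2) : Prop :=
  ∀ φ φ' : C(UnitAddCircle, ℝ), ContDiff ℝ ((⊤ : ℕ∞) : WithTop ℕ∞) (fun r : ℝ => φ (r : UnitAddCircle)) →
    (∀ r : ℝ, HasDerivAt (fun s : ℝ => φ (s : UnitAddCircle)) (φ' (r : UnitAddCircle)) r) →
    inner ℝ u (toL2 φ') = - inner ℝ v (toL2 φ)

theorem ae_neg_of_ae {p : UnitAddCircle → Prop} (h : ∀ᵐ x, p x) : ∀ᵐ x, p (-x) :=
  (Measure.measurePreserving_neg (volume : Measure UnitAddCircle)).quasiMeasurePreserving.ae h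

/-- `H²_sym(𝕊)`: triples `(u, u', u'')` of a symmetric function and its first two weak derivatives,
all in `L²(𝕊)`. The norm is the maximum of the three `L²` norms, hence is equivalent to the usual
Hilbert norm. -/
def H2symSubmodule : Submodule ℝ (L2 × L2 × L2) where
  carrier := {p | (∀ᵐ x, p.1 (-x) = p.1 x) ∧ IsWeakDeriv p.1 p.2.1 ∧ IsWeakDeriv p.2.1 p.2.2}
  zero_mem' := by
    refine ⟨?_, ?_, ?_⟩
    · have h := Lp.coeFn_zero ℝ 2 (volume : Measure UnitAddCircle)
      filter_upwards [h, ae_neg_of_ae h] with x h1 h2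
      simp only [Prod.fst_zero]
      rw [h1, h2]
      rfl
    · intro φ φ' _ _; simp
    · intro φ φ' _ _; simp
  add_mem' := by
    rintro a b ⟨ha, ha1, ha2⟩ ⟨hb, hb1, hb2⟩
    refine ⟨?_, ?_, ?_⟩
    · have h := Lp.coeFn_add a.1 b.1
      filter_upwards [h, ae_neg_of_ae h, ha, hb] with x h1 h2 h3 h4
      simp only [Prod.fst_add]
      rw [h1, h2]
      simp [h3, h4]
    · intro φ φ' h h'
      simp only [Prod.fst_add, Prod.snd_add, inner_add_left, ha1 φ φ' h h', hb1 φ φ' h h']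
      ring
    · intro φ φ' h h'
      simp only [Prod.fst_add, Prod.snd_add, inner_add_left, ha2 φ φ' h h', hb2 φ φ' h h']
      ring
  smul_mem' := by
    rintro c a ⟨ha, ha1, ha2⟩
    refine ⟨?_, ?_, ?_⟩
    · have h := Lp.coeFn_smul c a.1
      filter_upwards [h, ae_neg_of_ae h, ha] with x h1 h2 h3
      simp only [Prod.smul_fst]
      rw [h1, h2]
      simp [h3]
    · intro φ φ' h h'
      simp only [Prod.smul_fst, Prod.smul_snd, inner_smul_left, ha1 φ φ' h h']
      simp
    · intro φ φ' h h'
      simp only [Prod.smul_fst, Prod.smul_snd, inner_smul_left, ha2 φ φ' h h']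
      simp

abbrev H2sym : Type := ↥H2symSubmodule

/-- The underlying function of an element of `H²_sym(𝕊)`. -/
def H2sym.fn (u : H2sym) : L2 := u.1.1

/-- The Laplacian (second derivative) of an element of `H²_sym(𝕊)`. -/
def H2sym.lap (u : H2sym) : L2 := u.1.2.2

/-- The dual space `H^{-2}_sym(𝕊)`, with its dual norm. -/
abbrev Hm2sym : Type := StrongDual ℝ H2sym

/-- `x ↦ cos (2πkx)` on `𝕊`. -/
def cosMap (k : ℕ) : C(UnitAddCircle, ℝ) :=
  ⟨fun x => (fourier (k : ℤ) x : ℂ).re, Complex.continuous_re.comp (fourier (k : ℤ)).continuous⟩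

/-- `x ↦ sin (2πkx)` on `𝕊`. -/
def sinMap (k : ℕ) : C(UnitAddCircle, ℝ) :=
  ⟨fun x => (fourier (k : ℤ) x : ℂ).im, Complex.continuous_im.comp (fourier (k : ℤ)).continuous⟩

theorem cosMap_coe (k : ℕ) (r : ℝ) :
    cosMap k (r : UnitAddCircle) = Real.cos (2 * Real.pi * k * r) := by
  have h : (2 * Real.pi * Complex.I * (k : ℤ) * r / (1 : ℝ) : ℂ)
      = ((2 * Real.pi * k * r : ℝ) : ℂ) * Complex.I := by
    push_cast; ring
  simp only [cosMap, ContinuousMap.coe_mk, fourier_coe_apply]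
  rw [h, Complex.exp_ofReal_mul_I_re]

theorem sinMap_coe (k : ℕ) (r : ℝ) :
    sinMap k (r : UnitAddCircle) = Real.sin (2 * Real.pi * k * r) := by
  have h : (2 * Real.pi * Complex.I * (k : ℤ) * r / (1 : ℝ) : ℂ)
      = ((2 * Real.pi * k * r : ℝ) : ℂ) * Complex.I := by
    push_cast; ring
  simp only [sinMap, ContinuousMap.coe_mk, fourier_coe_apply]
  rw [h, Complex.exp_ofReal_mul_I_im]

/-- The normalisation of the cosine functions: `1` if `k = 0`, and `√2` otherwise. -/
def cosNorm (k : ℕ) : ℝ := if k = 0 then 1 else √2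

/-- The basis functions `e₀ = 1` and `e_k = √2 cos (2πk ·)`, `k ≥ 1`, as elements of `L²(𝕊)`. -/
def e (k : ℕ) : L2 := cosNorm k • toL2 (cosMap k)

theorem inner_toL2 (φ ψ : C(UnitAddCircle, ℝ)) :
    inner ℝ (toL2 φ) (toL2 ψ) = ∫ r in (0 : ℝ)..1, φ (r : UnitAddCircle) * ψ (r : UnitAddCircle) := by
  have h := UnitAddCircle.intervalIntegral_preimage 0 (fun x => φ x * ψ x)
  rw [zero_add] at h
  rw [h, L2.inner_def]
  refine integral_congr_ae ?_
  filter_upwards [ContinuousMap.coeFn_toLp (p := 2) (𝕜 := ℝ) (volume : Measure UnitAddCircle) φ,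
    ContinuousMap.coeFn_toLp (p := 2) (𝕜 := ℝ) (volume : Measure UnitAddCircle) ψ] with x h1 h2
  simp only [toL2]
  rw [h1, h2]
  simp [mul_comm]

theorem isWeakDeriv_toL2 (a b : C(UnitAddCircle, ℝ))
    (hab : ∀ r : ℝ, HasDerivAt (fun s : ℝ => a (s : UnitAddCircle)) (b (r : UnitAddCircle)) r) :
    IsWeakDeriv (toL2 a) (toL2 b) := by
  intro φ φ' _ h
  have hc : ∀ c : C(UnitAddCircle, ℝ), Continuous (fun r : ℝ => c (r : UnitAddCircle)) :=
    fun c => c.continuous.comp (AddCircle.continuous_mk' 1)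
  rw [inner_toL2, inner_toL2]
  rw [intervalIntegral.integral_mul_deriv_eq_deriv_mul (fun x _ => hab x) (fun x _ => h x)
    ((hc b).intervalIntegrable _ _) ((hc φ').intervalIntegrable _ _)]
  have h1 : ((1 : ℝ) : UnitAddCircle) = ((0 : ℝ) : UnitAddCircle) := by
    simp
  rw [h1]
  ring

theorem hasDerivAt_cosMap (k : ℕ) (r : ℝ) :
    HasDerivAt (fun s : ℝ => cosMap k (s : UnitAddCircle))
      ((-(2 * Real.pi * k) • sinMap k) (r : UnitAddCircle)) r := by
  simp only [cosMap_coe, ContinuousMap.smul_apply, sinMap_coe]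
  refine (((hasDerivAt_id' r).const_mul (2 * Real.pi * k)).cos).congr_deriv ?_
  simp only [smul_eq_mul]
  ring

theorem hasDerivAt_sinMap (k : ℕ) (r : ℝ) :
    HasDerivAt (fun s : ℝ => (-(2 * Real.pi * k) • sinMap k) (s : UnitAddCircle))
      ((-(2 * Real.pi * k) ^ 2 • cosMap k) (r : UnitAddCircle)) r := by
  simp only [cosMap_coe, ContinuousMap.smul_apply, sinMap_coe, smul_eq_mul]
  refine ((((hasDerivAt_id' r).const_mul (2 * Real.pi * k)).sin).const_mul
    (-(2 * Real.pi * k))).congr_deriv ?_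
  ring

/-- The function `cos (2πk ·)` as an element of `H²_sym(𝕊)`. -/
def cosH2 (k : ℕ) : H2sym :=
  ⟨(toL2 (cosMap k), toL2 (-(2 * Real.pi * k) • sinMap k), toL2 (-(2 * Real.pi * k) ^ 2 • cosMap k)),
    by
      show ∀ᵐ x, toL2 (cosMap k) (-x) = toL2 (cosMap k) x
      have h := ContinuousMap.coeFn_toLp (p := 2) (𝕜 := ℝ) (volume : Measure UnitAddCircle) (cosMap k)
      filter_upwards [h, ae_neg_of_ae h] with x h1 h2
      simp only [toL2]
      rw [h1, h2]
      induction x using QuotientAddGroup.induction_on with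
      | H r =>
        rw [← AddCircle.coe_neg, cosMap_coe, cosMap_coe]
        simp,
    isWeakDeriv_toL2 _ _ (hasDerivAt_cosMap k), isWeakDeriv_toL2 _ _ (hasDerivAt_sinMap k)⟩

/-- The basis function `e_k` as an element of `H²_sym(𝕊)`. -/
def eH2 (k : ℕ) : H2sym := cosNorm k • cosH2 k

theorem eH2_fn (k : ℕ) : (eH2 k).fn = e k := rfl

/-- The heat semigroup `e^{εΔ}`, `ε > 0`, on symmetric square-integrable functions, with values in
`H²_sym(𝕊)`. -/
def heat (ε : ℝ) (u : L2) : H2sym :=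
  ∑' k : ℕ, (Real.exp (-(2 * Real.pi * k) ^ 2 * ε) * inner ℝ (e k) u) • eH2 k

/-- The integral `∫₀ᵗ z_r · dη_r` of an `H²_sym(𝕊)`-valued path against an
`H^{-2}_sym(𝕊)`-valued path: the limit of the Riemann sums along uniform subdivisions. -/
def pathIntegral (z : ℝ≥0 → H2sym) (η : ℝ≥0 → Hm2sym) (t : ℝ≥0) : ℝ :=
  limUnder atTop fun n : ℕ =>
    ∑ i ∈ Finset.range n, (η ((i + 1) / n * t) - η (i / n * t)) (z (i / n * t))

/-- The Lebesgue measure on the time axis `[0, ∞)`. -/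
def leb : Measure ℝ≥0 := Measure.comap ((↑) : ℝ≥0 → ℝ) volume

/-! ### The noise -/

variable {Ω : Type*} [mΩ : MeasurableSpace Ω]

/-- `(B^k)_k` is a collection of independent `𝔽`-Brownian motions (on a complete probability space
whose filtration `𝔽` satisfies the usual conditions), and `𝔽` is generated by `𝓕₀` and
`(B^k)_k`. -/
structure IsNoise (P : Measure Ω) (ℱ : Filtration ℝ≥0 mΩ) (B : ℕ → ℝ≥0 → Ω → ℝ) : Prop where
  complete : P.IsComplete
  null_mem : ∀ s : Set Ω, P s = 0 → MeasurableSet[ℱ 0] s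
  rightContinuous : ℱ.IsRightContinuous
  brownian : ∀ k, IsPreBrownianReal (B k) P
  continuous : ∀ k ω, Continuous fun t => B k t ω
  adapted : ∀ k, Adapted ℱ (B k)
  indep : iIndepFun (fun k ω t => B k t ω) P
  indep_increments : ∀ s t, s ≤ t →
    Indep (MeasurableSpace.comap (fun ω k => B k t ω - B k s ω) inferInstance) (ℱ s) P
  generated : ∀ t, (ℱ t : MeasurableSpace Ω) =
    ℱ 0 ⊔ ⨆ k, ⨆ s ≤ t, MeasurableSpace.comap (B k s) inferInstance

/-- The `Q`-Brownian motion `W_t = ∑_k (Q e_k) B_t^k`, with `Q e_k = (1 ∨ k)^{-λ} e_k`. -/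
def noise (lam : ℝ) (B : ℕ → ℝ≥0 → Ω → ℝ) (t : ℝ≥0) (ω : Ω) : L2 :=
  ∑' k : ℕ, (((max 1 k : ℕ) : ℝ) ^ (-lam) * B k t ω) • e k

/-! ### The class of fields and the rearranged stochastic heat equation -/

/-- The class `𝒞` of fields `𝒱 : [0, T] × 𝕊 × 𝒫₂(ℝ) → ℝ`. The values of `V` after `T` play no
role. -/
structure IsField (T : ℝ≥0) (V : ℝ≥0 → UnitAddCircle → P2 → ℝ) : Prop where
  measurable : Measurable fun p : Set.Iic T × UnitAddCircle × P2 => V p.1 p.2.1 p.2.2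
  mem_U2 : ∀ t ≤ T, ∀ μ, IsCanonicalNondecreasing fun x => V t x μ
  bounded_lipschitz : ∃ C : ℝ, 0 ≤ C ∧ (∀ t ≤ T, ∀ x μ, |V t x μ| ≤ C) ∧
    ∀ t ≤ T, ∀ μ ν, ∫ x, |V t x μ - V t x ν| ^ 2 ≤ C * W2 μ ν ^ 2

/-- `(X, η)` solves, on `[0, T]`, the rearranged stochastic heat equation
`dX_t = - 𝒱(t, ·, Leb ∘ X_t⁻¹) dt + ΔX_t dt + dW_t + dη_t` with initial condition `x₀`. -/
structure IsSolution (P : Measure Ω) (ℱ : Filtration ℝ≥0 mΩ) (B : ℕ → ℝ≥0 → Ω → ℝ) (lam : ℝ)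
    (T : ℝ≥0) (V : ℝ≥0 → UnitAddCircle → P2 → ℝ) (x₀ : L2)
    (X : ℝ≥0 → Ω → L2) (η : ℝ≥0 → Ω → Hm2sym) : Prop where
  X_mem : ∀ t ≤ T, ∀ ω, X t ω ∈ U2
  X_continuous : ∀ ω, ContinuousOn (fun t => X t ω) (Set.Iic T)
  X_adapted : ∀ t ≤ T, StronglyMeasurable[ℱ t] (X t)
  X_zero : ∀ ω, X 0 ω = x₀
  η_continuous : ∀ ω, ContinuousOn (fun t => η t ω) (Set.Iic T)
  η_adapted : ∀ t ≤ T, StronglyMeasurable[ℱ t] (η t)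
  η_zero : ∀ ω, η 0 ω = 0
  η_monotone : ∀ᵐ ω ∂P, ∀ u : H2sym, u.fn ∈ U2 → MonotoneOn (fun t => η t ω u) (Set.Iic T)
  equation : ∀ᵐ ω ∂P, ∀ u : H2sym, ∀ t ≤ T,
    inner ℝ (X t ω - x₀) u.fn =
      - (∫ r in Set.Iic t, (∫ x, V r x (law (X r ω)) * u.fn x) ∂leb)
      + (∫ r in Set.Iic t, inner ℝ (X r ω) u.lap ∂leb)
      + inner ℝ (noise lam B t ω) u.fn + η t ω u
  reflection_integrable : ∀ t ≤ T, ∀ᶠ ε in 𝓝[>] (0 : ℝ),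
    Integrable (fun ω => pathIntegral (fun r => heat ε (X r ω)) (fun r => η r ω) t) P
  reflection : ∀ t ≤ T,
    Tendsto (fun ε : ℝ => ∫ ω, pathIntegral (fun r => heat ε (X r ω)) (fun r => η r ω) t ∂P)
      (𝓝[>] 0) (𝓝 0)

/-! ### The mean field game -/

/-- The assumptions on each of the cost coefficients `f` and `g`: measurability and linear growth,
differentiability in `x`, with a derivative in `x` that is bounded, non-decreasing in `x` and
jointly Lipschitz continuous. -/
structure IsCostCoefficient (f : ℝ → P2 → ℝ) : Prop where
  measurable : Measurable fun p : ℝ × P2 => f p.1 p.2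
  growth : ∃ C : ℝ, ∀ x μ, |f x μ| ≤ C * √(1 + x ^ 2 + ∫ y, y ^ 2 ∂μ.1)
  differentiable : ∀ μ, Differentiable ℝ fun x => f x μ
  deriv_bounded : ∃ C : ℝ, ∀ x μ, |deriv (fun y => f y μ) x| ≤ C
  deriv_monotone : ∀ μ, Monotone (deriv fun y => f y μ)
  deriv_lipschitz : ∃ C : ℝ, ∀ x y μ ν,
    |deriv (fun z => f z μ) x - deriv (fun z => f z ν) y| ≤ C * (|x - y| + W2 μ ν)

/-- `𝔽`-progressive measurability of a random field on `[0, T] × 𝕊`. -/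
def IsProgressiveField (ℱ : Filtration ℝ≥0 mΩ) (T : ℝ≥0)
    (γ : ℝ≥0 → Ω → UnitAddCircle → ℝ) : Prop :=
  ∀ t ≤ T, Measurable[MeasurableSpace.prod inferInstance (MeasurableSpace.prod (ℱ t) inferInstance)]
    fun p : Set.Iic t × Ω × UnitAddCircle => γ p.1 p.2.1 p.2.2

/-- `(Γ, γ)` is an admissible pair of the control problem in the environment `X` driven by `V`:
progressively measurable fields, `γ` square-integrable, such that
`dΓ_t(x) = dX_t(x) + (γ_t(x) + 𝒱(t, x, Leb ∘ X_t⁻¹)) dt` on `[0, T]` and `Γ_0 = X_0`. -/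
structure IsAdmissible (P : Measure Ω) (ℱ : Filtration ℝ≥0 mΩ) (T : ℝ≥0)
    (V : ℝ≥0 → UnitAddCircle → P2 → ℝ) (X : ℝ≥0 → Ω → L2)
    (Γ γ : ℝ≥0 → Ω → UnitAddCircle → ℝ) : Prop where
  state_progressive : IsProgressiveField ℱ T Γ
  control_progressive : IsProgressiveField ℱ T γ
  control_sq_integrable : ∫⁻ ω, (∫⁻ t in Set.Iic T, (∫⁻ x, ‖γ t ω x‖ₑ ^ 2) ∂leb) ∂P < ⊤
  dynamics : ∀ᵐ ω ∂P, ∀ᵐ x, ∀ t ≤ T, (Γ t ω x : EReal) =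
    canonicalValue (X t ω) x
      + ((∫ s in Set.Iic t, (γ s ω x + V s x (law (X s ω))) ∂leb : ℝ) : EReal)

/-- The cost functional `J`. -/
def cost (P : Measure Ω) (T : ℝ≥0) (f g : ℝ → P2 → ℝ) (X : ℝ≥0 → Ω → L2)
    (Γ γ : ℝ≥0 → Ω → UnitAddCircle → ℝ) : ℝ :=
  ∫ ω, (∫ x, (g (Γ T ω x) (law (X T ω))
    + ∫ t in Set.Iic T, (f (Γ t ω x) (law (X t ω)) + 1 / 2 * |γ t ω x| ^ 2) ∂leb)) ∂P

/-- The field `V`, with `X` the solution of the rearranged stochastic heat equation that it drives,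
forms a mean field equilibrium: `(X_t(x), - 𝒱(t, x, Leb ∘ X_t⁻¹))` is an optimal pair of the
control problem in the environment `X`. -/
def IsMeanFieldEquilibrium (P : Measure Ω) (ℱ : Filtration ℝ≥0 mΩ) (T : ℝ≥0)
    (f g : ℝ → P2 → ℝ) (V : ℝ≥0 → UnitAddCircle → P2 → ℝ) (X : ℝ≥0 → Ω → L2) : Prop :=
  let Γ₀ : ℝ≥0 → Ω → UnitAddCircle → ℝ := fun t ω x => (canonicalValue (X t ω) x).toReal
  let γ₀ : ℝ≥0 → Ω → UnitAddCircle → ℝ := fun t ω x => - V t x (law (X t ω))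
  IsAdmissible P ℱ T V X Γ₀ γ₀ ∧
    ∀ Γ γ : ℝ≥0 → Ω → UnitAddCircle → ℝ, IsAdmissible P ℱ T V X Γ γ →
      cost P T f g X Γ₀ γ₀ ≤ cost P T f g X Γ γ

/-- `∂ₓf(X_t(x), Leb ∘ X_t⁻¹)`, for an environment `u = X_t`. -/
def derivAlong (f : ℝ → P2 → ℝ) (u : L2) (x : UnitAddCircle) : ℝ :=
  extendEReal (deriv fun y => f y (law u)) (canonicalValue u x)

/-- `∂ₓg(X_T(x), Leb ∘ X_T⁻¹) + ∫_t^T ∂ₓf(X_s(x), Leb ∘ X_s⁻¹) ds`. -/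
def costate (T : ℝ≥0) (f g : ℝ → P2 → ℝ) (X : ℝ≥0 → Ω → L2) (t : ℝ≥0) (x : UnitAddCircle)
    (ω : Ω) : ℝ :=
  derivAlong g (X T ω) x + ∫ s in Set.Icc t T, derivAlong f (X s ω) x ∂leb

/-- `R` is the version of the random field `x ↦ 𝔼[Y(x) | 𝓖]` whose realizations are canonical
elements of `U²(𝕊)`. Any two such versions coincide for all `x` simultaneously, almost surely. -/
def IsCondExpField (P : Measure Ω) (𝒢 : MeasurableSpace Ω) (Y : UnitAddCircle → Ω → ℝ)
    (R : Ω → UnitAddCircle → ℝ) : Prop :=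
  (∀ x, Integrable (Y x) P ∧ (fun ω => R ω x) =ᵐ[P] P[Y x | 𝒢]) ∧
    ∀ ω, IsCanonicalNondecreasing (R ω)

/-- The optimality condition: for a.e. `t`, almost surely, for all `x`,
`𝒱(t, x, Leb ∘ X_t⁻¹) = 𝔼[∂ₓg(X_T(x), ·) + ∫_t^T ∂ₓf(X_s(x), ·) ds | 𝓕_t]`. -/
def PontryaginCondition (P : Measure Ω) (ℱ : Filtration ℝ≥0 mΩ) (T : ℝ≥0)
    (f g : ℝ → P2 → ℝ) (V : ℝ≥0 → UnitAddCircle → P2 → ℝ) (X : ℝ≥0 → Ω → L2) : Prop :=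
  ∀ᵐ t : ℝ≥0 ∂(leb.restrict (Set.Iic T)),
    ∃ R : Ω → UnitAddCircle → ℝ, IsCondExpField P (ℱ t) (costate T f g X t) R ∧
      ∀ᵐ ω ∂P, ∀ x, V t x (law (X t ω)) = R ω x

end RSHE

end

noncomputable section

namespace RSHE

section

/-! ### The Lebesgue measure on the time axis -/

/-! The environment `X` is frozen in the control problem, so every admissible control can be written
`γ = b - V`, with state `X + ∫ b`, and the candidate is `b = 0`. Since `f` and `g` are convex in `x`
with Lipschitz derivatives, and the control cost is quadratic, `⟨gap, b⟩ ≤ J(b) - J(0) ≤ ⟨gap, b⟩ +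
C‖b‖²`, where `gap` is the pathwise costate minus the field and the pairing is that of `L²([0,T] × Ω
× 𝕊)` (`IsSolution.stateCost_expansion`, from `pathCost_expansion`). The costate comes out of the
linear terms by Fubini on a triangle (`integral_mul_drift`). So the candidate is optimal exactly
when `gap` is orthogonal to the progressive square-integrable fields, that is, when `V` is the
projection of the costate on the past. Three points need work.

Finiteness. The cost is a Bochner integral, so `J(0)` must be shown to be a genuine expectation; as
`f` and `g` grow linearly, a first moment of `‖X_t‖`, uniform in `t`, is enough
(`IsSolution.lintegral_norm_le`). It follows from a discrete Itô inequality for `√(1 + ⟨e^{εΔ}X,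
X⟩)`. The square root makes the martingale integrand bounded by one, so no localisation is needed.
The Laplacian is dissipative, and the reflection contributes at most `∫ e^{εΔ}X · dη`, whose
expectation vanishes as `ε → 0` by the fourth condition on solutions. This uses that `e^{εΔ}`
preserves the cone `U²` (`heat_mem_U2`, a central limit theorem for moving averages) and that a
functional which is non-negative on the cone is controlled by its value at `-e₁`
(`abs_apply_heat_le`).

Conditional expectations along time. The natural test field `𝔼[costate | ℱ_s] - V_s` need not have a
progressive version at hand. Subtracting the adapted part of the running cost, `gap = Z - U_s` with
`Z` the costate at time zero and `U` progressive; the martingale `𝔼[Z | ℱ_s]` is then sampled at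
earlier grid times, and its `L²` norm, monotone in `s`, is continuous outside a countable set
(`ae_integral_mul_eq_zero`).

From almost every `x` to every `x`. Both sides have one-sidedly continuous, symmetric versions, also
after integration over any event of `ℱ_t`, and such a function vanishes everywhere once it vanishes
almost everywhere (`IsCanonical.eq_zero_of_ae`). This rests on a study of `canonicalValue`,
including its joint measurability. -/

theorem measurableEmbedding_nnreal_coe : MeasurableEmbedding ((↑) : ℝ≥0 → ℝ) :=
  MeasurableEmbedding.subtype_coe measurableSet_Ici

theorem leb_apply (s : Set ℝ≥0) : leb s = volume (((↑) : ℝ≥0 → ℝ) '' s) :=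
  measurableEmbedding_nnreal_coe.comap_apply _ _

theorem coe_image_Ioc (a b : ℝ≥0) :
    ((↑) : ℝ≥0 → ℝ) '' Set.Ioc a b = Set.Ioc (a : ℝ) b := by
  ext x
  constructor
  · rintro ⟨y, hy, rfl⟩
    exact ⟨by exact_mod_cast hy.1, by exact_mod_cast hy.2⟩
  · rintro ⟨h1, h2⟩
    exact ⟨⟨x, a.2.trans h1.le⟩, ⟨h1, h2⟩, rfl⟩

theorem coe_image_Iic (b : ℝ≥0) :
    ((↑) : ℝ≥0 → ℝ) '' Set.Iic b = Set.Icc (0 : ℝ) b := by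
  ext x
  constructor
  · rintro ⟨y, hy, rfl⟩
    exact ⟨y.2, by exact_mod_cast hy⟩
  · rintro ⟨h1, h2⟩
    exact ⟨⟨x, h1⟩, h2, rfl⟩

theorem leb_Ioc (a b : ℝ≥0) : leb (Set.Ioc a b) = ENNReal.ofReal (b - a) := by
  rw [leb_apply, coe_image_Ioc, Real.volume_Ioc]

theorem leb_Iic (b : ℝ≥0) : leb (Set.Iic b) = b := by
  rw [leb_apply, coe_image_Iic, Real.volume_Icc, sub_zero, ENNReal.ofReal_coe_nnreal]

theorem leb_singleton (a : ℝ≥0) : leb {a} = 0 := by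
  rw [leb_apply, Set.image_singleton, Real.volume_singleton]

instance : NullSingletonClass (leb : Measure ℝ≥0) := ⟨leb_singleton⟩

instance (T : ℝ≥0) : IsFiniteMeasure (leb.restrict (Set.Iic T)) :=
  ⟨by rw [Measure.restrict_apply_univ, leb_Iic]; exact ENNReal.coe_lt_top⟩

/-! ### Averages of an integrable function with a monotone version -/

section Averages

variable {H : ℝ → EReal} {U : ℝ → ℝ}

/-- A monotone version may be infinite, whereas `U` is real. Each nontrivial interval contains
points of agreement, and monotonicity propagates the finiteness obtained there. -/
theorem exists_mem_Ioo_of_ae (hHU : ∀ᵐ s : ℝ, s ∈ Set.Ioo (0 : ℝ) (1 / 2) → (U s : EReal) = H s)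
    {a b : ℝ} (ha : 0 ≤ a) (hab : a < b) (hb : b ≤ 1 / 2) :
    ∃ s ∈ Set.Ioo a b, (U s : EReal) = H s := by
  have h0 : volume (Set.Ioo a b) ≠ 0 := by
    rw [Real.volume_Ioo]; simpa using hab
  obtain ⟨s, hs, h⟩ := ((frequently_ae_mem_iff.2 h0).and_eventually hHU).exists
  exact ⟨s, hs, h ⟨ha.trans_lt hs.1, hs.2.trans_le hb⟩⟩

theorem ae_restrict_Icc_of_ae {p : ℝ → Prop} {a b : ℝ} (h : ∀ᵐ s : ℝ, s ∈ Set.Ioo a b → p s) :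
    ∀ᵐ s ∂(volume.restrict (Set.Icc a b)), p s := by
  rw [← Measure.restrict_congr_set Ioo_ae_eq_Icc]
  exact (ae_restrict_iff' measurableSet_Ioo).2 h

theorem le_average {a b c : ℝ} (hab : a < b) (hU : IntervalIntegrable U volume a b)
    (h : ∀ᵐ s : ℝ, s ∈ Set.Ioo a b → c ≤ U s) : c ≤ (b - a)⁻¹ * ∫ s in a..b, U s := by
  have h1 : ∫ _ in a..b, c ≤ ∫ s in a..b, U s :=
    intervalIntegral.integral_mono_ae_restrict hab.le (by simp) hU (ae_restrict_Icc_of_ae h)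
  rw [intervalIntegral.integral_const, smul_eq_mul] at h1
  rwa [le_inv_mul_iff₀ (sub_pos.2 hab)]

theorem average_le {a b c : ℝ} (hab : a < b) (hU : IntervalIntegrable U volume a b)
    (h : ∀ᵐ s : ℝ, s ∈ Set.Ioo a b → U s ≤ c) : (b - a)⁻¹ * ∫ s in a..b, U s ≤ c := by
  have h1 : ∫ s in a..b, U s ≤ ∫ _ in a..b, c :=
    intervalIntegral.integral_mono_ae_restrict hab.le hU (by simp) (ae_restrict_Icc_of_ae h)
  rw [intervalIntegral.integral_const, smul_eq_mul] at h1
  rwa [inv_mul_le_iff₀ (sub_pos.2 hab)]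

/-- By monotonicity the averages never exceed the supremum, and they exceed any value taken at a
point `s' < r` as soon as the window lies to the right of `s'`. The limit is taken in `EReal`
because the supremum may be `⊤` at `r = 1/2`. -/
theorem tendsto_average_left (hH : MonotoneOn H (Set.Ioo 0 (1 / 2)))
    (hU : IntervalIntegrable U volume 0 (1 / 2))
    (hHU : ∀ᵐ s : ℝ, s ∈ Set.Ioo (0 : ℝ) (1 / 2) → (U s : EReal) = H s)
    {r : ℝ} (hr : r ∈ Set.Ioc (0 : ℝ) (1 / 2)) :
    Tendsto (fun δ : ℝ => ((δ⁻¹ * ∫ s in (r - δ)..r, U s : ℝ) : EReal)) (𝓝[>] 0)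
      (𝓝 (sSup (H '' Set.Ioo 0 r))) := by
  have hint : ∀ δ, 0 < δ → δ < r → IntervalIntegrable U volume (r - δ) r := fun δ h1 h2 =>
    hU.mono_set (by
      rw [Set.uIcc_of_le (by linarith), Set.uIcc_of_le (by norm_num)]
      exact Set.Icc_subset_Icc (by linarith) hr.2)
  refine tendsto_order.2 ⟨fun a ha => ?_, fun b hb => ?_⟩
  · obtain ⟨_, ⟨s, hs, rfl⟩, has⟩ := lt_sSup_iff.1 ha
    -- Moving slightly to the right of `s`, to a point of agreement, replaces the possibly infinite
    -- `H s` by the real constant `U s'`.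
    obtain ⟨s', hs', hUs'⟩ := exists_mem_Ioo_of_ae hHU hs.1.le hs.2 hr.2
    have hs0 : s' ∈ Set.Ioo (0 : ℝ) (1 / 2) := ⟨hs.1.trans hs'.1, hs'.2.trans_le hr.2⟩
    have has' : a < (U s' : EReal) := by
      rw [hUs']
      exact has.trans_le (hH ⟨hs.1, hs.2.trans_le hr.2⟩ hs0 hs'.1.le)
    filter_upwards [Ioo_mem_nhdsGT (sub_pos.2 hs'.2)] with δ hδ
    have hδr : δ < r := by linarith [hδ.2, hs0.1]
    have h1 := le_average (c := U s') (sub_lt_self r hδ.1) (hint δ hδ.1 hδr) (by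
      filter_upwards [hHU] with x hx hx'
      have hx0 : x ∈ Set.Ioo (0 : ℝ) (1 / 2) :=
        ⟨by linarith [hx'.1], hx'.2.trans_le hr.2⟩
      rw [← EReal.coe_le_coe_iff, hUs', hx hx0]
      exact hH hs0 hx0 (by linarith [hx'.1, hδ.2]))
    rw [sub_sub_cancel] at h1
    exact has'.trans_le (EReal.coe_le_coe_iff.2 h1)
  · filter_upwards [Ioo_mem_nhdsGT hr.1] with δ hδ
    refine lt_of_le_of_lt ?_ hb
    have hne : sSup (H '' Set.Ioo 0 r) ≠ ⊥ := by
      obtain ⟨s, hs, hUs⟩ := exists_mem_Ioo_of_ae hHU le_rfl hr.1 hr.2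
      exact ne_bot_of_le_ne_bot (EReal.coe_ne_bot (U s)) (hUs ▸ le_sSup ⟨s, hs, rfl⟩)
    have hae : ∀ᵐ s : ℝ, s ∈ Set.Ioo (r - δ) r → (U s : EReal) ≤ sSup (H '' Set.Ioo 0 r) := by
      filter_upwards [hHU] with x hx hx'
      have hx0 : 0 < x := by linarith [hx'.1, hδ.2]
      rw [hx ⟨hx0, hx'.2.trans_le hr.2⟩]
      exact le_sSup ⟨x, ⟨hx0, hx'.2⟩, rfl⟩
    induction h : sSup (H '' Set.Ioo 0 r) with
    | bot => exact absurd h hne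
    | top => exact le_top
    | coe c =>
      rw [h] at hae
      have h1 := average_le (c := c) (sub_lt_self r hδ.1) (hint δ hδ.1 hδ.2)
        (hae.mono fun x hx hx' => EReal.coe_le_coe_iff.1 (hx hx'))
      rw [sub_sub_cancel] at h1
      exact EReal.coe_le_coe_iff.2 h1

theorem tendsto_average_right_zero (hH : MonotoneOn H (Set.Ioo 0 (1 / 2)))
    (hU : IntervalIntegrable U volume 0 (1 / 2))
    (hHU : ∀ᵐ s : ℝ, s ∈ Set.Ioo (0 : ℝ) (1 / 2) → (U s : EReal) = H s) :
    Tendsto (fun δ : ℝ => ((δ⁻¹ * ∫ s in (0 : ℝ)..δ, U s : ℝ) : EReal)) (𝓝[>] 0)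
      (𝓝 (sInf (H '' Set.Ioo 0 (1 / 2)))) := by
  have hint : ∀ δ, 0 < δ → δ < 1 / 2 → IntervalIntegrable U volume 0 δ := fun δ h1 h2 =>
    hU.mono_set (by
      rw [Set.uIcc_of_le h1.le, Set.uIcc_of_le (by norm_num)]
      exact Set.Icc_subset_Icc le_rfl h2.le)
  refine tendsto_order.2 ⟨fun a ha => ?_, fun b hb => ?_⟩
  · filter_upwards [Ioo_mem_nhdsGT (show (0 : ℝ) < 1 / 2 by norm_num)] with δ hδ
    refine lt_of_lt_of_le ha ?_
    have hne : sInf (H '' Set.Ioo 0 (1 / 2)) ≠ ⊤ := by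
      obtain ⟨s, hs, hUs⟩ := exists_mem_Ioo_of_ae hHU le_rfl (by norm_num : (0 : ℝ) < 1 / 2) le_rfl
      exact ne_top_of_le_ne_top (EReal.coe_ne_top (U s)) (hUs ▸ sInf_le ⟨s, hs, rfl⟩)
    have hae : ∀ᵐ s : ℝ, s ∈ Set.Ioo 0 δ → sInf (H '' Set.Ioo 0 (1 / 2)) ≤ (U s : EReal) := by
      filter_upwards [hHU] with x hx hx'
      have hx0 : x ∈ Set.Ioo (0 : ℝ) (1 / 2) := ⟨hx'.1, hx'.2.trans hδ.2⟩
      rw [hx hx0]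
      exact sInf_le ⟨x, hx0, rfl⟩
    induction h : sInf (H '' Set.Ioo 0 (1 / 2)) with
    | bot => exact bot_le
    | top => exact absurd h hne
    | coe c =>
      rw [h] at hae
      have h1 := le_average (c := c) hδ.1 (hint δ hδ.1 hδ.2)
        (hae.mono fun x hx hx' => EReal.coe_le_coe_iff.1 (hx hx'))
      rw [sub_zero] at h1
      exact EReal.coe_le_coe_iff.2 h1
  · obtain ⟨_, ⟨s, hs, rfl⟩, has⟩ := sInf_lt_iff.1 hb
    obtain ⟨s', hs', hUs'⟩ := exists_mem_Ioo_of_ae hHU le_rfl hs.1 hs.2.le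
    have hs0 : s' ∈ Set.Ioo (0 : ℝ) (1 / 2) := ⟨hs'.1, hs'.2.trans hs.2⟩
    have has' : (U s' : EReal) < b := by
      rw [hUs']
      exact (hH hs0 hs hs'.2.le).trans_lt has
    filter_upwards [Ioo_mem_nhdsGT hs'.1] with δ hδ
    have h1 := average_le (c := U s') hδ.1 (hint δ hδ.1 (hδ.2.trans hs0.2)) (by
      filter_upwards [hHU] with x hx hx'
      have hx0 : x ∈ Set.Ioo (0 : ℝ) (1 / 2) := ⟨hx'.1, hx'.2.trans (hδ.2.trans hs0.2)⟩
      rw [← EReal.coe_le_coe_iff, hUs', hx hx0]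
      exact hH hx0 hs0 (hx'.2.trans hδ.2).le)
    rw [sub_zero] at h1
    exact (EReal.coe_le_coe_iff.2 h1).trans_lt has'

end Averages

/-! ### Canonical versions of elements of `U²(𝕊)` -/

theorem ae_coe_of_ae {p : UnitAddCircle → Prop} (h : ∀ᵐ x, p x) :
    ∀ᵐ r : ℝ, p (r : UnitAddCircle) := by
  have key : ∀ n : ℤ, ∀ᵐ r : ℝ, r ∈ Set.Ioc (n : ℝ) (n + 1) → p (r : UnitAddCircle) := fun n =>
    (ae_restrict_iff' measurableSet_Ioc).1
      ((UnitAddCircle.measurePreserving_mk (n : ℝ)).quasiMeasurePreserving.ae h)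
  filter_upwards [ae_all_iff.2 key] with r hr
  -- The intervals are open on the left, so `r` lies in the one starting at `⌈r⌉ - 1`, not at `⌊r⌋`.
  exact hr (⌈r⌉ - 1) ⟨by push_cast; linarith [Int.ceil_lt_add_one r],
    by push_cast; linarith [Int.le_ceil r]⟩

theorem intervalIntegrable_coe {v : UnitAddCircle → ℝ} (hv : Integrable v) (a b : ℝ) :
    IntervalIntegrable (fun r : ℝ => v (r : UnitAddCircle)) volume a b := by
  have hper : Function.Periodic (fun r : ℝ => v (r : UnitAddCircle)) 1 := by
    intro r
    simp
  refine hper.intervalIntegrable one_ne_zero (t := 0) ?_ a b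
  rw [intervalIntegrable_iff_integrableOn_Ioc_of_le (by norm_num)]
  exact (UnitAddCircle.measurePreserving_mk 0).integrable_comp_of_integrable hv

theorem L2.integrable (u : L2) : Integrable u :=
  (Lp.memLp u).integrable (by norm_num)

theorem IsNondecreasing.monotoneOn {h : UnitAddCircle → EReal} (hh : IsNondecreasing h) :
    MonotoneOn (fun r : ℝ => h (r : UnitAddCircle)) (Set.Icc 0 (1 / 2)) := by
  intro a ha b hb hab
  have := hh.2 (show -b ∈ Set.Icc (-1 / 2 : ℝ) 0 from ⟨by linarith [hb.2], by linarith [hb.1]⟩)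
    (show -a ∈ Set.Icc (-1 / 2 : ℝ) 0 from ⟨by linarith [ha.2], by linarith [ha.1]⟩) (by linarith)
  simpa [hh.1] using this

theorem equivIoc_coe {r : ℝ} (hr : r ∈ Set.Ioc (-1 / 2 : ℝ) (1 / 2)) :
    (AddCircle.equivIoc (1 : ℝ) (-1 / 2) (r : UnitAddCircle) : ℝ) = r :=
  congrArg Subtype.val (AddCircle.equivIoc_coe_eq (p := (1 : ℝ)) (a := -1 / 2) (x := r)
    ⟨hr.1, by linarith [hr.2]⟩)

theorem ae_of_ae_coe {p : UnitAddCircle → Prop}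
    (h : ∀ᵐ r : ℝ, r ∈ Set.Ioc (-1 / 2 : ℝ) (-1 / 2 + 1) → p (r : UnitAddCircle)) : ∀ᵐ x, p x := by
  obtain ⟨N, hN, hNm, hN0⟩ := exists_measurable_superset_of_null h
  have hm : Measurable fun x : UnitAddCircle => (AddCircle.equivIoc (1 : ℝ) (-1 / 2) x : ℝ) :=
    measurable_subtype_coe.comp (AddCircle.measurableEquivIoc (1 : ℝ) (-1 / 2)).measurable
  refine measure_mono_null (t := {x | (AddCircle.equivIoc (1 : ℝ) (-1 / 2) x : ℝ) ∈ N})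
    (fun x hx => hN ?_) ?_
  · show ¬ (_ → p _)
    rw [AddCircle.coe_equivIoc]
    exact fun h' => hx (h' (AddCircle.equivIoc (1 : ℝ) (-1 / 2) x).2)
  · change volume ((fun x : UnitAddCircle => (AddCircle.equivIoc (1 : ℝ) (-1 / 2) x : ℝ)) ⁻¹' N) = 0
    rw [← (UnitAddCircle.measurePreserving_mk (-1 / 2)).measure_preimage
      (hm hNm).nullMeasurableSet, Measure.restrict_apply' measurableSet_Ioc]
    refine measure_mono_null (fun r hr => ?_) hN0
    have h1 : (AddCircle.equivIoc (1 : ℝ) (-1 / 2) (r : UnitAddCircle) : ℝ) ∈ N := hr.1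
    rwa [equivIoc_coe ⟨hr.2.1, by linarith [hr.2.2]⟩] at h1

/-- Every point of the circle is represented in `(-1/2, 1/2]`. -/
theorem exists_rep (x : UnitAddCircle) :
    ∃ r : ℝ, r ∈ Set.Ioc (-1 / 2 : ℝ) (1 / 2) ∧ (r : UnitAddCircle) = x := by
  refine ⟨(AddCircle.equivIoc (1 : ℝ) (-1 / 2) x : ℝ), ⟨?_, ?_⟩, ?_⟩
  · exact (AddCircle.equivIoc (1 : ℝ) (-1 / 2) x).2.1
  · linarith [(AddCircle.equivIoc (1 : ℝ) (-1 / 2) x).2.2]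
  · exact AddCircle.coe_equivIoc

/-- A symmetric property that holds on `[0, 1/2]` holds everywhere. -/
theorem forall_of_forall_Icc {p : UnitAddCircle → Prop} (hneg : ∀ x, p (-x) → p x)
    (h : ∀ r ∈ Set.Icc (0 : ℝ) (1 / 2), p (r : UnitAddCircle)) (x : UnitAddCircle) : p x := by
  obtain ⟨r, hr, rfl⟩ := exists_rep x
  rcases le_or_gt 0 r with h0 | h0
  · exact h r ⟨h0, hr.2⟩
  · refine hneg _ ?_
    rw [← AddCircle.coe_neg]
    exact h (-r) ⟨by linarith, by linarith [hr.1]⟩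

theorem ae_ne_point (x₀ : UnitAddCircle) : ∀ᵐ x, x ≠ x₀ := by
  obtain ⟨r₀, hr₀, rfl⟩ := exists_rep x₀
  refine ae_of_ae_coe (p := fun x => x ≠ (r₀ : UnitAddCircle)) ?_
  filter_upwards [(Set.countable_singleton r₀).ae_notMem volume] with r hr hr' heq
  refine hr ?_
  have := congrArg (fun x => (AddCircle.equivIoc (1 : ℝ) (-1 / 2) x : ℝ)) heq
  simp only [equivIoc_coe hr₀, equivIoc_coe (r := r) ⟨hr'.1, by linarith [hr'.2]⟩] at this
  exact this

section Canonical

variable {u : L2} {h : UnitAddCircle → EReal}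

theorem tendsto_canonicalValue_pos (hh : IsNondecreasing h)
    (hu : ∀ᵐ x, ((u x : ℝ) : EReal) = h x) {r : ℝ} (hr : r ∈ Set.Ioc (0 : ℝ) (1 / 2)) :
    Tendsto (fun δ : ℝ => ((δ⁻¹ * ∫ s in (r - δ)..r, u (s : UnitAddCircle) : ℝ) : EReal)) (𝓝[>] 0)
      (𝓝 (sSup ((fun s : ℝ => h (s : UnitAddCircle)) '' Set.Ioo 0 r))) :=
  tendsto_average_left (hh.monotoneOn.mono Set.Ioo_subset_Icc_self)
    (intervalIntegrable_coe u.integrable _ _) ((ae_coe_of_ae hu).mono fun _ hs _ => hs) hr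

theorem tendsto_canonicalValue_zero (hh : IsNondecreasing h)
    (hu : ∀ᵐ x, ((u x : ℝ) : EReal) = h x) :
    Tendsto (fun δ : ℝ => ((δ⁻¹ * ∫ s in (0 : ℝ)..δ, u (s : UnitAddCircle) : ℝ) : EReal)) (𝓝[>] 0)
      (𝓝 (sInf ((fun s : ℝ => h (s : UnitAddCircle)) '' Set.Ioo 0 (1 / 2)))) :=
  tendsto_average_right_zero (hh.monotoneOn.mono Set.Ioo_subset_Icc_self)
    (intervalIntegrable_coe u.integrable _ _) ((ae_coe_of_ae hu).mono fun _ hs _ => hs)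

/-- This left-limit formula holds for any non-decreasing version `h`. It replaces the averages of
the definition in all order arguments below. -/
theorem canonicalValue_pos (hh : IsNondecreasing h)
    (hu : ∀ᵐ x, ((u x : ℝ) : EReal) = h x) {r : ℝ} (hr : r ∈ Set.Ioc (0 : ℝ) (1 / 2)) :
    canonicalValue u (r : UnitAddCircle) = sSup ((fun s : ℝ => h (s : UnitAddCircle)) '' Set.Ioo 0 r) := by
  rw [canonicalValue, equivIoc_coe ⟨by linarith [hr.1], hr.2⟩]
  simp only [hr.1, if_true]
  exact (tendsto_canonicalValue_pos hh hu hr).limUnder_eq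

theorem canonicalValue_zero (hh : IsNondecreasing h)
    (hu : ∀ᵐ x, ((u x : ℝ) : EReal) = h x) :
    canonicalValue u ((0 : ℝ) : UnitAddCircle)
      = sInf ((fun s : ℝ => h (s : UnitAddCircle)) '' Set.Ioo 0 (1 / 2)) := by
  rw [canonicalValue, equivIoc_coe ⟨by norm_num, by norm_num⟩]
  simp only [lt_irrefl, if_false, zero_add]
  exact (tendsto_canonicalValue_zero hh hu).limUnder_eq

theorem integral_neg_arc (hh : IsNondecreasing h)
    (hu : ∀ᵐ x, ((u x : ℝ) : EReal) = h x) (a b : ℝ) :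
    ∫ s in (-b)..(-a), u (s : UnitAddCircle) = ∫ s in a..b, u (s : UnitAddCircle) := by
  rw [← intervalIntegral.integral_comp_neg]
  refine intervalIntegral.integral_congr_ae ?_
  have h1 : ∀ᵐ x, u (-x) = u x := by
    filter_upwards [hu, ae_neg_of_ae hu] with x hx hx'
    rw [← EReal.coe_eq_coe_iff, hx, hx', hh.1]
  filter_upwards [ae_coe_of_ae h1] with s hs _
  rw [AddCircle.coe_neg, hs]

theorem canonicalValue_neg (hu : u ∈ U2) (x : UnitAddCircle) :
    canonicalValue u (-x) = canonicalValue u x := by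
  obtain ⟨h, hh, hu⟩ := hu
  have key : ∀ r ∈ Set.Ioo (0 : ℝ) (1 / 2),
      canonicalValue u ((-r : ℝ) : UnitAddCircle) = canonicalValue u (r : UnitAddCircle) := by
    intro r hr
    rw [canonicalValue, canonicalValue, equivIoc_coe ⟨by linarith [hr.2], by linarith [hr.1]⟩,
      equivIoc_coe ⟨by linarith [hr.1], hr.2.le⟩]
    have h1 : ¬ 0 < -r := by linarith [hr.1]
    simp only [h1, if_false, hr.1, if_true]
    congr 1
    funext δ
    rw [← integral_neg_arc hh hu (r - δ) r]
    congr 4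
    ring
  obtain ⟨r, hr, rfl⟩ := exists_rep x
  rw [← AddCircle.coe_neg]
  rcases lt_trichotomy r 0 with h0 | rfl | h0
  · have := key (-r) ⟨by linarith, by linarith [hr.1]⟩
    rw [neg_neg] at this
    exact this.symm
  · rw [neg_zero]
  · rcases hr.2.lt_or_eq with h1 | rfl
    · exact key r ⟨h0, h1⟩
    -- The points `1/2` and `-1/2` differ by one period, hence coincide on the circle.
    · congr 1
      rw [← sub_eq_zero, ← AddCircle.coe_sub]
      norm_num


theorem canonicalValue_le_version (hh : IsNondecreasing h)
    (hu : ∀ᵐ x, ((u x : ℝ) : EReal) = h x) {r : ℝ} (hr : r ∈ Set.Ioc (0 : ℝ) (1 / 2)) :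
    canonicalValue u (r : UnitAddCircle) ≤ h (r : UnitAddCircle) := by
  rw [canonicalValue_pos hh hu hr]
  refine sSup_le ?_
  rintro _ ⟨s, hs, rfl⟩
  exact hh.monotoneOn ⟨hs.1.le, hs.2.le.trans hr.2⟩ ⟨hr.1.le, hr.2⟩ hs.2.le

/-- Together with `canonicalValue_le_version`, this squeezes the canonical value at `r` between the
version strictly before `r` and the version at `r`. One-sided continuity, finiteness and almost
everywhere equality all follow from these two bounds. -/
theorem version_le_canonicalValue (hh : IsNondecreasing h)
    (hu : ∀ᵐ x, ((u x : ℝ) : EReal) = h x) {s r : ℝ} (hs : 0 < s) (hsr : s < r) (hr : r ≤ 1 / 2) :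
    h (s : UnitAddCircle) ≤ canonicalValue u (r : UnitAddCircle) := by
  rw [canonicalValue_pos hh hu ⟨hs.trans hsr, hr⟩]
  exact le_sSup ⟨s, ⟨hs, hsr⟩, rfl⟩

theorem monotoneOn_canonicalValue (hu : u ∈ U2) :
    MonotoneOn (fun r : ℝ => canonicalValue u (r : UnitAddCircle)) (Set.Ioc 0 (1 / 2)) := by
  obtain ⟨h, hh, hu⟩ := hu
  intro a ha b hb hab
  simp only
  rw [canonicalValue_pos hh hu ha, canonicalValue_pos hh hu hb]
  exact sSup_le_sSup (Set.image_mono (Set.Ioo_subset_Ioo_right hab))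

theorem canonicalValue_ne_bot (hu : u ∈ U2) {r : ℝ} (hr : r ∈ Set.Ioc (0 : ℝ) (1 / 2)) :
    canonicalValue u (r : UnitAddCircle) ≠ ⊥ := by
  obtain ⟨h, hh, hu⟩ := hu
  obtain ⟨s, hs, hUs⟩ := exists_mem_Ioo_of_ae (U := fun s : ℝ => u (s : UnitAddCircle))
    (H := fun s : ℝ => h (s : UnitAddCircle))
    ((ae_coe_of_ae hu).mono fun _ hs _ => hs) le_rfl hr.1 hr.2
  refine ne_bot_of_le_ne_bot (EReal.coe_ne_bot (u (s : UnitAddCircle))) ?_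
  rw [hUs]
  exact version_le_canonicalValue hh hu hs.1 hs.2 hr.2

theorem canonicalValue_ne_top (hu : u ∈ U2) {r : ℝ} (hr : r ∈ Set.Ioo (0 : ℝ) (1 / 2)) :
    canonicalValue u (r : UnitAddCircle) ≠ ⊤ := by
  obtain ⟨h, hh, hu⟩ := hu
  obtain ⟨s, hs, hUs⟩ := exists_mem_Ioo_of_ae (U := fun s : ℝ => u (s : UnitAddCircle))
    (H := fun s : ℝ => h (s : UnitAddCircle))
    ((ae_coe_of_ae hu).mono fun _ hs _ => hs) hr.1.le hr.2 le_rfl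
  refine ne_top_of_le_ne_top (EReal.coe_ne_top (u (s : UnitAddCircle))) ?_
  rw [hUs]
  exact (canonicalValue_le_version hh hu ⟨hr.1, hr.2.le⟩).trans
    (hh.monotoneOn ⟨hr.1.le, hr.2.le⟩ ⟨hr.1.le.trans hs.1.le, hs.2.le⟩ hs.1.le)

/-- The points where the canonical version is finite. -/
theorem coe_toReal_canonicalValue (hu : u ∈ U2) {x : UnitAddCircle} (h0 : x ≠ ((0 : ℝ) : UnitAddCircle))
    (h1 : x ≠ ((1 / 2 : ℝ) : UnitAddCircle)) :
    ((canonicalValue u x).toReal : EReal) = canonicalValue u x := by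
  have key : ∀ r ∈ Set.Ioo (0 : ℝ) (1 / 2), ((canonicalValue u (r : UnitAddCircle)).toReal : EReal)
      = canonicalValue u (r : UnitAddCircle) := fun r hr =>
    EReal.coe_toReal (canonicalValue_ne_top hu hr) (canonicalValue_ne_bot hu ⟨hr.1, hr.2.le⟩)
  obtain ⟨r, hr, rfl⟩ := exists_rep x
  rcases lt_trichotomy r 0 with h2 | rfl | h2
  · rw [← canonicalValue_neg hu, ← AddCircle.coe_neg]
    exact key (-r) ⟨by linarith, by linarith [hr.1]⟩
  · exact absurd rfl h0
  · rcases hr.2.lt_or_eq with h3 | rfl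
    · exact key r ⟨h2, h3⟩
    · exact absurd rfl h1

theorem isCanonical_canonicalValue (hu : u ∈ U2) : IsCanonical (canonicalValue u) := by
  obtain ⟨h, hh, hu⟩ := hu
  constructor
  · show Tendsto _ _ (𝓝 (canonicalValue u ((0 : ℝ) : UnitAddCircle)))
    rw [canonicalValue_zero hh hu, ← Set.Ioi_insert, nhdsWithin_insert, tendsto_sup]
    refine ⟨?_, ?_⟩
    · rw [tendsto_pure_left]
      intro s hs
      rw [canonicalValue_zero hh hu]
      exact mem_of_mem_nhds hs
    · refine tendsto_order.2 ⟨fun a ha => ?_, fun b hb => ?_⟩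
      · filter_upwards [Ioo_mem_nhdsGT (show (0 : ℝ) < 1 / 2 by norm_num)] with r hr
        refine ha.trans_le ?_
        refine le_trans (sInf_le ⟨r / 2, ⟨by linarith [hr.1], by linarith [hr.2]⟩, rfl⟩)
          (version_le_canonicalValue hh hu (by linarith [hr.1]) (by linarith [hr.1]) hr.2.le)
      · obtain ⟨_, ⟨s, hs, rfl⟩, has⟩ := sInf_lt_iff.1 hb
        filter_upwards [Ioo_mem_nhdsGT hs.1] with r hr
        refine lt_of_le_of_lt ?_ has
        exact (canonicalValue_le_version hh hu ⟨hr.1, hr.2.le.trans hs.2.le⟩).trans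
          (hh.monotoneOn ⟨hr.1.le, hr.2.le.trans hs.2.le⟩ ⟨hs.1.le, hs.2.le⟩ hr.2.le)
  · intro r hr
    show Tendsto _ _ (𝓝 (canonicalValue u (r : UnitAddCircle)))
    rw [← Set.Iio_insert, nhdsWithin_insert, tendsto_sup]
    refine ⟨?_, ?_⟩
    · rw [tendsto_pure_left]
      intro s hs
      exact mem_of_mem_nhds hs
    · refine tendsto_order.2 ⟨fun a ha => ?_, fun b hb => ?_⟩
      · rw [canonicalValue_pos hh hu hr] at ha
        obtain ⟨_, ⟨s, hs, rfl⟩, has⟩ := lt_sSup_iff.1 ha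
        filter_upwards [Ioo_mem_nhdsLT hs.2] with s' hs'
        exact has.trans_le (version_le_canonicalValue hh hu hs.1 hs'.1 (hs'.2.le.trans hr.2))
      · filter_upwards [Ioo_mem_nhdsLT hr.1] with s hs
        exact (monotoneOn_canonicalValue ⟨h, hh, hu⟩ ⟨hs.1, hs.2.le.trans hr.2⟩ hr hs.2.le).trans_lt hb

/-- A monotone version has at most countably many discontinuities, and at a continuity point the two
squeezing bounds force equality with the canonical value. Symmetry transfers this from `(0, 1/2)` to
the other half of the circle. -/
theorem ae_eq_canonicalValue (hu : u ∈ U2) :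
    ∀ᵐ x, ((u x : ℝ) : EReal) = canonicalValue u x := by
  have hu' := hu
  obtain ⟨h, hh, hu⟩ := hu
  have hc := (hh.monotoneOn.mono (Set.Ioo_subset_Icc_self)).countable_not_continuousWithinAt
  have h1 : ∀ᵐ r : ℝ, r ∈ Set.Ioo (0 : ℝ) (1 / 2) →
      h (r : UnitAddCircle) = canonicalValue u (r : UnitAddCircle) := by
    filter_upwards [hc.ae_notMem volume] with r hr hr'
    simp only [not_and, not_not] at hr
    have h2 : Tendsto (fun s : ℝ => h (s : UnitAddCircle)) (𝓝[<] r) (𝓝 (h (r : UnitAddCircle))) :=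
      ((hr hr').continuousAt (Ioo_mem_nhds hr'.1 hr'.2)).mono_left nhdsWithin_le_nhds
    refine le_antisymm (le_of_tendsto h2 ?_) (canonicalValue_le_version hh hu ⟨hr'.1, hr'.2.le⟩)
    filter_upwards [Ioo_mem_nhdsLT hr'.1] with s hs
    exact version_le_canonicalValue hh hu hs.1 hs.2 hr'.2.le
  have h2 : ∀ᵐ r : ℝ, r ∈ Set.Ioc (-1 / 2 : ℝ) (-1 / 2 + 1) →
      h (r : UnitAddCircle) = canonicalValue u (r : UnitAddCircle) := by
    have h3 := (Measure.measurePreserving_neg (volume : Measure ℝ)).quasiMeasurePreserving.ae h1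
    filter_upwards [h1, h3, ((Set.countable_singleton (0 : ℝ)).insert (1 / 2)).ae_notMem volume]
      with r ha hb hr hr'
    simp only [Set.mem_insert_iff, Set.mem_singleton_iff, not_or] at hr
    rcases lt_or_gt_of_ne hr.2 with h4 | h4
    · have := hb ⟨by linarith, by linarith [hr'.1]⟩
      rwa [AddCircle.coe_neg, hh.1, canonicalValue_neg hu'] at this
    · exact ha ⟨h4, lt_of_le_of_ne (by linarith [hr'.2]) hr.1⟩
  filter_upwards [hu, ae_of_ae_coe (p := fun x => h x = canonicalValue u x) h2] with x ha hb
  rw [ha, hb]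

end Canonical

theorem ae_canonicalValue_finite {u : L2} (hu : u ∈ U2) :
    ∀ᵐ x, u x = (canonicalValue u x).toReal := by
  filter_upwards [ae_eq_canonicalValue hu] with x hx
  rw [← hx, EReal.toReal_coe]

/-! ### Joint measurability of the canonical version, and of the law -/

/-- An arc of length at most `n` is covered by `n` full periods, so the integral is `n`-Lipschitz
for the `L¹` norm, and hence for the `L²` norm since the circle has mass one. -/
theorem continuous_integral_arc (a b : ℝ) :
    Continuous fun u : L2 => ∫ s in a..b, u (s : UnitAddCircle) := by
  obtain ⟨n, hn⟩ := exists_nat_ge |b - a|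
  have hper : ∀ v : UnitAddCircle → ℝ, Function.Periodic (fun r : ℝ => v (r : UnitAddCircle)) 1 :=
    fun v r => by simp
  have key : ∀ u v : L2, |(∫ s in a..b, u (s : UnitAddCircle)) - ∫ s in a..b, v (s : UnitAddCircle)|
      ≤ n * ‖u - v‖ := by
    intro u v
    rw [← intervalIntegral.integral_sub (intervalIntegrable_coe u.integrable _ _)
      (intervalIntegrable_coe v.integrable _ _)]
    have hi : Integrable fun x => |u x - v x| := (u.integrable.sub v.integrable).abs
    have h1 : |∫ s in a..b, (u (s : UnitAddCircle) - v (s : UnitAddCircle))|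
        ≤ ∫ s in (min a b)..(min a b + n), |u (s : UnitAddCircle) - v (s : UnitAddCircle)| := by
      rw [← Real.norm_eq_abs]
      refine (intervalIntegral.norm_integral_le_integral_norm_uIoc).trans ?_
      rw [intervalIntegral.integral_of_le (by simp)]
      refine setIntegral_mono_set ?_ (ae_of_all _ fun x => abs_nonneg _) ?_
      · have := intervalIntegrable_coe hi (min a b) (min a b + n)
        rwa [intervalIntegrable_iff_integrableOn_Ioc_of_le (by simp)] at this
      · refine (Set.Ioc_subset_Ioc_right ?_).eventuallyLE
        rcases le_total a b with h | h
        · rw [abs_of_nonneg (by linarith)] at hn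
          simp [h]; linarith
        · rw [abs_of_nonpos (by linarith)] at hn
          simp [h]; linarith
    refine h1.trans ?_
    have h2 := (hper (fun x => |u x - v x|)).intervalIntegral_add_zsmul_eq n (min a b)
      (fun _ _ => intervalIntegrable_coe hi _ _)
    simp only [zsmul_eq_mul, Int.cast_natCast, mul_one] at h2
    rw [h2]
    have h3 := UnitAddCircle.intervalIntegral_preimage (min a b) (fun x => |u x - v x|)
    rw [h3]
    refine mul_le_mul_of_nonneg_left ?_ (Nat.cast_nonneg n)
    have h4 : ∫ x, |u x - v x| = ∫ x, ‖(u - v) x‖ := by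
      refine integral_congr_ae ?_
      filter_upwards [Lp.coeFn_sub u v] with x hx
      rw [hx, Real.norm_eq_abs, Pi.sub_apply]
    rw [h4, Lp.norm_def, integral_norm_eq_lintegral_enorm (Lp.aestronglyMeasurable _),
      ← eLpNorm_one_eq_lintegral_enorm]
    exact ENNReal.toReal_mono (Lp.eLpNorm_ne_top _)
      (eLpNorm_le_eLpNorm_of_exponent_le (by norm_num) (Lp.aestronglyMeasurable _))
  refine continuous_iff_continuousAt.2 fun u => ?_
  refine Metric.tendsto_nhds_nhds.2 fun ε hε => ⟨ε / (n + 1), by positivity, fun {v} hv => ?_⟩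
  rw [Real.dist_eq]
  refine (key v u).trans_lt ?_
  rw [dist_eq_norm, lt_div_iff₀ (by positivity)] at hv
  nlinarith [norm_nonneg (v - u)]

/-- Carathéodory argument: the integral is continuous in the position of the window and measurable
in the parameter, hence jointly measurable. -/
theorem measurable_integral_arc {α : Type*} [MeasurableSpace α] {Y : α → L2}
    (hY : StronglyMeasurable Y) (c d : ℝ) :
    Measurable fun p : α × ℝ => ∫ s in (p.2 + c)..(p.2 + d), (Y p.1) (s : UnitAddCircle) := by
  have h := stronglyMeasurable_uncurry_of_continuous_of_stronglyMeasurable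
    (u := fun (r : ℝ) (a : α) => ∫ s in (r + c)..(r + d), (Y a) (s : UnitAddCircle)) ?_ ?_
  · exact h.measurable.comp measurable_swap
  · intro a
    have hi := intervalIntegrable_coe (Y a).integrable
    have h1 : Continuous fun r : ℝ => ∫ s in (0 : ℝ)..r, (Y a) (s : UnitAddCircle) :=
      intervalIntegral.continuous_primitive hi 0
    have h2 : ∀ r : ℝ, ∫ s in (r + c)..(r + d), (Y a) (s : UnitAddCircle)
        = (∫ s in (0 : ℝ)..(r + d), (Y a) (s : UnitAddCircle))
          - ∫ s in (0 : ℝ)..(r + c), (Y a) (s : UnitAddCircle) := fun r =>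
      (intervalIntegral.integral_interval_sub_left (hi _ _) (hi _ _)).symm
    simp only [h2]
    exact (h1.comp (by fun_prop)).sub (h1.comp (by fun_prop))
  · intro r
    exact (continuous_integral_arc _ _).comp_stronglyMeasurable hY

/-- The canonical value is the limit, along `δ = 1/(n+1)`, of averages that are jointly measurable.
Membership in `U²` guarantees that the limits exist, so `limUnder` never falls back on its default
value. -/
theorem measurable_canonicalValue {α : Type*} [MeasurableSpace α] {Y : α → L2}
    (hY : StronglyMeasurable Y) (hU : ∀ a, Y a ∈ U2) :
    Measurable fun p : α × UnitAddCircle => canonicalValue (Y p.1) p.2 := by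
  let rep : UnitAddCircle → ℝ := fun x => (AddCircle.equivIoc (1 : ℝ) (-1 / 2) x : ℝ)
  have hrep : Measurable rep :=
    measurable_subtype_coe.comp (AddCircle.measurableEquivIoc (1 : ℝ) (-1 / 2)).measurable
  let δ : ℕ → ℝ := fun n => 1 / ((n : ℝ) + 1)
  have hδ : Tendsto δ atTop (𝓝[>] 0) := by
    refine tendsto_nhdsWithin_iff.2 ⟨tendsto_one_div_add_atTop_nhds_zero_nat, ?_⟩
    refine Eventually.of_forall fun n => ?_
    show (0 : ℝ) < 1 / ((n : ℝ) + 1)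
    positivity
  let A : ℕ → α × UnitAddCircle → EReal := fun n p =>
    if 0 < rep p.2 then
      (((δ n)⁻¹ * ∫ s in (rep p.2 + -δ n)..(rep p.2 + 0), (Y p.1) (s : UnitAddCircle) : ℝ) : EReal)
    else (((δ n)⁻¹ * ∫ s in (rep p.2 + 0)..(rep p.2 + δ n), (Y p.1) (s : UnitAddCircle) : ℝ) : EReal)
  have hA : ∀ n, Measurable (A n) := by
    intro n
    have h1 : Measurable fun p : α × UnitAddCircle => (p.1, rep p.2) :=
      measurable_fst.prodMk (hrep.comp measurable_snd)
    refine Measurable.ite (measurableSet_lt measurable_const (hrep.comp measurable_snd)) ?_ ?_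
    · exact measurable_coe_real_ereal.comp
        (((measurable_integral_arc hY (-δ n) 0).comp h1).const_mul _)
    · exact measurable_coe_real_ereal.comp
        (((measurable_integral_arc hY 0 (δ n)).comp h1).const_mul _)
  refine measurable_of_tendsto_metrizable hA (tendsto_pi_nhds.2 ?_)
  rintro ⟨a, x⟩
  have hUa := hU a
  obtain ⟨h, hh, hu⟩ := hU a
  obtain ⟨r, hr, rfl⟩ := exists_rep x
  have hr' : rep (r : UnitAddCircle) = r := equivIoc_coe hr
  simp only [A, hr', add_zero, ← sub_eq_add_neg]
  rcases lt_trichotomy r 0 with h0 | rfl | h0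
  · have hmem : -r ∈ Set.Ioc (0 : ℝ) (1 / 2) := ⟨by linarith, by linarith [hr.1]⟩
    have h1 := (tendsto_canonicalValue_pos hh hu hmem).comp hδ
    rw [← canonicalValue_pos hh hu hmem, AddCircle.coe_neg, canonicalValue_neg hUa] at h1
    refine h1.congr fun n => ?_
    simp only [not_lt.2 h0.le, if_false, Function.comp]
    rw [← integral_neg_arc hh hu r (r + δ n), neg_add']
  · have h1 := (tendsto_canonicalValue_zero hh hu).comp hδ
    rw [← canonicalValue_zero hh hu] at h1
    refine h1.congr fun n => ?_
    simp [Function.comp]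
  · have hmem : r ∈ Set.Ioc (0 : ℝ) (1 / 2) := ⟨h0, hr.2⟩
    have h1 := (tendsto_canonicalValue_pos hh hu hmem).comp hδ
    rw [← canonicalValue_pos hh hu hmem] at h1
    refine h1.congr fun n => ?_
    simp [h0, Function.comp]

/-- The mass given to a set `s` is the measure of a section of a jointly measurable set, thanks to
the jointly measurable choice of versions provided by `canonicalValue`. -/
theorem measurable_law {α : Type*} [MeasurableSpace α] {Y : α → L2}
    (hY : StronglyMeasurable Y) (hU : ∀ a, Y a ∈ U2) : Measurable fun a => law (Y a) := by
  refine Measurable.subtype_mk (Measure.measurable_of_measurable_coe _ fun s hs => ?_)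
  have h1 : ∀ a, (volume : Measure UnitAddCircle).map (Y a) s
      = volume (Prod.mk a ⁻¹' ((fun p : α × UnitAddCircle => (canonicalValue (Y p.1) p.2).toReal) ⁻¹' s)) := by
    intro a
    rw [Measure.map_apply_of_aemeasurable (Lp.aestronglyMeasurable (Y a)).aemeasurable hs]
    refine measure_congr ?_
    filter_upwards [ae_canonicalValue_finite (hU a)] with x hx
    exact congrArg (· ∈ s) hx
  show Measurable fun a => (volume : Measure UnitAddCircle).map (Y a) s
  simp only [h1]
  exact measurable_measure_prodMk_left ((measurable_canonicalValue hY hU).ereal_toReal hs)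

end

/-! ### The cosine basis -/

theorem hasSum_of_eq {E : Type*} [AddCommMonoid E] [TopologicalSpace E] {f g : ℕ → E} {a : E}
    (hf : HasSum f a) (h : ∀ k, f k = g k) : HasSum g a := by
  rwa [← funext h]

theorem integral_cos_nat (m : ℤ) (hm : m ≠ 0) : ∫ r in (0 : ℝ)..1, Real.cos (2 * Real.pi * m * r) = 0 := by
  have hc : (2 * Real.pi * m : ℝ) ≠ 0 := by
    have : (m : ℝ) ≠ 0 := by exact_mod_cast hm
    positivity
  rw [intervalIntegral.integral_comp_mul_left (fun x => Real.cos x) hc, integral_cos]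
  have : Real.sin (2 * Real.pi * m) = 0 := by
    have := Real.sin_int_mul_pi (2 * m)
    rw [← this]; push_cast; ring_nf
  simp [this]

theorem inner_e (j k : ℕ) : inner ℝ (e j) (e k) = if j = k then (1 : ℝ) else 0 := by
  rw [e, e, inner_smul_left, inner_smul_right, inner_toL2]
  simp only [cosMap_coe]
  have h1 : ∀ r : ℝ, Real.cos (2 * Real.pi * j * r) * Real.cos (2 * Real.pi * k * r)
      = (1 / 2) * Real.cos (2 * Real.pi * ((j - k : ℤ) : ℝ) * r)
        + (1 / 2) * Real.cos (2 * Real.pi * ((j + k : ℤ) : ℝ) * r) := by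
    intro r
    have := Real.two_mul_cos_mul_cos (2 * Real.pi * j * r) (2 * Real.pi * k * r)
    push_cast
    rw [show 2 * Real.pi * ((j : ℝ) - k) * r = 2 * Real.pi * j * r - 2 * Real.pi * k * r by ring,
      show 2 * Real.pi * ((j : ℝ) + k) * r = 2 * Real.pi * j * r + 2 * Real.pi * k * r by ring]
    linarith
  simp only [h1]
  rw [intervalIntegral.integral_add (by apply Continuous.intervalIntegrable; fun_prop)
    (by apply Continuous.intervalIntegrable; fun_prop), intervalIntegral.integral_const_mul,
    intervalIntegral.integral_const_mul]
  by_cases hjk : j = k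
  · subst hjk
    by_cases hj : j = 0
    · subst hj; simp [cosNorm]; norm_num
    · rw [integral_cos_nat ((j : ℤ) + j) (by omega)]
      simp [cosNorm, hj]
      rw [← mul_assoc, Real.mul_self_sqrt (by norm_num)]
      norm_num
  · rw [integral_cos_nat _ (by omega), integral_cos_nat _ (by omega)]
    simp [hjk]

theorem orthonormal_e : Orthonormal ℝ e := orthonormal_iff_ite.2 inner_e

/-- Symmetric elements of `L²(𝕊)`. -/
def IsSymm (u : L2) : Prop := ∀ᵐ x, u (-x) = u x

theorem isSymm_of_mem_U2 {u : L2} (hu : u ∈ U2) : IsSymm u := by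
  obtain ⟨h, hh, hu⟩ := hu
  filter_upwards [hu, ae_neg_of_ae hu] with x hx hx'
  rw [← EReal.coe_eq_coe_iff, hx, hx', hh.1]

theorem volume_eq_haar : (volume : Measure UnitAddCircle) = AddCircle.haarAddCircle := by
  rw [AddCircle.volume_eq_smul_haarAddCircle]; simp

theorem integral_haar {E : Type*} [NormedAddCommGroup E] [NormedSpace ℝ E] (F : UnitAddCircle → E) :
    ∫ x, F x ∂(AddCircle.haarAddCircle (T := 1)) = ∫ x, F x := by
  rw [volume_eq_haar]

theorem ae_haar {p : UnitAddCircle → Prop} (h : ∀ᵐ x ∂(AddCircle.haarAddCircle (T := 1)), p x) :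
    ∀ᵐ x, p x := by
  rwa [volume_eq_haar]

theorem toL2_coeFn (φ : C(UnitAddCircle, ℝ)) : toL2 φ =ᵐ[volume] φ :=
  ContinuousMap.coeFn_toLp (p := 2) (𝕜 := ℝ) (volume : Measure UnitAddCircle) φ

theorem inner_toL2_left (φ : C(UnitAddCircle, ℝ)) (u : L2) :
    inner ℝ (toL2 φ) u = ∫ x, φ x * u x := by
  rw [L2.inner_def]
  refine integral_congr_ae ?_
  filter_upwards [toL2_coeFn φ] with x hx
  simp [hx, mul_comm]

theorem inner_e_eq_integral (k : ℕ) (u : L2) :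
    inner ℝ (e k) u = cosNorm k * ∫ x, cosMap k x * u x := by
  rw [e, inner_smul_left, inner_toL2_left]; simp

theorem sinMap_neg (k : ℕ) (x : UnitAddCircle) : sinMap k (-x) = -sinMap k x := by
  induction x using QuotientAddGroup.induction_on with
  | H r =>
    rw [← AddCircle.coe_neg, sinMap_coe, sinMap_coe]
    simp

theorem cosMap_neg (k : ℕ) (x : UnitAddCircle) : cosMap k (-x) = cosMap k x := by
  induction x using QuotientAddGroup.induction_on with
  | H r =>
    rw [← AddCircle.coe_neg, cosMap_coe, cosMap_coe]
    simp

theorem integrable_continuousMap_mul (φ : C(UnitAddCircle, ℝ)) (u : L2) :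
    Integrable fun x => φ x * u x :=
  u.integrable.bdd_mul φ.continuous.aestronglyMeasurable
    (c := ‖φ‖) (ae_of_all _ fun x => φ.norm_coe_le_norm x)

theorem integral_sinMap_mul {u : L2} (hu : IsSymm u) (k : ℕ) : ∫ x, sinMap k x * u x = 0 := by
  have h1 : ∫ x, sinMap k x * u x = ∫ x, sinMap k (-x) * u (-x) :=
    (integral_neg_eq_self (fun x => sinMap k x * u x) volume).symm
  have h2 : ∫ x, sinMap k (-x) * u (-x) = - ∫ x, sinMap k x * u x := by
    rw [← integral_neg]
    refine integral_congr_ae ?_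
    filter_upwards [hu] with x hx
    rw [hx, sinMap_neg]; ring
  linarith

theorem norm_fourier_integral {u : L2} (hu : IsSymm u) (n : ℤ) :
    ‖∫ x, fourier n x • ((u x : ℝ) : ℂ)‖ ^ 2 = (∫ x, cosMap n.natAbs x * u x) ^ 2 := by
  have h0 : ∀ x : UnitAddCircle, fourier n x
      = ((cosMap n.natAbs x : ℝ) : ℂ) + ((n.sign * sinMap n.natAbs x : ℝ) : ℂ) * Complex.I := by
    intro x
    rcases Int.natAbs_eq n with h | h
    · rcases Nat.eq_zero_or_pos n.natAbs with h0 | h0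
      · have hn : n = 0 := Int.natAbs_eq_zero.1 h0
        subst hn
        simp [cosMap]
      · have hs : n.sign = 1 := Int.sign_eq_one_of_pos (by omega)
        conv_lhs => rw [h]
        rw [hs]
        simp [cosMap, sinMap, Complex.re_add_im]
    · rcases Nat.eq_zero_or_pos n.natAbs with h0 | h0
      · have hn : n = 0 := Int.natAbs_eq_zero.1 h0
        subst hn
        simp [cosMap]
      · have hs : n.sign = -1 := Int.sign_eq_neg_one_of_neg (by omega)
        conv_lhs => rw [h]
        rw [hs, fourier_neg]
        apply Complex.ext <;> simp [cosMap, sinMap]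
  have h1 : ∫ x, fourier n x • ((u x : ℝ) : ℂ)
      = ((∫ x, cosMap n.natAbs x * u x : ℝ) : ℂ)
        + (((n.sign : ℝ) * ∫ x, sinMap n.natAbs x * u x : ℝ) : ℂ) * Complex.I := by
    have h2 : ∀ x : UnitAddCircle, fourier n x • ((u x : ℝ) : ℂ)
        = ((cosMap n.natAbs x * u x : ℝ) : ℂ)
          + ((n.sign * (sinMap n.natAbs x * u x) : ℝ) : ℂ) * Complex.I := by
      intro x
      rw [h0, smul_eq_mul]; push_cast; ring
    simp only [h2]
    rw [integral_add, integral_mul_const, integral_complex_ofReal, integral_complex_ofReal,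
      integral_const_mul]
    · exact (integrable_continuousMap_mul _ u).ofReal
    · exact (((integrable_continuousMap_mul _ u).const_mul _).ofReal).mul_const _
  rw [h1, integral_sinMap_mul hu]
  simp

/-- Parseval for the complex Fourier series. By symmetry the sine integrals vanish, and the
frequencies `n` and `-n` contribute equally, which is the factor `cosNorm k ^ 2 = 2`. -/
theorem hasSum_sq_inner_e {u : L2} (hu : IsSymm u) :
    HasSum (fun k => inner ℝ (e k) u ^ 2) (‖u‖ ^ 2) := by
  have hm : MemLp (fun x => ((u x : ℝ) : ℂ)) 2 (AddCircle.haarAddCircle (T := 1)) := by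
    rw [← volume_eq_haar]
    exact (Lp.memLp u).ofReal
  have h1 := hasSum_sq_fourierCoeff hm.toLp
  have hc : ∀ n : ℤ, ‖fourierCoeff hm.toLp n‖ ^ 2 = (∫ x, cosMap n.natAbs x * u x) ^ 2 := by
    intro n
    rw [← Int.natAbs_neg n, ← norm_fourier_integral hu, fourierCoeff]
    congr 2
    rw [integral_haar]
    refine integral_congr_ae ?_
    filter_upwards [ae_haar hm.coeFn_toLp] with x hx
    rw [hx]
  have hn : ∫ t, ‖hm.toLp _ t‖ ^ 2 ∂(AddCircle.haarAddCircle (T := 1)) = ‖u‖ ^ 2 := by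
    rw [← real_inner_self_eq_norm_sq, L2.inner_def, integral_haar]
    refine integral_congr_ae ?_
    filter_upwards [ae_haar hm.coeFn_toLp] with x hx
    rw [hx]
    simp [sq]
  rw [hn] at h1
  simp only [hc] at h1
  have h2 := h1.nat_add_neg
  simp only [Int.natAbs_natCast, Int.natAbs_neg, Int.natAbs_zero] at h2
  -- Pairing `n` with `-n` counts the zero frequency twice; the extra copy is removed.
  have h3 := h2.sub (hasSum_ite_eq (0 : ℕ) ((∫ x, cosMap 0 x * u x) ^ 2))
  rw [add_sub_cancel_right] at h3
  refine hasSum_of_eq h3 fun k => ?_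
  rw [inner_e_eq_integral]
  by_cases hk : k = 0
  · subst hk; simp [cosNorm]
  · simp only [cosNorm, hk, if_false, sub_zero, mul_pow]
    rw [Real.sq_sqrt (by norm_num)]
    ring

theorem sum_inner_e_smul_inner (s : Finset ℕ) (c : ℕ → ℝ) :
    ‖∑ k ∈ s, c k • e k‖ ^ 2 = ∑ k ∈ s, c k ^ 2 := by
  rw [← real_inner_self_eq_norm_sq, orthonormal_e.inner_sum]
  simp [sq]

/-! ### Completeness of `H²_sym(𝕊)` and the heat semigroup -/

theorem isClosed_isSymm : IsClosed {u : L2 | IsSymm u} := by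
  let N := Lp.compMeasurePreservingₗᵢ (E := ℝ) (p := 2) ℝ (fun x : UnitAddCircle => -x)
    (Measure.measurePreserving_neg (volume : Measure UnitAddCircle))
  have h : {u : L2 | IsSymm u} = {u : L2 | N u = u} := by
    ext u
    have h1 := Lp.coeFn_compMeasurePreserving u
      (Measure.measurePreserving_neg (volume : Measure UnitAddCircle))
    constructor
    · intro hu
      refine Lp.ext ?_
      filter_upwards [h1, hu] with x hx hx'
      exact hx.trans hx'
    · intro hu
      have hu' : N u = u := hu
      filter_upwards [h1] with x hx
      have : (N u) x = u (-x) := hx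
      rw [← this, hu']
  rw [h]
  exact isClosed_eq N.continuous continuous_id

theorem isClosed_H2sym : IsClosed (H2symSubmodule : Set (L2 × L2 × L2)) := by
  have h : (H2symSubmodule : Set (L2 × L2 × L2)) =
      {p | IsSymm p.1} ∩ ({p | IsWeakDeriv p.1 p.2.1} ∩ {p | IsWeakDeriv p.2.1 p.2.2}) := rfl
  rw [h]
  refine (isClosed_isSymm.preimage continuous_fst).inter (IsClosed.inter ?_ ?_)
  · simp only [IsWeakDeriv, Set.ofPred_forall]
    refine isClosed_iInter fun φ => isClosed_iInter fun φ' => isClosed_iInter fun _ =>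
      isClosed_iInter fun _ => isClosed_eq (by fun_prop) (by fun_prop)
  · simp only [IsWeakDeriv, Set.ofPred_forall]
    refine isClosed_iInter fun φ => isClosed_iInter fun φ' => isClosed_iInter fun _ =>
      isClosed_iInter fun _ => isClosed_eq (by fun_prop) (by fun_prop)

instance : CompleteSpace H2sym := isClosed_H2sym.completeSpace_coe

/-- The frequency `2πk`. -/
def freq (k : ℕ) : ℝ := 2 * Real.pi * k

/-- The multiplier of the heat semigroup. -/
def heatCoeff (ε : ℝ) (k : ℕ) : ℝ := Real.exp (-(freq k) ^ 2 * ε)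

theorem norm_toL2_le (φ : C(UnitAddCircle, ℝ)) {C : ℝ} (hC : 0 ≤ C) (h : ∀ x, |φ x| ≤ C) :
    ‖toL2 φ‖ ≤ C := by
  have := Lp.norm_le_of_ae_bound (f := toL2 φ) hC (by
    filter_upwards [toL2_coeFn φ] with x hx
    rw [hx]; exact h x)
  have h1 : (measureUnivNNReal (volume : Measure UnitAddCircle)) = 1 := by
    simp [measureUnivNNReal]
  rw [h1] at this
  simpa using this

theorem norm_eH2_le (k : ℕ) : ‖eH2 k‖ ≤ 2 * (1 + freq k ^ 2) := by
  have hc : ∀ x, |cosMap k x| ≤ 1 := fun x => by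
    obtain ⟨r, _, rfl⟩ := exists_rep x
    rw [cosMap_coe]; exact Real.abs_cos_le_one _
  have hs : ∀ x, |sinMap k x| ≤ 1 := fun x => by
    obtain ⟨r, _, rfl⟩ := exists_rep x
    rw [sinMap_coe]; exact Real.abs_sin_le_one _
  have hf : 0 ≤ freq k := by unfold freq; positivity
  have h1 : ‖cosH2 k‖ ≤ 1 + freq k ^ 2 := by
    show ‖((toL2 (cosMap k), toL2 (-(2 * Real.pi * k) • sinMap k),
      toL2 (-(2 * Real.pi * k) ^ 2 • cosMap k)) : L2 × L2 × L2)‖ ≤ _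
    refine norm_prod_le_iff.2 ⟨?_, norm_prod_le_iff.2 ⟨?_, ?_⟩⟩
    · exact norm_toL2_le _ (by positivity) fun x => (hc x).trans (by nlinarith)
    · refine norm_toL2_le _ (by positivity) fun x => ?_
      rw [ContinuousMap.smul_apply, smul_eq_mul, abs_mul, abs_neg]
      change |freq k| * _ ≤ _
      rw [abs_of_nonneg hf]
      nlinarith [hs x, sq_nonneg (freq k - 1), abs_nonneg (sinMap k x)]
    · refine norm_toL2_le _ (by positivity) fun x => ?_
      rw [ContinuousMap.smul_apply, smul_eq_mul, abs_mul, abs_neg]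
      change |freq k ^ 2| * _ ≤ _
      rw [abs_of_nonneg (by positivity)]
      nlinarith [hc x, sq_nonneg (freq k), abs_nonneg (cosMap k x)]
  have h2 : |cosNorm k| ≤ 2 := by
    unfold cosNorm
    split_ifs
    · norm_num
    · rw [abs_of_nonneg (Real.sqrt_nonneg _), Real.sqrt_le_left (by norm_num)]; norm_num
  rw [eH2, norm_smul, Real.norm_eq_abs]
  exact mul_le_mul h2 h1 (norm_nonneg _) (by norm_num)

theorem norm_e (k : ℕ) : ‖e k‖ = 1 := orthonormal_e.1 k

theorem abs_inner_e_le (k : ℕ) (u : L2) : |inner ℝ (e k) u| ≤ ‖u‖ := by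
  simpa [norm_e] using abs_real_inner_le_norm (e k) u

theorem summable_heatCoeff_mul {ε : ℝ} (hε : 0 < ε) :
    Summable fun k => heatCoeff ε k * (2 * (1 + freq k ^ 2)) := by
  have h1 := (Real.summable_pow_mul_exp_neg_nat_mul 0 hε).add
    ((Real.summable_pow_mul_exp_neg_nat_mul 2 hε).mul_left ((2 * Real.pi) ^ 2))
  refine Summable.of_nonneg_of_le (fun k => by unfold heatCoeff; positivity) (fun k => ?_)
    (h1.mul_left 2)
  have h2 : heatCoeff ε k ≤ Real.exp (-ε * k) := by
    refine Real.exp_le_exp.2 ?_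
    -- This crude bound replaces the Gaussian weight by a geometric one.
    have h3 : (k : ℝ) ≤ freq k ^ 2 := by
      rcases Nat.eq_zero_or_pos k with rfl | hk
      · simp [freq]
      · have : (1 : ℝ) ≤ k := by exact_mod_cast hk
        have h1 : (k : ℝ) ≤ freq k := by
          unfold freq
          nlinarith [Real.pi_gt_three]
        nlinarith
    nlinarith
  have h4 : freq k ^ 2 = (2 * Real.pi) ^ 2 * (k : ℝ) ^ 2 := by unfold freq; ring
  rw [h4]
  have : 0 ≤ (2 * Real.pi) ^ 2 * (k : ℝ) ^ 2 := by positivity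
  calc heatCoeff ε k * (2 * (1 + (2 * Real.pi) ^ 2 * (k : ℝ) ^ 2))
      ≤ Real.exp (-ε * k) * (2 * (1 + (2 * Real.pi) ^ 2 * (k : ℝ) ^ 2)) :=
        mul_le_mul_of_nonneg_right h2 (by positivity)
    _ = _ := by ring

/-- A bound for the norm of the heat semigroup from `L²(𝕊)` to `H²_sym(𝕊)`. -/
def heatBound (ε : ℝ) : ℝ := ∑' k, heatCoeff ε k * (2 * (1 + freq k ^ 2))

theorem heatBound_nonneg (ε : ℝ) : 0 ≤ heatBound ε :=
  tsum_nonneg fun k => by unfold heatCoeff; positivity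

theorem heatCoeff_pos (ε : ℝ) (k : ℕ) : 0 < heatCoeff ε k := Real.exp_pos _

theorem heatCoeff_le_one {ε : ℝ} (hε : 0 ≤ ε) (k : ℕ) : heatCoeff ε k ≤ 1 := by
  refine Real.exp_le_one_iff.2 ?_
  nlinarith [sq_nonneg (freq k)]

theorem norm_heat_term_le (ε : ℝ) (u : L2) (k : ℕ) :
    ‖(heatCoeff ε k * inner ℝ (e k) u) • eH2 k‖ ≤ heatCoeff ε k * (2 * (1 + freq k ^ 2)) * ‖u‖ := by
  rw [norm_smul, norm_mul, Real.norm_eq_abs, Real.norm_eq_abs, abs_of_pos (heatCoeff_pos ε k)]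
  calc heatCoeff ε k * |inner ℝ (e k) u| * ‖eH2 k‖
      ≤ heatCoeff ε k * ‖u‖ * (2 * (1 + freq k ^ 2)) := by
        have := (heatCoeff_pos ε k).le
        gcongr
        · exact abs_inner_e_le k u
        · exact norm_eH2_le k
    _ = _ := by ring

theorem hasSum_heat {ε : ℝ} (hε : 0 < ε) (u : L2) :
    HasSum (fun k => (heatCoeff ε k * inner ℝ (e k) u) • eH2 k) (heat ε u) :=
  (Summable.of_norm_bounded ((summable_heatCoeff_mul hε).mul_right ‖u‖)
    (norm_heat_term_le ε u)).hasSum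

theorem norm_heat_le {ε : ℝ} (hε : 0 < ε) (u : L2) : ‖heat ε u‖ ≤ heatBound ε * ‖u‖ := by
  rw [heatBound, ← tsum_mul_right]
  exact tsum_of_norm_bounded ((summable_heatCoeff_mul hε).mul_right ‖u‖).hasSum
    (norm_heat_term_le ε u)

theorem heat_sub {ε : ℝ} (hε : 0 < ε) (u v : L2) : heat ε (u - v) = heat ε u - heat ε v := by
  refine (hasSum_heat hε (u - v)).unique ?_
  refine hasSum_of_eq ((hasSum_heat hε u).sub (hasSum_heat hε v)) fun k => ?_
  rw [inner_sub_right, mul_sub]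
  exact (sub_smul _ _ (eH2 k)).symm

theorem continuous_heat {ε : ℝ} (hε : 0 < ε) : Continuous (heat ε) := by
  have h : LipschitzWith (heatBound ε).toNNReal (heat ε) := LipschitzWith.of_dist_le_mul fun u v => by
    rw [dist_eq_norm, dist_eq_norm, ← heat_sub hε, Real.coe_toNNReal _ (heatBound_nonneg ε)]
    exact norm_heat_le hε _
  exact h.continuous

/-- The underlying function, as a continuous linear map. -/
def fnCLM : H2sym →L[ℝ] L2 :=
  (ContinuousLinearMap.fst ℝ L2 (L2 × L2)).comp H2symSubmodule.subtypeL

/-- The Laplacian, as a continuous linear map. -/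
def lapCLM : H2sym →L[ℝ] L2 :=
  ((ContinuousLinearMap.snd ℝ L2 L2).comp (ContinuousLinearMap.snd ℝ L2 (L2 × L2))).comp
    H2symSubmodule.subtypeL

theorem fn_sub (u v : H2sym) : (u - v).fn = u.fn - v.fn := rfl

theorem norm_lap_le (u : H2sym) : ‖u.lap‖ ≤ ‖u‖ := (norm_snd_le u.1.2).trans (norm_snd_le u.1)

theorem eH2_lap (k : ℕ) : (eH2 k).lap = (-(freq k) ^ 2) • e k := by
  show cosNorm k • toL2 (-(2 * Real.pi * k) ^ 2 • cosMap k) = _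
  have : toL2 (-(2 * Real.pi * k) ^ 2 • cosMap k) = (-(2 * Real.pi * k) ^ 2) • toL2 (cosMap k) :=
    (ContinuousMap.toLp (E := ℝ) 2 volume ℝ).map_smul _ _
  rw [this, e, smul_comm]
  rfl

theorem hasSum_heat_fn {ε : ℝ} (hε : 0 < ε) (u : L2) :
    HasSum (fun k => (heatCoeff ε k * inner ℝ (e k) u) • e k) (heat ε u).fn :=
  (hasSum_heat hε u).mapL fnCLM

theorem hasSum_inner_heat {ε : ℝ} (hε : 0 < ε) (u v : L2) :
    HasSum (fun k => heatCoeff ε k * (inner ℝ (e k) u * inner ℝ (e k) v))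
      (inner ℝ v (heat ε u).fn) := by
  refine hasSum_of_eq ((hasSum_heat_fn hε u).mapL (innerSL ℝ v)) fun k => ?_
  rw [innerSL_apply_apply, inner_smul_right, real_inner_comm (e k) v]
  ring

theorem inner_heat_comm {ε : ℝ} (hε : 0 < ε) (u v : L2) :
    inner ℝ v (heat ε u).fn = inner ℝ u (heat ε v).fn := by
  refine (hasSum_inner_heat hε u v).unique ?_
  simpa only [mul_comm (inner ℝ (e _) v)] using hasSum_inner_heat hε v u

theorem inner_heat_self_nonneg {ε : ℝ} (hε : 0 < ε) (u : L2) : 0 ≤ inner ℝ u (heat ε u).fn :=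
  (hasSum_inner_heat hε u u).nonneg fun k =>
    mul_nonneg (heatCoeff_pos ε k).le (mul_self_nonneg _)

theorem hasSum_sq_of_smul_e {c : ℕ → ℝ} {w : L2} (h : HasSum (fun k => c k • e k) w) :
    HasSum (fun k => c k ^ 2) (‖w‖ ^ 2) := by
  have h1 := (h.norm).pow 2
  exact h1.congr fun s => sum_inner_e_smul_inner s c

theorem norm_heat_fn_sq_le {ε : ℝ} (hε : 0 < ε) (u : L2) :
    ‖(heat ε u).fn‖ ^ 2 ≤ inner ℝ u (heat ε u).fn := by
  refine hasSum_le (fun k => ?_) (hasSum_sq_of_smul_e (hasSum_heat_fn hε u))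
    (hasSum_inner_heat hε u u)
  rw [mul_pow, ← sq]
  have := heatCoeff_le_one hε.le k
  have := heatCoeff_pos ε k
  nlinarith [sq_nonneg (inner ℝ (e k) u), mul_nonneg this.le (sq_nonneg (inner ℝ (e k) u))]

theorem norm_heat_fn_le {ε : ℝ} (hε : 0 < ε) (u : L2) : ‖(heat ε u).fn‖ ≤ ‖u‖ := by
  have h1 := norm_heat_fn_sq_le hε u
  have h2 := real_inner_le_norm u (heat ε u).fn
  by_contra! h
  nlinarith [norm_nonneg u]

theorem inner_heat_self_le {ε : ℝ} (hε : 0 < ε) (u : L2) :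
    inner ℝ u (heat ε u).fn ≤ ‖u‖ ^ 2 := by
  have h2 := real_inner_le_norm u (heat ε u).fn
  have h3 := norm_heat_fn_le hε u
  nlinarith [norm_nonneg u]

theorem inner_lap_heat_nonpos {ε : ℝ} (hε : 0 < ε) (u : L2) : inner ℝ u (heat ε u).lap ≤ 0 := by
  have h1 : HasSum (fun k => inner ℝ u ((heatCoeff ε k * inner ℝ (e k) u) • (eH2 k).lap))
      (inner ℝ u (heat ε u).lap) := ((hasSum_heat hε u).mapL lapCLM).mapL (innerSL ℝ u)
  refine h1.nonpos fun k => ?_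
  rw [eH2_lap, inner_smul_right, inner_smul_right, real_inner_comm (e k) u]
  have := heatCoeff_pos ε k
  nlinarith [mul_nonneg (mul_nonneg this.le (sq_nonneg (freq k))) (sq_nonneg (inner ℝ (e k) u))]

/-- Strong continuity of the heat semigroup at `0`, on symmetric functions. -/
theorem tendsto_inner_heat_self {u : L2} (hu : IsSymm u) :
    Tendsto (fun ε => inner ℝ u (heat ε u).fn) (𝓝[>] 0) (𝓝 (‖u‖ ^ 2)) := by
  have h1 := hasSum_sq_inner_e hu
  have h2 : Tendsto (fun ε => ∑' k, heatCoeff ε k * (inner ℝ (e k) u * inner ℝ (e k) u)) (𝓝[>] 0)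
      (𝓝 (∑' k, inner ℝ (e k) u ^ 2)) := by
    refine tendsto_tsum_of_dominated_convergence h1.summable (fun k => ?_) ?_
    · have h3 : Tendsto (fun ε => heatCoeff ε k * (inner ℝ (e k) u * inner ℝ (e k) u)) (𝓝 0)
          (𝓝 (heatCoeff 0 k * (inner ℝ (e k) u * inner ℝ (e k) u))) :=
        Continuous.tendsto (by unfold heatCoeff; fun_prop) 0
      have h4 : heatCoeff 0 k * (inner ℝ (e k) u * inner ℝ (e k) u) = inner ℝ (e k) u ^ 2 := by
        simp [heatCoeff, sq]
      rw [h4] at h3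
      exact h3.mono_left nhdsWithin_le_nhds
    · filter_upwards [self_mem_nhdsWithin] with ε hε k
      have h5 := heatCoeff_le_one (le_of_lt hε) k
      rw [Real.norm_eq_abs, abs_mul, abs_of_pos (heatCoeff_pos ε k), ← sq, abs_of_nonneg (sq_nonneg _)]
      nlinarith [sq_nonneg (inner ℝ (e k) u)]
  rw [h1.tsum_eq] at h2
  refine h2.congr' ?_
  filter_upwards [self_mem_nhdsWithin] with ε hε
  exact (hasSum_inner_heat hε u u).tsum_eq

/-! ### The cone `U²(𝕊)` -/

/-- Along a subsequence the convergence is almost everywhere. The pointwise `limsup` of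
non-decreasing versions is again non-decreasing, and values in `EReal` make it always meaningful. -/
theorem isClosed_U2 : IsClosed U2 := by
  refine IsSeqClosed.isClosed fun v u hv hvu => ?_
  obtain ⟨φ, _, hφ⟩ := (tendstoInMeasure_of_tendsto_Lp hvu).exists_seq_tendsto_ae
  choose h hh hu using hv
  refine ⟨fun x => limsup (fun n => h (φ n) x) atTop, ⟨fun x => ?_, fun a ha b hb hab => ?_⟩, ?_⟩
  · simp only [(hh _).1]
  · exact limsup_le_limsup (Eventually.of_forall fun n => (hh (φ n)).2 ha hb hab)
  · filter_upwards [hφ, ae_all_iff.2 fun n => hu (φ n)] with x hx hx'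
    simp only [← hx']
    exact ((continuous_coe_real_ereal.tendsto _).comp hx).limsup_eq.symm

theorem mem_U2_of_continuousMap {φ : C(UnitAddCircle, ℝ)} (hsymm : ∀ x, φ (-x) = φ x)
    (hanti : AntitoneOn (fun r : ℝ => φ (r : UnitAddCircle)) (Set.Icc (-1 / 2) 0)) :
    toL2 φ ∈ U2 := by
  refine ⟨fun x => (φ x : EReal), ⟨fun x => by simp only [hsymm], fun a ha b hb hab =>
    EReal.coe_le_coe_iff.2 (hanti ha hb hab)⟩, ?_⟩
  filter_upwards [toL2_coeFn φ] with x hx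
  rw [hx]

theorem abs_sin_nat_mul_le (k : ℕ) (x : ℝ) : |Real.sin (k * x)| ≤ k * |Real.sin x| := by
  induction k with
  | zero => simp
  | succ k ih =>
    push_cast
    rw [add_mul, one_mul, Real.sin_add]
    calc |Real.sin (k * x) * Real.cos x + Real.cos (k * x) * Real.sin x|
        ≤ |Real.sin (k * x)| * |Real.cos x| + |Real.cos (k * x)| * |Real.sin x| := by
          rw [← abs_mul, ← abs_mul]; exact abs_add_le _ _
      _ ≤ |Real.sin (k * x)| * 1 + 1 * |Real.sin x| := by
          gcongr
          · exact Real.abs_cos_le_one _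
          · exact Real.abs_cos_le_one _
      _ ≤ _ := by linarith

/-- The function `-e₁` is non-decreasing and dominates all the other `e_k`. -/
theorem smul_add_eH2_mem_U2 (k : ℕ) {c : ℝ} (hc : |c| ≤ 1) :
    (((k : ℝ) ^ 2) • (-eH2 1) + c • eH2 k).fn ∈ U2 := by
  let φ : C(UnitAddCircle, ℝ) := ((k : ℝ) ^ 2) • (-(√2 • cosMap 1)) + c • (cosNorm k • cosMap k)
  have h1 : (((k : ℝ) ^ 2) • (-eH2 1) + c • eH2 k).fn = toL2 φ := by
    have h2 : (((k : ℝ) ^ 2) • (-eH2 1) + c • eH2 k).fn = ((k : ℝ) ^ 2) • (-e 1) + c • e k := rfl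
    rw [h2]
    simp only [φ, e, toL2, cosNorm, map_add, map_smul, map_neg]
    rfl
  rw [h1]
  refine mem_U2_of_continuousMap (fun x => by simp [φ, cosMap_neg]) ?_
  have hd : ∀ r : ℝ, HasDerivAt (fun r : ℝ => φ (r : UnitAddCircle))
      ((k : ℝ) ^ 2 * (√2 * (2 * Real.pi * Real.sin (2 * Real.pi * r)))
        - c * (cosNorm k * (2 * Real.pi * k * Real.sin (2 * Real.pi * k * r)))) r := by
    intro r
    have e1 := (((hasDerivAt_cosMap 1 r).const_mul √2).neg).const_mul ((k : ℝ) ^ 2)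
    have e2 := ((hasDerivAt_cosMap k r).const_mul (cosNorm k)).const_mul c
    refine (e1.add e2).congr_deriv ?_
    simp only [ContinuousMap.smul_apply, sinMap_coe, smul_eq_mul, Nat.cast_one, mul_one]
    ring
  refine antitoneOn_of_deriv_nonpos (convex_Icc _ _)
    (fun r _ => (hd r).continuousAt.continuousWithinAt)
    (fun r _ => (hd r).differentiableAt.differentiableWithinAt) (fun r hr => ?_)
  rw [interior_Icc] at hr
  rw [(hd r).deriv]
  have hpi := Real.pi_pos
  have hs : Real.sin (2 * Real.pi * r) ≤ 0 := by
    refine Real.sin_nonpos_of_nonpos_of_neg_pi_le ?_ ?_ <;> nlinarith [hr.1, hr.2]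
  -- The sign of the derivative reduces to `|sin kθ| ≤ k |sin θ|`. A second factor `k` comes from
  -- differentiating `e_k`, whence the weight `k²` on `-e₁`.
  have hk := abs_sin_nat_mul_le k (2 * Real.pi * r)
  rw [abs_of_nonpos hs, show (k : ℝ) * (2 * Real.pi * r) = 2 * Real.pi * k * r by ring] at hk
  rcases Nat.eq_zero_or_pos k with rfl | hk0
  · simp
  · have hN : cosNorm k = √2 := by simp [cosNorm, hk0.ne']
    rw [hN]
    have h3 : |c * Real.sin (2 * Real.pi * k * r)| ≤ k * -Real.sin (2 * Real.pi * r) := by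
      rw [abs_mul]
      nlinarith [abs_nonneg (Real.sin (2 * Real.pi * k * r)), abs_nonneg c]
    have h4 := neg_le_of_abs_le h3
    have h5 : (k : ℝ) ^ 2 * (√2 * (2 * Real.pi * Real.sin (2 * Real.pi * r)))
        - c * (√2 * (2 * Real.pi * k * Real.sin (2 * Real.pi * k * r)))
        = (√2 * (2 * Real.pi) * k) * (k * Real.sin (2 * Real.pi * r)
          - c * Real.sin (2 * Real.pi * k * r)) := by ring
    rw [h5]
    refine mul_nonpos_of_nonneg_of_nonpos (by positivity) (by linarith)

/-- A functional that is non-negative on the non-decreasing functions is dominated, on the range of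
the heat semigroup, by its value at `-e₁`. -/
theorem abs_apply_heat_le {ε : ℝ} (hε : 0 < ε) {ℓ : Hm2sym} (hℓ : ∀ z : H2sym, z.fn ∈ U2 → 0 ≤ ℓ z)
    (u : L2) : |ℓ (heat ε u)| ≤ heatBound ε * ‖u‖ * ℓ (-eH2 1) := by
  have h1 : ∀ k : ℕ, |ℓ (eH2 k)| ≤ (k : ℝ) ^ 2 * ℓ (-eH2 1) := by
    intro k
    -- Testing against `k² (-e₁) ± e_k`, both in the cone, bounds `ℓ (e_k)` from both sides. The
    -- quadratic growth in `k` is absorbed by the heat multiplier.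
    have ha := hℓ _ (smul_add_eH2_mem_U2 k (c := 1) (by norm_num))
    have hb := hℓ _ (smul_add_eH2_mem_U2 k (c := -1) (by norm_num))
    rw [map_add, map_smul, map_smul, smul_eq_mul, smul_eq_mul] at ha hb
    exact abs_le.2 ⟨by linarith, by linarith⟩
  have hv : 0 ≤ ℓ (-eH2 1) := by
    have := (abs_nonneg _).trans (h1 1)
    simpa using this
  have h2 := (hasSum_heat hε u).mapL ℓ
  have h3 : ∀ k, ‖ℓ ((heatCoeff ε k * inner ℝ (e k) u) • eH2 k)‖
      ≤ heatCoeff ε k * (2 * (1 + freq k ^ 2)) * (‖u‖ * ℓ (-eH2 1)) := by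
    intro k
    rw [map_smul, smul_eq_mul, norm_mul, norm_mul, Real.norm_eq_abs, Real.norm_eq_abs,
      Real.norm_eq_abs, abs_of_pos (heatCoeff_pos ε k)]
    have hk : (k : ℝ) ^ 2 ≤ 2 * (1 + freq k ^ 2) := by
      unfold freq
      have : 1 ≤ Real.pi ^ 2 := by nlinarith [Real.pi_gt_three]
      nlinarith [mul_nonneg (sub_nonneg.2 this) (sq_nonneg (k : ℝ)), sq_nonneg (k : ℝ)]
    calc heatCoeff ε k * |inner ℝ (e k) u| * |ℓ (eH2 k)|
        ≤ heatCoeff ε k * ‖u‖ * ((k : ℝ) ^ 2 * ℓ (-eH2 1)) := by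
          have := (heatCoeff_pos ε k).le
          gcongr
          · exact abs_inner_e_le k u
          · exact h1 k
      _ ≤ heatCoeff ε k * ‖u‖ * ((2 * (1 + freq k ^ 2)) * ℓ (-eH2 1)) := by
          have := (heatCoeff_pos ε k).le
          gcongr
      _ = _ := by ring
  have h4 := tsum_of_norm_bounded
    ((summable_heatCoeff_mul hε).mul_right (‖u‖ * ℓ (-eH2 1))).hasSum h3
  rw [h2.tsum_eq, tsum_mul_right, Real.norm_eq_abs] at h4
  rw [mul_assoc]
  exact h4

/-! ### Averages over intervals preserve `U²(𝕊)` -/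

theorem measurePreserving_add_right (s : UnitAddCircle) :
    MeasurePreserving (fun x : UnitAddCircle => x + s) :=
  MeasureTheory.measurePreserving_add_right volume s

/-- The moving average of `u` over intervals of length `2h`. -/
def boxFn (h : ℝ) (u : L2) (x : UnitAddCircle) : ℝ :=
  (2 * h)⁻¹ * ∫ s in (-h)..h, u (x + (s : UnitAddCircle))

theorem stronglyMeasurable_shift (u : L2) :
    StronglyMeasurable fun p : UnitAddCircle × ℝ => u (p.1 + (p.2 : UnitAddCircle)) :=
  (Lp.stronglyMeasurable u).comp_measurable
    (measurable_fst.add ((AddCircle.measurable_mk' (a := (1 : ℝ))).comp measurable_snd))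

theorem measurable_boxFn {h : ℝ} (u : L2) : Measurable (boxFn h u) := by
  have h1 : StronglyMeasurable fun x : UnitAddCircle => ∫ s in (-h)..h, u (x + (s : UnitAddCircle)) := by
    simp only [intervalIntegral]
    exact ((stronglyMeasurable_shift u).integral_prod_right (ν := volume.restrict (Set.Ioc (-h) h))).sub
      ((stronglyMeasurable_shift u).integral_prod_right (ν := volume.restrict (Set.Ioc h (-h))))
  exact h1.measurable.const_mul _

theorem integrable_shift (u : L2) (x : UnitAddCircle) : Integrable fun y => u (x + y) := by
  simp only [add_comm x]
  exact (measurePreserving_add_right x).integrable_comp_of_integrable u.integrable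

theorem integral_abs_shift_le {h : ℝ} (h1 : h ≤ 1 / 2) (u : L2) (x : UnitAddCircle) :
    ∫ s in Set.Ioc (-h) h, |u (x + (s : UnitAddCircle))| ≤ ∫ y, |u y| := by
  have hi := intervalIntegrable_coe (integrable_shift u x).abs
  calc ∫ s in Set.Ioc (-h) h, |u (x + (s : UnitAddCircle))|
      ≤ ∫ s in Set.Ioc (-(1 / 2) : ℝ) (-(1 / 2) + 1), |u (x + (s : UnitAddCircle))| := by
        refine setIntegral_mono_set ?_ (ae_of_all _ fun _ => abs_nonneg _)
          (Set.Ioc_subset_Ioc (by linarith) (by linarith)).eventuallyLE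
        exact (intervalIntegrable_iff_integrableOn_Ioc_of_le (by norm_num)).1 (hi _ _)
    _ = ∫ y, |u (x + y)| := by
        rw [← intervalIntegral.integral_of_le (by norm_num)]
        exact UnitAddCircle.intervalIntegral_preimage (-(1 / 2)) fun y => |u (x + y)|
    _ = ∫ y, |u y| := integral_add_left_eq_self (fun y => |u y|) x

theorem abs_boxFn_le {h : ℝ} (h0 : 0 < h) (h1 : h ≤ 1 / 2) (u : L2) (x : UnitAddCircle) :
    |boxFn h u x| ≤ (2 * h)⁻¹ * ∫ y, |u y| := by
  rw [boxFn, abs_mul, abs_of_pos (by positivity)]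
  refine mul_le_mul_of_nonneg_left ?_ (by positivity)
  rw [intervalIntegral.integral_of_le (by linarith)]
  exact (abs_integral_le_integral_abs).trans (integral_abs_shift_le h1 u x)

theorem memLp_boxFn {h : ℝ} (h0 : 0 < h) (h1 : h ≤ 1 / 2) (u : L2) : MemLp (boxFn h u) 2 volume :=
  MemLp.of_bound (measurable_boxFn u).aestronglyMeasurable _
    (ae_of_all _ fun x => abs_boxFn_le h0 h1 u x)

/-- The moving average, as an element of `L²(𝕊)`. -/
def box {h : ℝ} (h0 : 0 < h) (h1 : h ≤ 1 / 2) (u : L2) : L2 := (memLp_boxFn h0 h1 u).toLp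

theorem boxFn_coe (h : ℝ) (u : L2) (r : ℝ) :
    boxFn h u (r : UnitAddCircle) = (2 * h)⁻¹ * ∫ s in (r - h)..(r + h), u (s : UnitAddCircle) := by
  rw [boxFn]
  congr 1
  have := intervalIntegral.integral_comp_add_left (fun s : ℝ => u (s : UnitAddCircle)) (a := -h) (b := h) r
  simp only [AddCircle.coe_add] at this
  rw [this, ← sub_eq_add_neg]

/-- Both points are moved into `[-1/2, 0]` by the symmetries of the circle: `s + h` goes to `-|s +
h|` and `s - h`, reflected about `-1/2` if necessary, to `max (s - h) (-1 - (s - h))`. The second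
image lies to the left of the first. -/
theorem le_of_centered {v : UnitAddCircle → EReal} (hv : IsNondecreasing v) {s h : ℝ} (h0 : 0 ≤ h)
    (h1 : h ≤ 1 / 2) (hs : s ∈ Set.Icc (-1 / 2 : ℝ) 0) :
    v ((s + h : ℝ) : UnitAddCircle) ≤ v ((s - h : ℝ) : UnitAddCircle) := by
  obtain ⟨a, ha, hva, ha1⟩ : ∃ a ∈ Set.Icc (-1 / 2 : ℝ) 0, v (a : UnitAddCircle)
      = v ((s + h : ℝ) : UnitAddCircle) ∧ a = -|s + h| := by
    refine ⟨-|s + h|, ⟨?_, by simp⟩, ?_, rfl⟩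
    · have : |s + h| ≤ 1 / 2 := abs_le.2 ⟨by linarith [hs.1], by linarith [hs.2]⟩
      linarith
    · rw [AddCircle.coe_neg, hv.1]
      rcases abs_choice (s + h) with h2 | h2 <;> rw [h2]
      rw [AddCircle.coe_neg, hv.1]
  obtain ⟨b, hb, hvb, hb1⟩ : ∃ b ∈ Set.Icc (-1 / 2 : ℝ) 0, v (b : UnitAddCircle)
      = v ((s - h : ℝ) : UnitAddCircle) ∧ b = max (s - h) (-1 - (s - h)) := by
    rcases le_total (-1 / 2) (s - h) with h2 | h2
    · exact ⟨s - h, ⟨h2, by linarith [hs.2]⟩, rfl, (max_eq_left (by linarith)).symm⟩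
    · refine ⟨-1 - (s - h), ⟨by linarith, by linarith [hs.1]⟩, ?_, (max_eq_right (by linarith)).symm⟩
      rw [← hv.1 ((s - h : ℝ) : UnitAddCircle), ← AddCircle.coe_neg]
      congr 1
      rw [sub_eq_add_neg (-1 : ℝ), AddCircle.coe_add]
      have : ((-1 : ℝ) : UnitAddCircle) = 0 := by
        rw [AddCircle.coe_neg]; simp
      rw [this, zero_add]
  rw [← hva, ← hvb]
  refine hv.2 hb ha ?_
  rw [ha1, hb1]
  refine max_le ?_ ?_
  · have : |s + h| ≤ h - s := abs_le.2 ⟨by linarith [hs.2], by linarith [hs.2]⟩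
    linarith
  · have : |s + h| ≤ 1 + (s - h) := abs_le.2 ⟨by linarith [hs.1], by linarith [hs.2]⟩
    linarith

/-- The difference between the integrals over windows centred at `a ≤ b` equals the integral over `s
∈ [a, b]` of `u (s - h) - u (s + h)`, which is non-negative by `le_of_centered`. -/
theorem box_mem_U2 {h : ℝ} (h0 : 0 < h) (h1 : h ≤ 1 / 2) {u : L2} (hu : u ∈ U2) :
    box h0 h1 u ∈ U2 := by
  obtain ⟨v, hv, huv⟩ := hu
  refine ⟨fun x => (boxFn h u x : EReal), ⟨fun x => ?_, fun a ha b hb hab => ?_⟩, ?_⟩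
  · obtain ⟨r, _, rfl⟩ := exists_rep x
    beta_reduce
    rw [← AddCircle.coe_neg, boxFn_coe, boxFn_coe, ← integral_neg_arc hv huv (r - h) (r + h)]
    rw [show -r - h = -(r + h) by ring, show -r + h = -(r - h) by ring]
  · refine EReal.coe_le_coe_iff.2 ?_
    simp only [boxFn_coe]
    refine mul_le_mul_of_nonneg_left ?_ (by positivity)
    have hi := intervalIntegrable_coe u.integrable
    have e1 : (∫ s in (a - h)..(a + h), u (s : UnitAddCircle))
        - ∫ s in (b - h)..(b + h), u (s : UnitAddCircle)
        = (∫ s in (a - h)..(b - h), u (s : UnitAddCircle))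
          - ∫ s in (a + h)..(b + h), u (s : UnitAddCircle) :=
      intervalIntegral.integral_interval_sub_interval_comm (hi _ _) (hi _ _) (hi _ _)
    have e2 := intervalIntegral.integral_comp_sub_right (fun s : ℝ => u (s : UnitAddCircle))
      (a := a) (b := b) h
    have e3 := intervalIntegral.integral_comp_add_right (fun s : ℝ => u (s : UnitAddCircle))
      (a := a) (b := b) h
    have e4 : ∫ s in a..b, u ((s + h : ℝ) : UnitAddCircle) ≤ ∫ s in a..b, u ((s - h : ℝ) : UnitAddCircle) := by
      have q := ae_coe_of_ae huv
      have q1 := (MeasureTheory.measurePreserving_add_right (volume : Measure ℝ) h).quasiMeasurePreserving.ae q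
      have q2 := (MeasureTheory.measurePreserving_add_right (volume : Measure ℝ) (-h)).quasiMeasurePreserving.ae q
      have i1 : IntervalIntegrable (fun s : ℝ => u ((s + h : ℝ) : UnitAddCircle)) volume a b := by
        simpa only [AddCircle.coe_add, add_comm] using
          intervalIntegrable_coe (integrable_shift u (h : UnitAddCircle)) a b
      have i2 : IntervalIntegrable (fun s : ℝ => u ((s - h : ℝ) : UnitAddCircle)) volume a b := by
        simpa only [← AddCircle.coe_add, neg_add_eq_sub] using
          intervalIntegrable_coe (integrable_shift u ((-h : ℝ) : UnitAddCircle)) a b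
      refine intervalIntegral.integral_mono_ae_restrict hab i1 i2 ?_
      refine ae_restrict_Icc_of_ae ?_
      filter_upwards [q1, q2] with s hs1 hs2 hs
      rw [← sub_eq_add_neg] at hs2
      rw [← EReal.coe_le_coe_iff, hs1, hs2]
      exact le_of_centered hv h0.le h1 ⟨ha.1.trans hs.1.le, hs.2.le.trans hb.2⟩
    linarith
  · filter_upwards [(memLp_boxFn h0 h1 u).coeFn_toLp] with x hx
    rw [box, hx]

/-- The multiplier of the moving average. -/
def boxCoeff (h : ℝ) (k : ℕ) : ℝ := (2 * h)⁻¹ * ∫ s in (-h)..h, Real.cos (freq k * s)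

theorem cosMap_sub (k : ℕ) (x : UnitAddCircle) (s : ℝ) :
    cosMap k (x - (s : UnitAddCircle))
      = Real.cos (freq k * s) * cosMap k x + Real.sin (freq k * s) * sinMap k x := by
  obtain ⟨r, _, rfl⟩ := exists_rep x
  rw [← AddCircle.coe_sub, cosMap_coe, cosMap_coe, sinMap_coe, mul_sub, Real.cos_sub]
  unfold freq
  ring

/-- Averaging is a convolution, so after Fubini and a translation the addition formula for the
cosine leaves a multiple of the same coefficient; the sine term vanishes because `u` is symmetric.
-/
theorem inner_e_box {h : ℝ} (h0 : 0 < h) (h1 : h ≤ 1 / 2) {u : L2} (hu : IsSymm u) (k : ℕ) :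
    inner ℝ (e k) (box h0 h1 u) = boxCoeff h k * inner ℝ (e k) u := by
  rw [inner_e_eq_integral, inner_e_eq_integral]
  have e1 : ∫ x, cosMap k x * box h0 h1 u x = ∫ x, cosMap k x * boxFn h u x := by
    refine integral_congr_ae ?_
    filter_upwards [(memLp_boxFn h0 h1 u).coeFn_toLp] with x hx
    rw [box, hx]
  have hc : ∀ x, |cosMap k x| ≤ 1 := fun x => by
    obtain ⟨r, _, rfl⟩ := exists_rep x
    rw [cosMap_coe]; exact Real.abs_cos_le_one _
  have hint : Integrable (Function.uncurry fun (x : UnitAddCircle) (s : ℝ) =>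
      cosMap k x * u (x + (s : UnitAddCircle))) (volume.prod (volume.restrict (Set.Ioc (-h) h))) := by
    have hm : AEStronglyMeasurable (Function.uncurry fun (x : UnitAddCircle) (s : ℝ) =>
        cosMap k x * u (x + (s : UnitAddCircle))) (volume.prod (volume.restrict (Set.Ioc (-h) h))) :=
      (((cosMap k).continuous.stronglyMeasurable.comp_measurable measurable_fst).mul
        (stronglyMeasurable_shift u)).aestronglyMeasurable
    refine (integrable_prod_iff' hm).2 ⟨ae_of_all _ fun s => ?_, ?_⟩
    · have hs : Integrable fun x => u (x + (s : UnitAddCircle)) :=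
        (measurePreserving_add_right _).integrable_comp_of_integrable u.integrable
      exact hs.bdd_mul (cosMap k).continuous.aestronglyMeasurable (c := 1) (ae_of_all _ hc)
    · refine Integrable.mono' (g := fun _ => ∫ x, |u x|) (integrable_const _)
        hm.norm.prod_swap.integral_prod_right' (ae_of_all _ fun s => ?_)
      rw [Real.norm_eq_abs, abs_of_nonneg (integral_nonneg fun _ => norm_nonneg _)]
      rw [← integral_add_right_eq_self (fun y => |u y|) (s : UnitAddCircle)]
      have hs : Integrable fun x => u (x + (s : UnitAddCircle)) :=
        (measurePreserving_add_right _).integrable_comp_of_integrable u.integrable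
      refine integral_mono_of_nonneg (ae_of_all _ fun _ => norm_nonneg _) hs.abs
        (ae_of_all _ fun x => ?_)
      simp only [Function.uncurry, norm_mul, Real.norm_eq_abs]
      nlinarith [hc x, abs_nonneg (u (x + (s : UnitAddCircle)))]
  have e2 : ∫ x, cosMap k x * boxFn h u x
      = (2 * h)⁻¹ * ∫ s in (-h)..h, ∫ x, cosMap k x * u (x + (s : UnitAddCircle)) := by
    rw [intervalIntegral.integral_of_le (by linarith), ← integral_integral_swap hint,
      ← integral_const_mul]
    refine integral_congr_ae (ae_of_all _ fun x => ?_)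
    simp only [boxFn]
    rw [intervalIntegral.integral_of_le (by linarith), integral_const_mul]
    ring
  have e3 : ∀ s : ℝ, ∫ x, cosMap k x * u (x + (s : UnitAddCircle))
      = Real.cos (freq k * s) * ∫ x, cosMap k x * u x := by
    intro s
    have := integral_sub_right_eq_self (fun x => cosMap k x * u (x + (s : UnitAddCircle)))
      (s : UnitAddCircle) (μ := volume)
    rw [← this]
    simp only [sub_add_cancel, cosMap_sub, add_mul, mul_assoc]
    rw [integral_add ((integrable_continuousMap_mul _ u).const_mul _)
      ((integrable_continuousMap_mul _ u).const_mul _), integral_const_mul, integral_const_mul,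
      integral_sinMap_mul hu, mul_zero, add_zero]
  rw [e1, e2]
  simp only [e3]
  rw [intervalIntegral.integral_mul_const, boxCoeff]
  ring

theorem abs_boxCoeff_le {h : ℝ} (h0 : 0 < h) (k : ℕ) : |boxCoeff h k| ≤ 1 := by
  have h1 := intervalIntegral.norm_integral_le_of_norm_le_const (a := -h) (b := h) (C := 1)
    (f := fun s => Real.cos (freq k * s)) fun s _ => Real.abs_cos_le_one _
  rw [sub_neg_eq_add, abs_of_pos (by linarith), one_mul, Real.norm_eq_abs] at h1
  rw [boxCoeff, abs_mul, abs_of_pos (by positivity), inv_mul_le_iff₀ (by positivity)]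
  linarith

theorem abs_boxCoeff_sub_le {h : ℝ} (h0 : 0 < h) {k : ℕ} (hk : freq k * h ≤ 1) :
    |boxCoeff h k - 1 + freq k ^ 2 * h ^ 2 / 6| ≤ (freq k * h) ^ 4 := by
  have hf : 0 ≤ freq k := by unfold freq; positivity
  have e1 : ∫ s in (-h)..h, (Real.cos (freq k * s) - (1 - freq k ^ 2 / 2 * s ^ 2))
      = (∫ s in (-h)..h, Real.cos (freq k * s)) - (2 * h - freq k ^ 2 * h ^ 3 / 3) := by
    rw [intervalIntegral.integral_sub (by apply Continuous.intervalIntegrable; fun_prop)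
      (by apply Continuous.intervalIntegrable; fun_prop),
      intervalIntegral.integral_sub (by simp) (by apply Continuous.intervalIntegrable; fun_prop),
      intervalIntegral.integral_const_mul, integral_pow]
    simp
    ring
  have h1 := intervalIntegral.norm_integral_le_of_norm_le_const (a := -h) (b := h)
    (C := (freq k * h) ^ 4)
    (f := fun s => Real.cos (freq k * s) - (1 - freq k ^ 2 / 2 * s ^ 2)) (fun s hs => by
      rw [Set.uIoc_of_le (by linarith)] at hs
      have hs' : |s| ≤ h := abs_le.2 ⟨hs.1.le, hs.2⟩
      have hb : |freq k * s| ≤ freq k * h := by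
        rw [abs_mul, abs_of_nonneg hf]; gcongr
      have := Real.cos_bound (hb.trans hk)
      rw [Real.norm_eq_abs]
      have e : (1 - (freq k * s) ^ 2 / 2) = 1 - freq k ^ 2 / 2 * s ^ 2 := by ring
      rw [e] at this
      refine this.trans ?_
      have : |freq k * s| ^ 4 ≤ (freq k * h) ^ 4 := by gcongr
      nlinarith [pow_nonneg (abs_nonneg (freq k * s)) 4])
  rw [e1, sub_neg_eq_add, abs_of_pos (by linarith), Real.norm_eq_abs] at h1
  have e2 : boxCoeff h k - 1 + freq k ^ 2 * h ^ 2 / 6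
      = (2 * h)⁻¹ * ((∫ s in (-h)..h, Real.cos (freq k * s)) - (2 * h - freq k ^ 2 * h ^ 3 / 3)) := by
    rw [boxCoeff]
    field_simp
    ring
  rw [e2, abs_mul, abs_of_pos (by positivity), inv_mul_le_iff₀ (by positivity)]
  linarith

/-- The uniform law on `[-h, h]` has variance `h²/3`. With `h² = 6ε/n`, a sum of `n` independent
copies has variance `2ε`, that of the kernel of `e^{εΔ}`. On multipliers this is `(1 - freq² ε/n +
O(1/n²))^n → exp (-freq² ε)`. -/
theorem tendsto_boxCoeff_pow {ε : ℝ} (hε : 0 < ε) (k : ℕ) :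
    Tendsto (fun n : ℕ => boxCoeff (√(6 * ε / n)) k ^ n) atTop (𝓝 (heatCoeff ε k)) := by
  have h1 : Tendsto (fun n : ℕ => (n : ℝ) * (boxCoeff (√(6 * ε / n)) k - 1)) atTop
      (𝓝 (-(freq k) ^ 2 * ε)) := by
    have hz : Tendsto (fun n : ℕ => (freq k ^ 4 * (6 * ε) ^ 2) / n) atTop (𝓝 0) :=
      tendsto_const_div_atTop_nhds_zero_nat _
    have hz2 : Tendsto (fun n : ℕ => freq k ^ 2 * (6 * ε) / n) atTop (𝓝 0) :=
      tendsto_const_div_atTop_nhds_zero_nat _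
    refine tendsto_iff_norm_sub_tendsto_zero.2 (squeeze_zero' (Eventually.of_forall fun _ =>
      norm_nonneg _) ?_ hz)
    filter_upwards [eventually_gt_atTop 0, hz2.eventually (ge_mem_nhds one_pos)] with n hn hn2
    have hn' : (0 : ℝ) < n := by exact_mod_cast hn
    have hf : 0 ≤ freq k := by unfold freq; positivity
    have hs : √(6 * ε / n) ^ 2 = 6 * ε / n := Real.sq_sqrt (by positivity)
    have h2 := abs_boxCoeff_sub_le (h := √(6 * ε / n)) (by positivity) (k := k) (by
      refine abs_le_one_iff_mul_self_le_one.2 ?_ |> le_of_abs_le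
      rw [← sq, mul_pow, hs, ← mul_div_assoc]
      exact hn2)
    rw [mul_pow, show √(6 * ε / n) ^ 4 = (√(6 * ε / n) ^ 2) ^ 2 by ring, hs] at h2
    rw [Real.norm_eq_abs]
    have e1 : (n : ℝ) * (boxCoeff (√(6 * ε / n)) k - 1) - -(freq k) ^ 2 * ε
        = n * (boxCoeff (√(6 * ε / n)) k - 1 + freq k ^ 2 * (6 * ε / n) / 6) := by
      field_simp
      ring
    rw [e1, abs_mul, abs_of_pos hn']
    calc (n : ℝ) * |boxCoeff (√(6 * ε / n)) k - 1 + freq k ^ 2 * (6 * ε / n) / 6|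
        ≤ n * (freq k ^ 4 * (6 * ε / n) ^ 2) := by gcongr
      _ = _ := by field_simp
  have := Real.tendsto_one_add_pow_exp_of_tendsto h1
  simpa [heatCoeff] using this

theorem isSymm_fn (z : H2sym) : IsSymm z.fn := z.2.1

theorem isSymm_sub {u v : L2} (hu : IsSymm u) (hv : IsSymm v) : IsSymm (u - v) := by
  have h := Lp.coeFn_sub u v
  filter_upwards [h, ae_neg_of_ae h, hu, hv] with x h1 h2 h3 h4
  rw [h1, h2, Pi.sub_apply, Pi.sub_apply, h3, h4]

theorem inner_e_heat {ε : ℝ} (hε : 0 < ε) (u : L2) (k : ℕ) :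
    inner ℝ (e k) (heat ε u).fn = heatCoeff ε k * inner ℝ (e k) u := by
  refine ((hasSum_heat_fn hε u).mapL (innerSL ℝ (e k))).unique ?_
  refine hasSum_of_eq (hasSum_ite_eq k (heatCoeff ε k * inner ℝ (e k) u)) fun j => ?_
  rw [innerSL_apply_apply, inner_smul_right, inner_e]
  by_cases h : j = k
  · subst h; simp
  · simp [h, Ne.symm h]

/-- The heat semigroup preserves the cone of non-decreasing functions. -/
theorem heat_mem_U2 {ε : ℝ} (hε : 0 < ε) {u : L2} (hu : u ∈ U2) : (heat ε u).fn ∈ U2 := by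
  -- The window `√(6ε/N)` is at most `1/2` exactly when `N ≥ 24ε`; all subdivisions therefore start
  -- from `n₀ + 1`.
  obtain ⟨n₀, hn₀⟩ := exists_nat_ge (24 * ε)
  have hpos : ∀ n : ℕ, 0 < √(6 * ε / (n + n₀ + 1 : ℕ)) := fun n => by
    push_cast; positivity
  have hle : ∀ n : ℕ, √(6 * ε / (n + n₀ + 1 : ℕ)) ≤ 1 / 2 := fun n => by
    rw [Real.sqrt_le_left (by norm_num), div_le_iff₀ (by push_cast; positivity)]
    push_cast
    have : (0 : ℝ) ≤ n := Nat.cast_nonneg n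
    linarith
  let w : ℕ → ℕ → L2 := fun n m => (box (hpos n) (hle n))^[m] u
  have hw : ∀ n m, w n m ∈ U2 := by
    intro n m
    induction m with
    | zero => exact hu
    | succ m ih =>
      simp only [w, Function.iterate_succ', Function.comp]
      exact box_mem_U2 _ _ ih
  have hwc : ∀ n m k, inner ℝ (e k) (w n m)
      = boxCoeff (√(6 * ε / (n + n₀ + 1 : ℕ))) k ^ m * inner ℝ (e k) u := by
    intro n m k
    induction m with
    | zero => simp [w]
    | succ m ih =>
      have : w n (m + 1) = box (hpos n) (hle n) (w n m) := by
        simp only [w, Function.iterate_succ', Function.comp]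
      rw [this, inner_e_box _ _ (isSymm_of_mem_U2 (hw n m)), ih]
      ring
  -- The iterated averages stay in the closed cone. By Parseval their `L²` convergence to the heat
  -- flow is a dominated convergence of multipliers, whose differences are at most `2` in absolute
  -- value, hence the bound with the factor `4`.
  have hlim : Tendsto (fun n => w n (n + n₀ + 1)) atTop (𝓝 (heat ε u).fn) := by
    rw [tendsto_iff_norm_sub_tendsto_zero]
    have hnorm : ∀ n, ∑' k, ((boxCoeff (√(6 * ε / (n + n₀ + 1 : ℕ))) k ^ (n + n₀ + 1)
        - heatCoeff ε k) * inner ℝ (e k) u) ^ 2 = ‖w n (n + n₀ + 1) - (heat ε u).fn‖ ^ 2 := by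
      intro n
      rw [← (hasSum_sq_inner_e (isSymm_sub (isSymm_of_mem_U2 (hw n (n + n₀ + 1)))
        (isSymm_fn (heat ε u)))).tsum_eq]
      refine tsum_congr fun k => ?_
      rw [inner_sub_right, hwc, inner_e_heat hε, sub_mul]
    have h1 : Tendsto (fun n : ℕ => ∑' k, ((boxCoeff (√(6 * ε / (n + n₀ + 1 : ℕ))) k ^ (n + n₀ + 1)
        - heatCoeff ε k) * inner ℝ (e k) u) ^ 2) atTop (𝓝 (∑' _ : ℕ, 0)) := by
      refine tendsto_tsum_of_dominated_convergence
        ((hasSum_sq_inner_e (isSymm_of_mem_U2 hu)).summable.mul_left 4) (fun k => ?_)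
        (Eventually.of_forall fun n k => ?_)
      · have h2 : Tendsto (fun n : ℕ => n + n₀ + 1) atTop atTop :=
          tendsto_atTop_mono (fun n => show n ≤ n + n₀ + 1 by omega) tendsto_id
        have h3 := (((tendsto_boxCoeff_pow hε k).comp h2).sub_const (heatCoeff ε k)).mul_const
          (inner ℝ (e k) u)
        have h4 := h3.pow 2
        rw [sub_self, zero_mul, zero_pow two_ne_zero] at h4
        exact h4
      · have h5 : |boxCoeff (√(6 * ε / (n + n₀ + 1 : ℕ))) k ^ (n + n₀ + 1) - heatCoeff ε k| ≤ 2 := by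
          have h6 : |boxCoeff (√(6 * ε / (n + n₀ + 1 : ℕ))) k ^ (n + n₀ + 1)| ≤ 1 := by
            rw [abs_pow]
            exact pow_le_one₀ (abs_nonneg _) (abs_boxCoeff_le (hpos n) k)
          have h7 : |heatCoeff ε k| ≤ 1 := by
            rw [abs_of_pos (heatCoeff_pos ε k)]; exact heatCoeff_le_one hε.le k
          exact (abs_sub _ _).trans (by linarith)
        rw [Real.norm_eq_abs, abs_pow, abs_mul, mul_pow, sq_abs (inner ℝ (e k) u)]
        refine mul_le_mul_of_nonneg_right ?_ (sq_nonneg _)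
        nlinarith [abs_nonneg (boxCoeff (√(6 * ε / (n + n₀ + 1 : ℕ))) k ^ (n + n₀ + 1) - heatCoeff ε k)]
    simp only [hnorm, tsum_zero] at h1
    have h2 := h1.sqrt
    simpa [Real.sqrt_sq (norm_nonneg _)] using h2
  exact isClosed_U2.mem_of_tendsto hlim (Eventually.of_forall fun n => hw _ _)

section

/-! ### Uniform subdivisions -/

/-- The `i`-th point of the uniform subdivision of `[0, t]` into `n` intervals. -/
def grid (t : ℝ≥0) (n i : ℕ) : ℝ≥0 := (i : ℝ≥0) / n * t

theorem grid_zero (t : ℝ≥0) (n : ℕ) : grid t n 0 = 0 := by simp [grid]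

theorem grid_self (t : ℝ≥0) {n : ℕ} (hn : 0 < n) : grid t n n = t := by
  have : (n : ℝ≥0) ≠ 0 := by exact_mod_cast hn.ne'
  rw [grid, div_self this, one_mul]

theorem grid_mono (t : ℝ≥0) (n : ℕ) : Monotone (grid t n) := fun i j hij => by
  unfold grid
  gcongr

theorem grid_le (t : ℝ≥0) {n i : ℕ} (hi : i ≤ n) : grid t n i ≤ t := by
  rcases Nat.eq_zero_or_pos n with rfl | hn
  · obtain rfl : i = 0 := by omega
    simp [grid]
  · exact (grid_mono t n hi).trans (grid_self t hn).le

theorem grid_coe_succ_sub (t : ℝ≥0) (n i : ℕ) :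
    ((grid t n (i + 1) : ℝ≥0) : ℝ) - grid t n i = t / n := by
  unfold grid
  push_cast
  ring

theorem grid_mul (t : ℝ≥0) (n i : ℕ) {m : ℕ} (hm : 0 < m) : grid t (n * m) (i * m) = grid t n i := by
  have : (m : ℝ≥0) ≠ 0 := by exact_mod_cast hm.ne'
  unfold grid
  push_cast
  rw [mul_div_mul_right _ _ this]

theorem sum_range_mul_eq {M : Type*} [AddCommMonoid M] (F : ℕ → M) (n m : ℕ) :
    ∑ k ∈ Finset.range (n * m), F k = ∑ i ∈ Finset.range n, ∑ j ∈ Finset.range m, F (i * m + j) := by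
  induction n with
  | zero => simp
  | succ n ih => rw [Finset.sum_range_succ, ← ih, add_mul, one_mul, Finset.sum_range_add]

theorem exists_forall_grid_lt {E : Type*} [SeminormedAddCommGroup E] {t : ℝ≥0} {x : ℝ≥0 → E}
    (hx : ContinuousOn x (Set.Iic t)) {δ : ℝ} (hδ : 0 < δ) :
    ∀ᶠ n : ℕ in atTop, ∀ s r, s ≤ r → r ≤ t → (r : ℝ) - s ≤ t / n → ‖x r - x s‖ ≤ δ := by
  have hc : IsCompact (Set.Iic t) := by
    rw [← Set.Icc_bot]; exact isCompact_Icc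
  obtain ⟨κ, hκ, h⟩ := Metric.uniformContinuousOn_iff.1 (hc.uniformContinuousOn_of_continuous hx) δ hδ
  have h1 : Tendsto (fun n : ℕ => (t : ℝ) / n) atTop (𝓝 0) := tendsto_const_div_atTop_nhds_zero_nat _
  filter_upwards [h1.eventually (gt_mem_nhds hκ)] with n hn s r hsr hr hrs
  rw [← dist_eq_norm]
  refine (h r hr s (hsr.trans hr) ?_).le
  rw [NNReal.dist_eq, abs_of_nonneg (by simpa using hsr)]
  exact hrs.trans_lt hn

/-! ### Riemann sums against a monotone functional-valued path -/

/-- Riemann sum of `e^{εΔ} x` against `η`. -/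
def riemannSum (ε : ℝ) (x : ℝ≥0 → L2) (η : ℝ≥0 → Hm2sym) (t : ℝ≥0) (n : ℕ) : ℝ :=
  ∑ i ∈ Finset.range n, (η (grid t n (i + 1)) - η (grid t n i)) (heat ε (x (grid t n i)))

section Riemann

variable {ε : ℝ} {x : ℝ≥0 → L2} {η : ℝ≥0 → Hm2sym} {t : ℝ≥0}

theorem increment_nonneg (hη : ∀ u : H2sym, u.fn ∈ U2 → MonotoneOn (fun s => η s u) (Set.Iic t))
    {s r : ℝ≥0} (hsr : s ≤ r) (hr : r ≤ t) (z : H2sym) (hz : z.fn ∈ U2) : 0 ≤ (η r - η s) z := by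
  have := hη z hz (hsr.trans hr) hr hsr
  rw [sub_apply]
  simp only at this
  linarith

/-- Passing to an `m`-fold refinement replaces `x` at a coarse point by `x` at a fine one, an
oscillation of size `δ`. Each fine increment of `η` is non-negative on the cone, hence bounded on
heat-regularised vectors by its value at `-e₁`, and these values telescope. Monotonicity thus plays
the role of bounded variation. -/
theorem abs_riemannSum_sub_le (hε : 0 < ε)
    (hη : ∀ u : H2sym, u.fn ∈ U2 → MonotoneOn (fun s => η s u) (Set.Iic t)) {δ : ℝ} {n m : ℕ}
    (hn : 0 < n) (hm : 0 < m)
    (hδ : ∀ s r, s ≤ r → r ≤ t → (r : ℝ) - s ≤ t / n → ‖x r - x s‖ ≤ δ) :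
    |riemannSum ε x η t n - riemannSum ε x η t (n * m)|
      ≤ heatBound ε * δ * (η t - η 0) (-eH2 1) := by
  have hnm : 0 < n * m := Nat.mul_pos hn hm
  have h1 : ∀ i, (η (grid t n (i + 1)) - η (grid t n i))
      = ∑ j ∈ Finset.range m, (η (grid t (n * m) (i * m + j + 1)) - η (grid t (n * m) (i * m + j))) := by
    intro i
    have := Finset.sum_range_sub (fun j => η (grid t (n * m) (i * m + j))) m
    simp only [← add_assoc, add_zero] at this
    rw [this, grid_mul t n i hm, show i * m + m = (i + 1) * m by ring, grid_mul t n (i + 1) hm]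
  have h2 : riemannSum ε x η t n - riemannSum ε x η t (n * m)
      = ∑ i ∈ Finset.range n, ∑ j ∈ Finset.range m,
        (η (grid t (n * m) (i * m + j + 1)) - η (grid t (n * m) (i * m + j)))
          (heat ε (x (grid t n i) - x (grid t (n * m) (i * m + j)))) := by
    rw [riemannSum, riemannSum, sum_range_mul_eq, ← Finset.sum_sub_distrib]
    refine Finset.sum_congr rfl fun i _ => ?_
    rw [h1, sum_apply, ← Finset.sum_sub_distrib]
    refine Finset.sum_congr rfl fun j _ => ?_
    rw [heat_sub hε, map_sub]
  have h3 : (η t - η 0) (-eH2 1) = ∑ i ∈ Finset.range n, ∑ j ∈ Finset.range m,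
        (η (grid t (n * m) (i * m + j + 1)) - η (grid t (n * m) (i * m + j))) (-eH2 1) := by
    rw [← sum_range_mul_eq (fun k => (η (grid t (n * m) (k + 1)) - η (grid t (n * m) k)) (-eH2 1)),
      ← sum_apply, Finset.sum_range_sub (fun k => η (grid t (n * m) k)),
      grid_self t hnm, grid_zero]
  rw [h2, h3, Finset.mul_sum]
  refine (Finset.abs_sum_le_sum_abs _ _).trans (Finset.sum_le_sum fun i hi => ?_)
  rw [Finset.mul_sum]
  refine (Finset.abs_sum_le_sum_abs _ _).trans (Finset.sum_le_sum fun j hj => ?_)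
  rw [Finset.mem_range] at hi hj
  have hidx : i * m + j + 1 ≤ n * m := by nlinarith
  have hle := grid_le t hidx
  have hpos := increment_nonneg hη (grid_mono t (n * m) (Nat.le_succ (i * m + j))) hle
  refine (abs_apply_heat_le hε hpos _).trans ?_
  have hv : 0 ≤ (η (grid t (n * m) (i * m + j + 1)) - η (grid t (n * m) (i * m + j))) (-eH2 1) := by
    refine hpos _ ?_
    have := smul_add_eH2_mem_U2 1 (c := 0) (by simp)
    simpa using this
  have hx : ‖x (grid t n i) - x (grid t (n * m) (i * m + j))‖ ≤ δ := by
    rw [norm_sub_rev]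
    have e1 : grid t n i ≤ grid t (n * m) (i * m + j) := by
      rw [← grid_mul t n i hm]; exact grid_mono t _ (by omega)
    have e2 : grid t (n * m) (i * m + j) ≤ grid t n (i + 1) := by
      rw [← grid_mul t n (i + 1) hm]; exact grid_mono t _ (by nlinarith)
    refine hδ _ _ e1 ((grid_mono t (n * m) (Nat.le_succ _)).trans hle) ?_
    rw [← grid_coe_succ_sub t n i]
    have : ((grid t (n * m) (i * m + j) : ℝ≥0) : ℝ) ≤ grid t n (i + 1) := by exact_mod_cast e2
    linarith
  have := heatBound_nonneg ε
  gcongr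

/-- The Riemann sums are Cauchy: the sums for `n` and `N` are both compared with the one for the
common refinement `n * N`. Consequently the `limUnder` in `pathIntegral` is a true limit. -/
theorem tendsto_riemannSum (hε : 0 < ε) (hx : ContinuousOn x (Set.Iic t))
    (hη : ∀ u : H2sym, u.fn ∈ U2 → MonotoneOn (fun s => η s u) (Set.Iic t)) :
    Tendsto (riemannSum ε x η t) atTop (𝓝 (pathIntegral (fun r => heat ε (x r)) η t)) := by
  have hcauchy : CauchySeq (riemannSum ε x η t) := by
    refine Metric.cauchySeq_iff'.2 fun κ hκ => ?_
    set A := heatBound ε * (η t - η 0) (-eH2 1) with hA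
    have hA0 : 0 ≤ A := by
      refine mul_nonneg (heatBound_nonneg ε) (increment_nonneg hη bot_le le_rfl _ ?_)
      have := smul_add_eH2_mem_U2 1 (c := 0) (by simp)
      simpa using this
    have hδ : 0 < κ / (4 * (A + 1)) := by positivity
    obtain ⟨N, hN⟩ := eventually_atTop.1 ((exists_forall_grid_lt hx hδ).and (eventually_gt_atTop 0))
    refine ⟨N, fun n hn => ?_⟩
    have h1 := abs_riemannSum_sub_le hε hη (hN n hn).2 (hN N le_rfl).2 (hN n hn).1
    have h2 := abs_riemannSum_sub_le hε hη (hN N le_rfl).2 (hN n hn).2 (hN N le_rfl).1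
    rw [mul_comm N n] at h2
    have h3 : heatBound ε * (κ / (4 * (A + 1))) * (η t - η 0) (-eH2 1) ≤ κ / 4 := by
      have : heatBound ε * (κ / (4 * (A + 1))) * (η t - η 0) (-eH2 1)
          = A * (κ / (4 * (A + 1))) := by rw [hA]; ring
      rw [this, mul_div_assoc', div_le_div_iff₀ (by positivity) (by positivity)]
      nlinarith
    rw [Real.dist_eq]
    have h4 := abs_le.1 (h1.trans h3)
    have h5 := abs_le.1 (h2.trans h3)
    exact abs_lt.2 ⟨by linarith [h4.1, h5.2], by linarith [h4.2, h5.1]⟩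
  have h1 : pathIntegral (fun r => heat ε (x r)) η t = limUnder atTop (riemannSum ε x η t) := by
    rw [pathIntegral]
    congr 1
    funext n
    refine Finset.sum_congr rfl fun i _ => ?_
    simp only [grid, Nat.cast_add, Nat.cast_one]
  rw [h1]
  exact hcauchy.tendsto_limUnder

end Riemann

/-! ### The energy inequality -/

/-- The regularised norm `(1 + ⟨e^{εΔ} u, u⟩)^{1/2}`. -/
def energy (ε : ℝ) (u : L2) : ℝ := √(1 + inner ℝ u (heat ε u).fn)

theorem energy_sq {ε : ℝ} (hε : 0 < ε) (u : L2) :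
    energy ε u ^ 2 = 1 + inner ℝ u (heat ε u).fn :=
  Real.sq_sqrt (by linarith [inner_heat_self_nonneg hε u])

theorem one_le_energy {ε : ℝ} (hε : 0 < ε) (u : L2) : 1 ≤ energy ε u := by
  rw [energy, Real.one_le_sqrt]
  linarith [inner_heat_self_nonneg hε u]

theorem norm_heat_fn_le_energy {ε : ℝ} (hε : 0 < ε) (u : L2) : ‖(heat ε u).fn‖ ≤ energy ε u :=
  Real.le_sqrt_of_sq_le (by linarith [norm_heat_fn_sq_le hε u])

theorem energy_le {ε : ℝ} (hε : 0 < ε) (u : L2) : energy ε u ≤ 1 + ‖u‖ := by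
  refine Real.sqrt_le_iff.2 ⟨by positivity, ?_⟩
  nlinarith [inner_heat_self_le hε u, norm_nonneg u]

theorem continuous_energy {ε : ℝ} (hε : 0 < ε) : Continuous (energy ε) := by
  have h : Continuous fun u : L2 => (heat ε u).fn := fnCLM.continuous.comp (continuous_heat hε)
  unfold energy
  fun_prop

/-- This is the concavity of the square root: `E_b - E_a ≤ (E_b² - E_a²) / (2 E_a)`, and the
difference of squares is an exact quadratic expansion. Since `E_a ≥ 1`, the prefactor of the
non-negative second-order term may be dropped. -/
theorem energy_sub_le {ε : ℝ} (hε : 0 < ε) (a b : L2) :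
    energy ε b - energy ε a ≤ (energy ε a)⁻¹ * inner ℝ (b - a) (heat ε a).fn
      + 1 / 2 * inner ℝ (b - a) (heat ε (b - a)).fn := by
  have ha := one_le_energy hε a
  have hQ := inner_heat_self_nonneg hε (b - a)
  have h1 : energy ε b ^ 2 = energy ε a ^ 2 + 2 * inner ℝ (b - a) (heat ε a).fn
      + inner ℝ (b - a) (heat ε (b - a)).fn := by
    rw [energy_sq hε, energy_sq hε, heat_sub hε, fn_sub, inner_sub_right, inner_sub_left,
      inner_sub_left, inner_heat_comm hε b a]
    ring
  have h2 : energy ε b - energy ε a ≤ (energy ε a)⁻¹ * (inner ℝ (b - a) (heat ε a).fn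
      + 1 / 2 * inner ℝ (b - a) (heat ε (b - a)).fn) := by
    rw [inv_mul_eq_div, le_div_iff₀ (by linarith)]
    nlinarith [sq_nonneg (energy ε b - energy ε a)]
  refine h2.trans ?_
  rw [mul_add]
  exact add_le_add le_rfl (mul_le_of_le_one_left (by linarith) (inv_le_one_of_one_le₀ ha))

/-- The integrand of the martingale term. -/
def unitHeat (ε : ℝ) (u : L2) : L2 := (energy ε u)⁻¹ • (heat ε u).fn

theorem norm_unitHeat_le {ε : ℝ} (hε : 0 < ε) (u : L2) : ‖unitHeat ε u‖ ≤ 1 := by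
  have h1 := one_le_energy hε u
  rw [unitHeat, norm_smul, norm_inv, Real.norm_eq_abs, abs_of_pos (by linarith),
    inv_mul_le_iff₀ (by linarith), mul_one]
  exact norm_heat_fn_le_energy hε u

theorem continuous_unitHeat {ε : ℝ} (hε : 0 < ε) : Continuous (unitHeat ε) := by
  have h : Continuous fun u : L2 => (heat ε u).fn := fnCLM.continuous.comp (continuous_heat hε)
  exact ((continuous_energy hε).inv₀ fun u => by linarith [one_le_energy hε u] |> ne_of_gt).smul h

/-- One step of the energy inequality. -/
theorem energy_step {ε C ρ δ κ : ℝ} (hε : 0 < ε) (hC : 0 ≤ C) (hκ : 0 ≤ κ) (hδ0 : 0 ≤ δ) (hδ1 : δ ≤ 1)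
    {a b w : L2} {ℓ : Hm2sym} (ha : a ∈ U2) (hρ : ‖a‖ ≤ ρ) (hab : ‖b - a‖ ≤ δ)
    (hℓ : ∀ z : H2sym, z.fn ∈ U2 → 0 ≤ ℓ z)
    (hstep : ∀ z : H2sym, inner ℝ (b - a) z.fn
      ≤ κ * (C * ‖z.fn‖ + inner ℝ a z.lap + δ * ‖z.lap‖) + inner ℝ w z.fn + ℓ z) :
    energy ε b - energy ε a ≤ κ * C + inner ℝ w (unitHeat ε a) + ℓ (heat ε a) + 1 / 2 * ‖w‖ ^ 2
      + δ * (κ * (C + 2 * ρ * heatBound ε + heatBound ε) + heatBound ε * ℓ (-eH2 1)) := by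
  set H := heatBound ε with hH
  have hH0 : 0 ≤ H := heatBound_nonneg ε
  have hρ0 : 0 ≤ ρ := (norm_nonneg a).trans hρ
  have hE := one_le_energy hε a
  have hEinv0 : 0 ≤ (energy ε a)⁻¹ := by positivity
  have hEinv1 : (energy ε a)⁻¹ ≤ 1 := inv_le_one_of_one_le₀ hE
  refine (energy_sub_le hε a b).trans ?_
  have h1 : (energy ε a)⁻¹ * inner ℝ (b - a) (heat ε a).fn
      ≤ κ * C + κ * (δ * (ρ * H)) + inner ℝ w (unitHeat ε a) + ℓ (heat ε a) := by
    have e1 := mul_le_mul_of_nonneg_left (hstep (heat ε a)) hEinv0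
    have e2 : inner ℝ w (unitHeat ε a) = (energy ε a)⁻¹ * inner ℝ w (heat ε a).fn := by
      rw [unitHeat, inner_smul_right]
    have e3 : (energy ε a)⁻¹ * ‖(heat ε a).fn‖ ≤ 1 := by
      rw [inv_mul_le_iff₀ (by linarith), mul_one]
      exact norm_heat_fn_le_energy hε a
    -- Dissipativity of the Laplacian: the only main term of this order is discarded by its sign.
    have e4 : (energy ε a)⁻¹ * inner ℝ a (heat ε a).lap ≤ 0 :=
      mul_nonpos_of_nonneg_of_nonpos hEinv0 (inner_lap_heat_nonpos hε a)
    have e5 : ‖(heat ε a).lap‖ ≤ ρ * H := by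
      refine (norm_lap_le _).trans ((norm_heat_le hε a).trans ?_)
      rw [mul_comm]; gcongr
    have e6 : (energy ε a)⁻¹ * (δ * ‖(heat ε a).lap‖) ≤ δ * (ρ * H) := by
      calc (energy ε a)⁻¹ * (δ * ‖(heat ε a).lap‖) ≤ 1 * (δ * (ρ * H)) := by gcongr
        _ = _ := one_mul _
    -- The heat flow keeps `a` in the cone, so the reflection term is non-negative and its weight,
    -- at most one, can be removed. What remains is the integral that appears in the fourth
    -- condition on solutions.
    have e7 : (energy ε a)⁻¹ * ℓ (heat ε a) ≤ ℓ (heat ε a) :=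
      mul_le_of_le_one_left (hℓ _ (heat_mem_U2 hε ha)) hEinv1
    have e8 : (energy ε a)⁻¹ * (κ * (C * ‖(heat ε a).fn‖ + inner ℝ a (heat ε a).lap
        + δ * ‖(heat ε a).lap‖)) ≤ κ * (C + δ * (ρ * H)) := by
      have : (energy ε a)⁻¹ * (κ * (C * ‖(heat ε a).fn‖ + inner ℝ a (heat ε a).lap
        + δ * ‖(heat ε a).lap‖)) = κ * (C * ((energy ε a)⁻¹ * ‖(heat ε a).fn‖)
          + (energy ε a)⁻¹ * inner ℝ a (heat ε a).lap
          + (energy ε a)⁻¹ * (δ * ‖(heat ε a).lap‖)) := by ring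
      rw [this]
      refine mul_le_mul_of_nonneg_left ?_ hκ
      nlinarith
    rw [e2]
    nlinarith
  have h2 : 1 / 2 * inner ℝ (b - a) (heat ε (b - a)).fn
      ≤ κ * (δ * (C + ρ * H + H)) + 1 / 2 * ‖w‖ ^ 2 + H * δ * ℓ (-eH2 1) := by
    have e1 := hstep (heat ε (b - a))
    have e2 : ‖(heat ε (b - a)).fn‖ ≤ δ := (norm_heat_fn_le hε _).trans hab
    have e3 : ‖(heat ε (b - a)).lap‖ ≤ H * δ :=
      (norm_lap_le _).trans ((norm_heat_le hε _).trans (by gcongr))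
    have e4 : inner ℝ a (heat ε (b - a)).lap ≤ ρ * (H * δ) :=
      (real_inner_le_norm _ _).trans (by gcongr)
    have e5 : ℓ (heat ε (b - a)) ≤ H * δ * ℓ (-eH2 1) := by
      refine (le_abs_self _).trans ((abs_apply_heat_le hε hℓ _).trans ?_)
      have hv : 0 ≤ ℓ (-eH2 1) := by
        refine hℓ _ ?_
        have := smul_add_eH2_mem_U2 1 (c := 0) (by simp)
        simpa using this
      gcongr
    -- Young's inequality for the positive form `⟨·, e^{εΔ} ·⟩`. The half of the quadratic term
    -- produced on the right is absorbed by the left-hand side, leaving `‖w‖² / 2`.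
    have e6 : inner ℝ w (heat ε (b - a)).fn
        ≤ 1 / 2 * inner ℝ (b - a) (heat ε (b - a)).fn + 1 / 2 * ‖w‖ ^ 2 := by
      have q1 := inner_heat_self_nonneg hε (b - a - w)
      have q2 := inner_heat_self_le hε w
      rw [heat_sub hε (b - a) w, fn_sub, inner_sub_right, inner_sub_left, inner_sub_left _ w,
        inner_heat_comm hε w (b - a)] at q1
      linarith
    have e7 : κ * (C * ‖(heat ε (b - a)).fn‖ + inner ℝ a (heat ε (b - a)).lap
        + δ * ‖(heat ε (b - a)).lap‖) ≤ κ * (δ * (C + ρ * H + H)) := by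
      refine mul_le_mul_of_nonneg_left ?_ hκ
      have : δ * ‖(heat ε (b - a)).lap‖ ≤ 1 * (H * δ) := by gcongr
      nlinarith
    linarith
  nlinarith

/-- The energy inequality along the uniform subdivisions. -/
theorem eventually_energy_le {ε C : ℝ} (hε : 0 < ε) (hC : 0 ≤ C) {t : ℝ≥0} {x w : ℝ≥0 → L2}
    {η : ℝ≥0 → Hm2sym} (hxU : ∀ s ≤ t, x s ∈ U2) (hx : ContinuousOn x (Set.Iic t))
    (hη : ∀ u : H2sym, u.fn ∈ U2 → MonotoneOn (fun s => η s u) (Set.Iic t))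
    (hstep : ∀ s r, s ≤ r → r ≤ t → ∀ δ : ℝ, (∀ q, s ≤ q → q ≤ r → ‖x q - x s‖ ≤ δ) → ∀ z : H2sym,
      inner ℝ (x r - x s) z.fn ≤ ((r : ℝ) - s) * (C * ‖z.fn‖ + inner ℝ (x s) z.lap + δ * ‖z.lap‖)
        + inner ℝ (w r - w s) z.fn + (η r - η s) z)
    {κ : ℝ} (hκ : 0 < κ) :
    ∀ᶠ n : ℕ in atTop,
      energy ε (x t) - energy ε (x 0) - t * C - pathIntegral (fun r => heat ε (x r)) η t
        ≤ (∑ i ∈ Finset.range n, inner ℝ (w (grid t n (i + 1)) - w (grid t n i))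
            (unitHeat ε (x (grid t n i))))
          + 1 / 2 * (∑ i ∈ Finset.range n, ‖w (grid t n (i + 1)) - w (grid t n i)‖ ^ 2) + κ := by
  have hcpt : IsCompact (Set.Iic t) := by
    rw [← Set.Icc_bot]; exact isCompact_Icc
  obtain ⟨ρ, hρ⟩ := hcpt.exists_bound_of_continuousOn hx
  have hρ0 : 0 ≤ ρ := (norm_nonneg _).trans (hρ 0 (bot_le : (0 : ℝ≥0) ≤ t))
  -- `A` is the sum over the subdivision of all the terms that `energy_step` multiplies by `δ`. The
  -- choice of `δ` makes their total at most `κ / 2`; the other `κ / 2` pays for replacing the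
  -- Riemann sum of the reflection term by its limit.
  set A := t * (C + 2 * ρ * heatBound ε + heatBound ε) + heatBound ε * (η t - η 0) (-eH2 1) with hA
  have hA0 : 0 ≤ A := by
    have h1 : 0 ≤ (η t - η 0) (-eH2 1) := by
      refine increment_nonneg hη bot_le le_rfl _ ?_
      have := smul_add_eH2_mem_U2 1 (c := 0) (by simp)
      simpa using this
    have := heatBound_nonneg ε
    positivity
  have hδ : 0 < min 1 (κ / (2 * (A + 1))) := by positivity
  set δ := min 1 (κ / (2 * (A + 1))) with hδdef
  have hδA : δ * A ≤ κ / 2 := by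
    have : δ ≤ κ / (2 * (A + 1)) := min_le_right _ _
    calc δ * A ≤ κ / (2 * (A + 1)) * A := by gcongr
      _ ≤ κ / 2 := by
        rw [div_mul_eq_mul_div, div_le_div_iff₀ (by positivity) (by positivity)]
        nlinarith
  have hR := (tendsto_riemannSum hε hx hη).eventually
    (gt_mem_nhds (show pathIntegral (fun r => heat ε (x r)) η t
      < pathIntegral (fun r => heat ε (x r)) η t + κ / 2 by linarith))
  filter_upwards [exists_forall_grid_lt hx hδ, hR, eventually_gt_atTop 0] with n hn hRn hn0
  have hsum : ∑ i ∈ Finset.range n, (energy ε (x (grid t n (i + 1))) - energy ε (x (grid t n i)))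
      ≤ ∑ i ∈ Finset.range n, ((t / n : ℝ) * C
        + inner ℝ (w (grid t n (i + 1)) - w (grid t n i)) (unitHeat ε (x (grid t n i)))
        + (η (grid t n (i + 1)) - η (grid t n i)) (heat ε (x (grid t n i)))
        + 1 / 2 * ‖w (grid t n (i + 1)) - w (grid t n i)‖ ^ 2
        + δ * ((t / n : ℝ) * (C + 2 * ρ * heatBound ε + heatBound ε)
          + heatBound ε * (η (grid t n (i + 1)) - η (grid t n i)) (-eH2 1))) := by
    refine Finset.sum_le_sum fun i hi => ?_
    rw [Finset.mem_range] at hi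
    have hmono := grid_mono t n (Nat.le_succ i)
    have hle := grid_le t (n := n) (i := i + 1) hi
    have hlen := grid_coe_succ_sub t n i
    have hosc : ∀ q, grid t n i ≤ q → q ≤ grid t n (i + 1) → ‖x q - x (grid t n i)‖ ≤ δ := by
      intro q h1 h2
      refine hn _ _ h1 (h2.trans hle) ?_
      have : (q : ℝ) ≤ grid t n (i + 1) := by exact_mod_cast h2
      linarith
    refine energy_step hε hC (by positivity) hδ.le (min_le_left _ _) (hxU _ (hmono.trans hle))
      (hρ _ (hmono.trans hle)) (hosc _ hmono le_rfl) (increment_nonneg hη hmono hle) (fun z => ?_)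
    have := hstep _ _ hmono hle δ hosc z
    rwa [hlen] at this
  rw [Finset.sum_range_sub (fun i => energy ε (x (grid t n i))), grid_self t hn0, grid_zero] at hsum
  simp only [Finset.sum_add_distrib, ← Finset.mul_sum, Finset.sum_const, Finset.card_range,
    nsmul_eq_mul] at hsum
  have hn' : (n : ℝ) ≠ 0 := by exact_mod_cast hn0.ne'
  have e1 : (t / n : ℝ) * (n * C) = t * C := by field_simp
  have e2 : (t / n : ℝ) * (n * C + 2 * ρ * (n * heatBound ε) + n * heatBound ε)
      = t * (C + 2 * ρ * heatBound ε + heatBound ε) := by field_simp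
  have e3 : ∑ i ∈ Finset.range n, (η (grid t n (i + 1)) - η (grid t n i)) (-eH2 1)
      = (η t - η 0) (-eH2 1) := by
    rw [← sum_apply, Finset.sum_range_sub (fun k => η (grid t n k)),
      grid_self t hn0, grid_zero]
  rw [e1, e2, e3, ← hA] at hsum
  unfold riemannSum at hRn
  linarith

end

section

/-! ### The amplitudes of the noise -/

/-- The amplitude `(1 ∨ k)^{-λ}` of the noise in the direction `e_k`. -/
def amp (lam : ℝ) (k : ℕ) : ℝ := ((max 1 k : ℕ) : ℝ) ^ (-lam)

theorem summable_amp_sq (hlam : 1 / 2 < lam) : Summable fun k => amp lam k ^ 2 := by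
  rw [← summable_nat_add_iff 1]
  have h : Summable fun k : ℕ => ((k : ℝ)) ^ (-(2 * lam)) := Real.summable_nat_rpow.2 (by linarith)
  refine ((summable_nat_add_iff 1).2 h).congr fun k => ?_
  rw [amp, max_eq_right (by omega), ← Real.rpow_natCast, ← Real.rpow_mul (by positivity)]
  congr 1
  push_cast
  ring

/-- The trace of the covariance of the noise. -/
def ampTrace (lam : ℝ) : ℝ := ∑' k, amp lam k ^ 2

theorem summable_smul_e {c : ℕ → ℝ} (hc : Summable fun k => c k ^ 2) : Summable fun k => c k • e k := by
  have h := (orthonormal_e.orthogonalFamily.summable_iff_norm_sq_summable c).2 (by simpa using hc)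
  simpa using h

/-- The truncated increment of the stochastic integral of a frozen integrand. -/
def noiseInc {Ω : Type*} (lam : ℝ) (B : ℕ → ℝ≥0 → Ω → ℝ) (K : ℕ) (s r : ℝ≥0) (Z : Ω → L2) (ω : Ω) : ℝ :=
  ∑ k ∈ Finset.range K, amp lam k * inner ℝ (e k) (Z ω) * (B k r ω - B k s ω)

/-- The squared norm of the truncated increment of the noise. -/
def noiseIncSq {Ω : Type*} (lam : ℝ) (B : ℕ → ℝ≥0 → Ω → ℝ) (K : ℕ) (s r : ℝ≥0) (ω : Ω) : ℝ :=
  ∑ k ∈ Finset.range K, amp lam k ^ 2 * (B k r ω - B k s ω) ^ 2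

/-- Cauchy–Schwarz, then Bessel's inequality for `Z`, whose norm is at most one. -/
theorem noiseInc_sq_le {Ω : Type*} {B : ℕ → ℝ≥0 → Ω → ℝ} {lam : ℝ} (K : ℕ) (s r : ℝ≥0) {Z : Ω → L2} (hZ : ∀ ω, ‖Z ω‖ ≤ 1) (ω : Ω) :
    noiseInc lam B K s r Z ω ^ 2 ≤ noiseIncSq lam B K s r ω := by
  have h1 := Finset.sum_mul_sq_le_sq_mul_sq (Finset.range K) (fun k => inner ℝ (e k) (Z ω))
    (fun k => amp lam k * (B k r ω - B k s ω))
  have h2 := orthonormal_e.sum_inner_products_le (Z ω) (s := Finset.range K)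
  simp only [Real.norm_eq_abs, sq_abs] at h2
  have h3 : ∑ k ∈ Finset.range K, inner ℝ (e k) (Z ω) ^ 2 ≤ 1 :=
    h2.trans (pow_le_one₀ (norm_nonneg _) (hZ ω))
  have h4 : noiseInc lam B K s r Z ω
      = ∑ k ∈ Finset.range K, inner ℝ (e k) (Z ω) * (amp lam k * (B k r ω - B k s ω)) :=
    Finset.sum_congr rfl fun k _ => by ring
  have h5 : noiseIncSq lam B K s r ω
      = ∑ k ∈ Finset.range K, (amp lam k * (B k r ω - B k s ω)) ^ 2 :=
    Finset.sum_congr rfl fun k _ => by ring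
  rw [h4, h5]
  refine h1.trans ?_
  exact mul_le_of_le_one_left (Finset.sum_nonneg fun k _ => sq_nonneg _) h3

/-! ### Measurability along the solution, and the increments of the equation -/

theorem IsField.measurable_comp {T : ℝ≥0} {V : ℝ≥0 → UnitAddCircle → P2 → ℝ} (hV : IsField T V)
    {α : Type*} [MeasurableSpace α] {τ : α → ℝ≥0} (hτ : Measurable τ) (hτT : ∀ a, τ a ≤ T)
    {Y : α → L2} (hY : StronglyMeasurable Y) (hU : ∀ a, Y a ∈ U2) :
    Measurable fun p : α × UnitAddCircle => V (τ p.1) p.2 (law (Y p.1)) := by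
  have h1 : Measurable fun p : α × UnitAddCircle =>
      ((⟨τ p.1, hτT p.1⟩ : Set.Iic T), p.2, law (Y p.1)) :=
    ((hτ.comp measurable_fst).subtype_mk).prodMk
      (measurable_snd.prodMk ((measurable_law hY hU).comp measurable_fst))
  exact hV.measurable.comp h1

variable {Ω : Type*} [mΩ : MeasurableSpace Ω] {P : Measure Ω} {ℱ : Filtration ℝ≥0 mΩ}
  {B : ℕ → ℝ≥0 → Ω → ℝ} {lam : ℝ} {T : ℝ≥0} {V : ℝ≥0 → UnitAddCircle → P2 → ℝ} {x₀ : L2}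
  {X : ℝ≥0 → Ω → L2} {η : ℝ≥0 → Ω → Hm2sym}

theorem IsSolution.continuous_min (hX : IsSolution P ℱ B lam T V x₀ X η) (ω : Ω) :
    Continuous fun t => X (min t T) ω :=
  (hX.X_continuous ω).comp_continuous (by fun_prop) fun t => min_le_right t T

theorem IsSolution.min_mem (hX : IsSolution P ℱ B lam T V x₀ X η) (t : ℝ≥0) (ω : Ω) :
    X (min t T) ω ∈ U2 := hX.X_mem _ (min_le_right t T) ω

/-- Joint measurability of the stopped solution, for the σ-algebra generated up to time `t`. -/
theorem IsSolution.stronglyMeasurable_min (hX : IsSolution P ℱ B lam T V x₀ X η) {t : ℝ≥0}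
    (ht : t ≤ T) : StronglyMeasurable[MeasurableSpace.prod inferInstance (ℱ t)]
      fun p : ℝ≥0 × Ω => X (min p.1 t) p.2 := by
  refine @stronglyMeasurable_uncurry_of_continuous_of_stronglyMeasurable Ω L2 ℝ≥0 _ _ _ _ _ _ _
    (ℱ t) (fun s ω => X (min s t) ω) (fun ω => ?_) (fun s => ?_)
  · exact (hX.X_continuous ω).comp_continuous (by fun_prop) fun s => (min_le_right s t).trans ht
  · exact (hX.X_adapted _ ((min_le_right s t).trans ht)).mono (ℱ.mono (min_le_right s t))

theorem IsSolution.stronglyMeasurable_uncurry (hX : IsSolution P ℱ B lam T V x₀ X η) :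
    StronglyMeasurable fun p : ℝ≥0 × Ω => X (min p.1 T) p.2 :=
  (hX.stronglyMeasurable_min le_rfl).mono (sup_le_sup le_rfl (MeasurableSpace.comap_mono (ℱ.le T)))

theorem setIntegral_Iic_sub {a : ℝ≥0 → ℝ} {s r : ℝ≥0} (hsr : s ≤ r)
    (ha : IntegrableOn a (Set.Iic r) leb) :
    (∫ q in Set.Iic r, a q ∂leb) - ∫ q in Set.Iic s, a q ∂leb = ∫ q in Set.Ioc s r, a q ∂leb := by
  rw [← Set.Iic_union_Ioc_eq_Iic hsr, setIntegral_union ?_ measurableSet_Ioc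
    (ha.mono_set (Set.Iic_subset_Iic.2 hsr)) (ha.mono_set Set.Ioc_subset_Iic_self)]
  · ring
  · exact Set.disjoint_left.2 fun q hq hq' => not_lt.2 hq hq'.1

theorem leb_real_Ioc {s r : ℝ≥0} (hsr : s ≤ r) : leb.real (Set.Ioc s r) = (r : ℝ) - s := by
  rw [Measure.real, leb_Ioc, ENNReal.toReal_ofReal]
  simpa using hsr

theorem integral_abs_le_norm (u : L2) : ∫ x, |u x| ≤ ‖u‖ := by
  have h4 : ∫ x, |u x| = ∫ x, ‖u x‖ := rfl
  rw [h4, Lp.norm_def, integral_norm_eq_lintegral_enorm (Lp.aestronglyMeasurable _),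
    ← eLpNorm_one_eq_lintegral_enorm]
  exact ENNReal.toReal_mono (Lp.eLpNorm_ne_top _)
    (eLpNorm_le_eLpNorm_of_exponent_le (by norm_num) (Lp.aestronglyMeasurable _))

theorem abs_integral_mul_le {C : ℝ} {φ : UnitAddCircle → ℝ} (hφ : ∀ x, |φ x| ≤ C) (hC : 0 ≤ C)
    (u : L2) : |∫ x, φ x * u x| ≤ C * ‖u‖ := by
  calc |∫ x, φ x * u x| ≤ ∫ x, C * |u x| := by
        rw [← Real.norm_eq_abs]
        refine norm_integral_le_of_norm_le (u.integrable.abs.const_mul C) (ae_of_all _ fun x => ?_)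
        rw [norm_mul, Real.norm_eq_abs, Real.norm_eq_abs]
        gcongr
        exact hφ x
    _ = C * ∫ x, |u x| := integral_const_mul _ _
    _ ≤ _ := by
        gcongr
        exact integral_abs_le_norm u

/-- Difference of the weak equation between two times, with the Laplacian term frozen at time `s` up
to the oscillation `δ` and the field replaced by its bound. The exceptional event depends on none of
`s`, `r`, `δ`, `z`, so every subdivision can be used on the same event. -/
theorem IsSolution.step (hX : IsSolution P ℱ B lam T V x₀ X η) (hV : IsField T V) {C : ℝ}
    (hC : 0 ≤ C) (hVC : ∀ t ≤ T, ∀ x μ, |V t x μ| ≤ C) :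
    ∀ᵐ ω ∂P, ∀ s r, s ≤ r → r ≤ T → ∀ δ : ℝ, (∀ q, s ≤ q → q ≤ r → ‖X q ω - X s ω‖ ≤ δ) →
      ∀ z : H2sym, inner ℝ (X r ω - X s ω) z.fn
        ≤ ((r : ℝ) - s) * (C * ‖z.fn‖ + inner ℝ (X s ω) z.lap + δ * ‖z.lap‖)
          + inner ℝ (noise lam B r ω - noise lam B s ω) z.fn + (η r ω - η s ω) z := by
  filter_upwards [hX.equation] with ω hω s r hsr hrT δ hδ z
  have hr := hω z r hrT
  have hs := hω z s (hsr.trans hrT)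
  have hfin : ∀ q : ℝ≥0, leb (Set.Iic q) ≠ ⊤ := fun q => by
    rw [leb_Iic]; exact ENNReal.coe_ne_top
  have ha : IntegrableOn (fun q => ∫ x, V q x (law (X q ω)) * z.fn x) (Set.Iic r) leb := by
    -- Nothing is known about `X` and `V` after `T`; stopping at `T` yields functions that are
    -- measurable on the whole time axis, here and below.
    have hY : StronglyMeasurable fun q : ℝ≥0 => X (min q T) ω := (hX.continuous_min ω).stronglyMeasurable
    have h1 := hV.measurable_comp (τ := fun q => min q T) (by fun_prop) (fun q => min_le_right q T) hY
      fun q => hX.min_mem q ω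
    have h2 : StronglyMeasurable fun q : ℝ≥0 =>
        ∫ x, V (min q T) x (law (X (min q T) ω)) * z.fn x :=
      StronglyMeasurable.integral_prod_right (f := fun (q : ℝ≥0) (x : UnitAddCircle) =>
        V (min q T) x (law (X (min q T) ω)) * z.fn x)
        (h1.stronglyMeasurable.mul ((Lp.stronglyMeasurable z.fn).comp_measurable measurable_snd))
    have h3 : IntegrableOn (fun q => ∫ x, V (min q T) x (law (X (min q T) ω)) * z.fn x)
        (Set.Iic r) leb :=
      Measure.integrableOn_of_bounded (M := C * ‖z.fn‖) (hfin r) h2.aestronglyMeasurable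
        (ae_of_all _ fun q => abs_integral_mul_le (hVC _ (min_le_right q T) · _) hC _)
    refine h3.congr_fun (fun q hq => ?_) measurableSet_Iic
    beta_reduce
    rw [min_eq_left (le_trans hq hrT)]
  have hb : IntegrableOn (fun q => inner ℝ (X q ω) z.lap) (Set.Iic r) leb := by
    have hcpt : IsCompact (Set.Iic r) := by
      rw [← Set.Icc_bot]; exact isCompact_Icc
    have hc : ContinuousOn (fun q => inner ℝ (X q ω) z.lap) (Set.Iic r) :=
      ((hX.X_continuous ω).mono (Set.Iic_subset_Iic.2 hrT)).inner continuousOn_const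
    exact hc.integrableOn_of_subset_isCompact hcpt measurableSet_Iic le_rfl (hfin r)
  have e1 := setIntegral_Iic_sub hsr ha
  have e2 := setIntegral_Iic_sub hsr hb
  have b1 : -(∫ q in Set.Ioc s r, (∫ x, V q x (law (X q ω)) * z.fn x) ∂leb)
      ≤ ((r : ℝ) - s) * (C * ‖z.fn‖) := by
    have := norm_setIntegral_le_of_norm_le_const (μ := leb) (s := Set.Ioc s r) (C := C * ‖z.fn‖)
      (f := fun q => ∫ x, V q x (law (X q ω)) * z.fn x)
      (by rw [leb_Ioc]; exact ENNReal.ofReal_lt_top)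
      (fun q hq => abs_integral_mul_le (hVC q (hq.2.trans hrT) · _) hC _)
    rw [leb_real_Ioc hsr] at this
    have := neg_le_abs (∫ q in Set.Ioc s r, (∫ x, V q x (law (X q ω)) * z.fn x) ∂leb)
    simp only [Real.norm_eq_abs] at *
    linarith
  have b2 : ∫ q in Set.Ioc s r, inner ℝ (X q ω) z.lap ∂leb
      ≤ ((r : ℝ) - s) * (inner ℝ (X s ω) z.lap + δ * ‖z.lap‖) := by
    have h1 : ∫ q in Set.Ioc s r, inner ℝ (X q ω) z.lap ∂leb
        ≤ ∫ _ in Set.Ioc s r, (inner ℝ (X s ω) z.lap + δ * ‖z.lap‖) ∂leb := by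
      refine setIntegral_mono_on (hb.mono_set Set.Ioc_subset_Iic_self) ?_ measurableSet_Ioc
        fun q hq => ?_
      · exact integrableOn_const (by rw [leb_Ioc]; exact ENNReal.ofReal_ne_top)
      · have h2 : inner ℝ (X q ω) z.lap = inner ℝ (X s ω) z.lap + inner ℝ (X q ω - X s ω) z.lap := by
          rw [inner_sub_left]; ring
        rw [h2]
        gcongr
        refine (real_inner_le_norm _ _).trans ?_
        gcongr
        exact hδ q hq.1.le hq.2
    rwa [setIntegral_const, leb_real_Ioc hsr, smul_eq_mul] at h1
  have h3 : inner ℝ (X r ω - X s ω) z.fn = inner ℝ (X r ω - x₀) z.fn - inner ℝ (X s ω - x₀) z.fn := by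
    rw [← inner_sub_left]; congr 1; abel
  rw [h3, hr, hs, inner_sub_left, sub_apply]
  linarith

/-! ### The noise -/

section Noise

theorem IsNoise.memLp_sub (hB : IsNoise P ℱ B) (k : ℕ) (s r : ℝ≥0) :
    MemLp (fun ω => B k r ω - B k s ω) 2 P := by
  have h := (hB.brownian k).hasLaw_sub r s
  have h1 : MemLp (id ∘ (B k r - B k s)) 2 P := by
    refine (memLp_map_measure_iff (by fun_prop) h.aemeasurable).1 ?_
    rw [h.map_eq]
    exact memLp_id_gaussianReal' 2 (by simp)
  exact h1

theorem IsNoise.integral_sub (hB : IsNoise P ℱ B) (k : ℕ) (s r : ℝ≥0) :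
    ∫ ω, (B k r ω - B k s ω) ∂P = 0 := by
  have h := (hB.brownian k).hasLaw_sub r s
  have := h.integral_eq
  rw [integral_id_gaussianReal] at this
  exact this

theorem IsNoise.integral_sub_sq (hB : IsNoise P ℱ B) (k : ℕ) {s r : ℝ≥0} (hsr : s ≤ r) :
    ∫ ω, (B k r ω - B k s ω) ^ 2 ∂P = (r : ℝ) - s := by
  have h := (hB.brownian k).hasLaw_sub r s
  have h1 := h.variance_eq
  rw [variance_id_gaussianReal, variance_eq_integral h.aemeasurable] at h1
  have h2 : ∫ ω, (B k r - B k s) ω ∂P = 0 := hB.integral_sub k s r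
  rw [h2] at h1
  simp only [sub_zero, Pi.sub_apply] at h1
  rw [h1, coe_nndist, Real.dist_eq, abs_of_nonneg (by simpa using hsr)]
  rfl

theorem IsNoise.integral_sq (hB : IsNoise P ℱ B) (k : ℕ) (t : ℝ≥0) :
    ∫ ω, B k t ω ^ 2 ∂P = t ∧ MemLp (B k t) 2 P := by
  have h0 := (hB.brownian k).eval_zero_ae_eq_zero
  have h1 := hB.integral_sub_sq k (zero_le : 0 ≤ t)
  have h2 := hB.memLp_sub k 0 t
  have h3 : (fun ω => B k t ω - B k 0 ω) =ᵐ[P] B k t := by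
    filter_upwards [h0] with ω hω
    simp [hω]
  refine ⟨?_, h2.ae_eq h3⟩
  rw [NNReal.coe_zero, sub_zero] at h1
  rw [← h1]
  refine integral_congr_ae ?_
  filter_upwards [h3] with ω hω
  rw [hω]

/-- The expected sum of the squared coefficients is `t` times the trace, which is finite as `λ >
1/2`. Hence the series defining `noise` almost surely converges. -/
theorem IsNoise.hasSum_noise (hB : IsNoise P ℱ B) (hlam : 1 / 2 < lam) (t : ℝ≥0) :
    ∀ᵐ ω ∂P, HasSum (fun k => (amp lam k * B k t ω) • e k) (noise lam B t ω) := by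
  have hm : ∀ k, AEMeasurable (fun ω => ENNReal.ofReal ((amp lam k * B k t ω) ^ 2)) P := fun k =>
    (((hB.brownian k).aemeasurable t).const_mul _).pow_const 2 |>.ennreal_ofReal
  have h1 : ∫⁻ ω, ∑' k, ENNReal.ofReal ((amp lam k * B k t ω) ^ 2) ∂P ≠ ⊤ := by
    rw [lintegral_tsum hm]
    have h2 : ∀ k, ∫⁻ ω, ENNReal.ofReal ((amp lam k * B k t ω) ^ 2) ∂P
        = ENNReal.ofReal (amp lam k ^ 2 * t) := by
      intro k
      rw [← ofReal_integral_eq_lintegral_ofReal]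
      · simp only [mul_pow]
        rw [integral_const_mul, (hB.integral_sq k t).1]
      · exact ((hB.integral_sq k t).2.const_mul _).integrable_sq
      · exact ae_of_all _ fun ω => sq_nonneg _
    simp only [h2]
    rw [← ENNReal.ofReal_tsum_of_nonneg (fun k => by positivity) ((summable_amp_sq hlam).mul_right _)]
    exact ENNReal.ofReal_ne_top
  filter_upwards [ae_lt_top' (AEMeasurable.tsum hm) h1] with ω hω
  refine (summable_smul_e ?_).hasSum
  have := ENNReal.summable_toReal hω.ne
  refine this.congr fun k => ?_
  rw [ENNReal.toReal_ofReal (sq_nonneg _)]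

/-- The increment is centred and independent of `ℱ s`. The product formula for independent variables
requires no integrability of `S`. -/
theorem IsNoise.integral_mul_sub (hB : IsNoise P ℱ B) (k : ℕ) {s r : ℝ≥0} (hsr : s ≤ r)
    {S : Ω → ℝ} (hS : Measurable[ℱ s] S) : ∫ ω, S ω * (B k r ω - B k s ω) ∂P = 0 := by
  have h1 : IndepFun (fun ω => B k r ω - B k s ω) S P := by
    have h2 := hB.indep_increments s r hsr
    refine indep_of_indep_of_le_left (indep_of_indep_of_le_right h2 hS.comap_le) ?_
    have h3 : (fun ω => B k r ω - B k s ω) = (fun v : ℕ → ℝ => v k) ∘ (fun ω k => B k r ω - B k s ω) := rfl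
    rw [h3, ← MeasurableSpace.comap_comp]
    exact MeasurableSpace.comap_mono (measurable_pi_apply k).comap_le
  have h2 := h1.symm.integral_mul_eq_mul_integral
    (hS.mono (ℱ.le s) le_rfl).aestronglyMeasurable (hB.memLp_sub k s r).1
  have h3 : ∫ ω, S ω * (B k r ω - B k s ω) ∂P = (∫ ω, S ω ∂P) * ∫ ω, (B k r ω - B k s ω) ∂P := h2
  rw [h3, hB.integral_sub, mul_zero]

theorem IsNoise.integrable_noiseIncSq (hB : IsNoise P ℱ B) (K : ℕ) (s r : ℝ≥0) :
    Integrable (noiseIncSq lam B K s r) P :=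
  integrable_finsetSum _ fun k _ => (hB.memLp_sub k s r).integrable_sq.const_mul _

theorem IsNoise.integral_noiseIncSq_le (hB : IsNoise P ℱ B) (hlam : 1 / 2 < lam) (K : ℕ)
    {s r : ℝ≥0} (hsr : s ≤ r) :
    ∫ ω, noiseIncSq lam B K s r ω ∂P ≤ ampTrace lam * ((r : ℝ) - s) := by
  unfold noiseIncSq
  rw [integral_finsetSum _ fun k _ => (hB.memLp_sub k s r).integrable_sq.const_mul _]
  simp only [integral_const_mul, hB.integral_sub_sq _ hsr]
  rw [← Finset.sum_mul]
  have : (0 : ℝ) ≤ r - s := by simpa using hsr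
  gcongr
  exact (summable_amp_sq hlam).sum_le_tsum _ fun k _ => sq_nonneg _

end Noise

end

/-! ### From the truncated noise to the full noise -/

section

theorem tendsto_noiseInc {Ω : Type*} {B : ℕ → ℝ≥0 → Ω → ℝ} {lam : ℝ} {s r : ℝ≥0} {Z : Ω → L2} {ω : Ω}
    (hs : HasSum (fun k => (amp lam k * B k s ω) • e k) (noise lam B s ω))
    (hr : HasSum (fun k => (amp lam k * B k r ω) • e k) (noise lam B r ω)) :
    Tendsto (fun K => noiseInc lam B K s r Z ω) atTop
      (𝓝 (inner ℝ (noise lam B r ω - noise lam B s ω) (Z ω))) ∧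
    Tendsto (fun K => noiseIncSq lam B K s r ω) atTop (𝓝 (‖noise lam B r ω - noise lam B s ω‖ ^ 2)) := by
  have h1 : HasSum (fun k => (amp lam k * (B k r ω - B k s ω)) • e k)
      (noise lam B r ω - noise lam B s ω) := by
    refine hasSum_of_eq (hr.sub hs) fun k => ?_
    rw [← sub_smul]; ring_nf
  constructor
  · have h2 := (h1.mapL (innerSL ℝ (Z ω))).tendsto_sum_nat
    rw [innerSL_apply_apply, real_inner_comm] at h2
    refine h2.congr fun K => Finset.sum_congr rfl fun k _ => ?_
    rw [innerSL_apply_apply, inner_smul_right, real_inner_comm]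
    ring
  · have h2 := (hasSum_sq_of_smul_e h1).tendsto_sum_nat
    refine h2.congr fun K => Finset.sum_congr rfl fun k _ => ?_
    ring

variable {Ω : Type*} [mΩ : MeasurableSpace Ω] {P : Measure Ω} {ℱ : Filtration ℝ≥0 mΩ}
  {B : ℕ → ℝ≥0 → Ω → ℝ} {lam : ℝ} {T : ℝ≥0} {V : ℝ≥0 → UnitAddCircle → P2 → ℝ} {x₀ : L2}
  {X : ℝ≥0 → Ω → L2} {η : ℝ≥0 → Ω → Hm2sym}

/-! ### The martingale term -/

theorem measurable_noiseInc (hB : IsNoise P ℱ B) (K : ℕ) {s r : ℝ≥0} (hsr : s ≤ r) {Z : Ω → L2}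
    (hZm : StronglyMeasurable[ℱ s] Z) : Measurable[ℱ r] (noiseInc lam B K s r Z) := by
  refine Finset.measurable_sum _ fun k _ => ?_
  have h1 : Measurable[ℱ r] fun ω => inner ℝ (e k) (Z ω) :=
    (((innerSL ℝ (e k)).continuous.comp_stronglyMeasurable hZm).mono (ℱ.mono hsr)).measurable
  exact (h1.const_mul _).mul ((hB.adapted k r).sub ((hB.adapted k s).mono (ℱ.mono hsr) le_rfl))

/-- Itô's isometry, as an inequality, for integrands that are constant between grid times. By
induction the new increment is orthogonal to the past sum, so its second moment simply adds up;
measurability and square integrability are carried along because the orthogonality uses them. -/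
theorem martingale_sq_le (hB : IsNoise P ℱ B) (hlam : 1 / 2 < lam) (K : ℕ)
    {g : ℕ → ℝ≥0} (hg : Monotone g) {Z : ℕ → Ω → L2} (hZ : ∀ i ω, ‖Z i ω‖ ≤ 1) (m : ℕ)
    (hZm : ∀ i < m, StronglyMeasurable[ℱ (g i)] (Z i)) :
    Measurable[ℱ (g m)] (fun ω => ∑ i ∈ Finset.range m, noiseInc lam B K (g i) (g (i + 1)) (Z i) ω) ∧
    MemLp (fun ω => ∑ i ∈ Finset.range m, noiseInc lam B K (g i) (g (i + 1)) (Z i) ω) 2 P ∧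
    ∫ ω, (∑ i ∈ Finset.range m, noiseInc lam B K (g i) (g (i + 1)) (Z i) ω) ^ 2 ∂P
      ≤ ampTrace lam * ((g m : ℝ) - g 0) := by
  induction m with
  | zero => simp
  | succ m ih =>
    obtain ⟨ih1, ih2, ih3⟩ := ih fun i hi => hZm i (by omega)
    have hle := hg (Nat.le_succ m)
    have hZm' := hZm m (by omega)
    have hZe : ∀ k, Measurable[ℱ (g m)] fun ω => inner ℝ (e k) (Z m ω) := fun k =>
      ((innerSL ℝ (e k)).continuous.comp_stronglyMeasurable hZm').measurable
    set S : Ω → ℝ := fun ω => ∑ i ∈ Finset.range m, noiseInc lam B K (g i) (g (i + 1)) (Z i) ω with hS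
    set a : Ω → ℝ := noiseInc lam B K (g m) (g (m + 1)) (Z m) with ha
    have ham : Measurable[ℱ (g (m + 1))] a := measurable_noiseInc hB K hle hZm'
    have haL : MemLp a 2 P := by
      refine (memLp_two_iff_integrable_sq (ham.mono (ℱ.le _) le_rfl).aestronglyMeasurable).2 ?_
      refine (hB.integrable_noiseIncSq (lam := lam) K (g m) (g (m + 1))).mono'
        ((ham.mono (ℱ.le _) le_rfl).pow_const 2).aestronglyMeasurable (ae_of_all _ fun ω => ?_)
      rw [Real.norm_eq_abs, abs_of_nonneg (sq_nonneg _)]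
      exact noiseInc_sq_le K _ _ (hZ m) ω
    have haI : ∫ ω, a ω ^ 2 ∂P ≤ ampTrace lam * ((g (m + 1) : ℝ) - g m) :=
      (integral_mono haL.integrable_sq (hB.integrable_noiseIncSq K _ _)
        (noiseInc_sq_le K _ _ (hZ m))).trans (hB.integral_noiseIncSq_le hlam K hle)
    have hcross : ∫ ω, S ω * a ω ∂P = 0 := by
      have h1 : ∀ ω, S ω * a ω = ∑ k ∈ Finset.range K,
          (S ω * (amp lam k * inner ℝ (e k) (Z m ω))) * (B k (g (m + 1)) ω - B k (g m) ω) := by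
        intro ω
        rw [ha, noiseInc, Finset.mul_sum]
        exact Finset.sum_congr rfl fun k _ => by ring
      simp only [h1]
      rw [integral_finsetSum]
      · refine Finset.sum_eq_zero fun k _ => hB.integral_mul_sub k hle ?_
        exact ih1.mul ((hZe k).const_mul _)
      · intro k _
        have h2 : MemLp (fun ω => S ω * (amp lam k * inner ℝ (e k) (Z m ω))) 2 P := by
          refine (ih2.mul_const |amp lam k|).mono
            ((ih1.mul ((hZe k).const_mul _)).mono (ℱ.le _) le_rfl).aestronglyMeasurable
            (ae_of_all _ fun ω => ?_)
          rw [norm_mul, norm_mul, norm_mul, Real.norm_eq_abs |amp lam k|, abs_abs]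
          have := (abs_inner_e_le k (Z m ω)).trans (hZ m ω)
          calc ‖S ω‖ * (‖amp lam k‖ * ‖inner ℝ (e k) (Z m ω)‖) ≤ ‖S ω‖ * (‖amp lam k‖ * 1) := by
                gcongr
                exact this
            _ = _ := by rw [mul_one]; rfl
        exact h2.integrable_mul (hB.memLp_sub k _ _)
    have hsum : (fun ω => ∑ i ∈ Finset.range (m + 1), noiseInc lam B K (g i) (g (i + 1)) (Z i) ω)
        = fun ω => S ω + a ω := by
      funext ω
      rw [Finset.sum_range_succ]
    refine ⟨?_, ?_, ?_⟩
    · rw [hsum]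
      exact (ih1.mono (ℱ.mono hle) le_rfl).add ham
    · rw [hsum]
      exact ih2.add haL
    · have h2 : ∀ ω, (∑ i ∈ Finset.range (m + 1), noiseInc lam B K (g i) (g (i + 1)) (Z i) ω) ^ 2
          = S ω ^ 2 + 2 * (S ω * a ω) + a ω ^ 2 := by
        intro ω
        rw [congrFun hsum ω]; ring
      simp only [h2]
      have i1 : Integrable (fun ω => S ω * a ω) P := ih2.integrable_mul haL
      have i2 : Integrable (fun ω => S ω ^ 2 + 2 * (S ω * a ω)) P :=
        ih2.integrable_sq.add (i1.const_mul 2)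
      rw [integral_add i2 haL.integrable_sq,
        integral_add ih2.integrable_sq (i1.const_mul 2), integral_const_mul, hcross]
      linarith

/-! ### Moment bound for the solution -/

theorem ampTrace_nonneg (lam : ℝ) : 0 ≤ ampTrace lam := tsum_nonneg fun _ => sq_nonneg _

theorem riemannSum_nonneg {ε : ℝ} (hε : 0 < ε) {x : ℝ≥0 → L2} {ζ : ℝ≥0 → Hm2sym} {t : ℝ≥0}
    (hxU : ∀ s ≤ t, x s ∈ U2)
    (hζ : ∀ u : H2sym, u.fn ∈ U2 → MonotoneOn (fun s => ζ s u) (Set.Iic t)) (n : ℕ) :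
    0 ≤ riemannSum ε x ζ t n := by
  refine Finset.sum_nonneg fun i hi => ?_
  have hi' := Finset.mem_range.1 hi
  exact increment_nonneg hζ (grid_mono t n (Nat.le_succ i)) (grid_le t hi') _
    (heat_mem_U2 hε (hxU _ (grid_le t hi'.le)))

/-- The excess of energy is dominated by a martingale and half a quadratic variation, up to an error
`κ = 1`. Fatou's lemma is used twice, first to remove the truncation of the noise and then along the
subdivisions. Lower integrals of positive parts avoid any prior integrability of `X`. -/
theorem lintegral_energy_excess_le [IsProbabilityMeasure P] (hB : IsNoise P ℱ B)
    (hlam : 1 / 2 < lam) (hV : IsField T V) (hX : IsSolution P ℱ B lam T V x₀ X η) {C : ℝ} (hC : 0 ≤ C)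
    (hVC : ∀ t ≤ T, ∀ x μ, |V t x μ| ≤ C) {ε : ℝ} (hε : 0 < ε) {t : ℝ≥0} (ht : t ≤ T) :
    ∫⁻ ω, ENNReal.ofReal (energy ε (X t ω) - energy ε x₀ - t * C
      - pathIntegral (fun r => heat ε (X r ω)) (fun r => η r ω) t) ∂P
      ≤ ENNReal.ofReal (2 + 2 * (ampTrace lam * t)) := by
  let Z : ℕ → ℕ → Ω → L2 := fun n i ω => unitHeat ε (X (grid t n i) ω)
  let M : ℕ → ℕ → Ω → ℝ := fun n K ω =>
    ∑ i ∈ Finset.range n, noiseInc lam B K (grid t n i) (grid t n (i + 1)) (Z n i) ω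
  let q : ℕ → ℕ → Ω → ℝ := fun n K ω =>
    ∑ i ∈ Finset.range n, noiseIncSq lam B K (grid t n i) (grid t n (i + 1)) ω
  have hZ : ∀ n i ω, ‖Z n i ω‖ ≤ 1 := fun n i ω => norm_unitHeat_le hε _
  have hZm : ∀ n, ∀ i < n, StronglyMeasurable[ℱ (grid t n i)] (Z n i) := fun n i hi =>
    (continuous_unitHeat hε).comp_stronglyMeasurable (hX.X_adapted _ ((grid_le t hi.le).trans ht))
  have hgt : ∀ n, (grid t n n : ℝ) - grid t n 0 ≤ t := fun n => by
    rw [grid_zero, NNReal.coe_zero, sub_zero]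
    exact_mod_cast grid_le t le_rfl
  have hΛ := ampTrace_nonneg lam
  have hMK : ∀ n K, Measurable (M n K) ∧ Integrable (fun ω => M n K ω ^ 2) P ∧
      ∫ ω, M n K ω ^ 2 ∂P ≤ ampTrace lam * t := fun n K => by
    obtain ⟨h1, h2, h3⟩ := martingale_sq_le hB hlam K (grid_mono t n) (hZ n) n (hZm n)
    exact ⟨h1.mono (ℱ.le _) le_rfl, h2.integrable_sq, h3.trans (by gcongr; exact hgt n)⟩
  have hqK : ∀ n K, Integrable (q n K) P ∧ ∫ ω, q n K ω ∂P ≤ ampTrace lam * t := fun n K => by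
    refine ⟨integrable_finsetSum _ fun i _ => hB.integrable_noiseIncSq K _ _, ?_⟩
    simp only [q]
    rw [integral_finsetSum _ fun i _ => hB.integrable_noiseIncSq K _ _]
    calc ∑ i ∈ Finset.range n, ∫ ω, noiseIncSq lam B K (grid t n i) (grid t n (i + 1)) ω ∂P
        ≤ ∑ i ∈ Finset.range n, ampTrace lam * ((grid t n (i + 1) : ℝ) - grid t n i) :=
          Finset.sum_le_sum fun i _ => hB.integral_noiseIncSq_le hlam K (grid_mono t n (Nat.le_succ i))
      _ = ampTrace lam * ((grid t n n : ℝ) - grid t n 0) := by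
          rw [← Finset.mul_sum, Finset.sum_range_sub (fun i => (grid t n i : ℝ))]
      _ ≤ _ := by gcongr; exact hgt n
  have hBm : ∀ k s, Measurable (B k s) := fun k s => (hB.adapted k s).mono (ℱ.le _) le_rfl
  have hqm : ∀ n K, Measurable (q n K) := fun n K =>
    Finset.measurable_sum _ fun i _ => Finset.measurable_sum _ fun k _ =>
      (((hBm k _).sub (hBm k _)).pow_const 2).const_mul _
  let D : ℕ → ℕ → Ω → ℝ≥0∞ := fun n K ω => ENNReal.ofReal (2 + M n K ω ^ 2 + 1 / 2 * q n K ω)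
  have hDm : ∀ n K, Measurable (D n K) := fun n K =>
    (((((hMK n K).1.pow_const 2).const_add 2).add ((hqm n K).const_mul (1 / 2)))).ennreal_ofReal
  have hq0 : ∀ n K ω, 0 ≤ q n K ω := fun n K ω =>
    Finset.sum_nonneg fun i _ => Finset.sum_nonneg fun k _ => by positivity
  have hDle : ∀ n K, ∫⁻ ω, D n K ω ∂P ≤ ENNReal.ofReal (2 + 2 * (ampTrace lam * t)) := fun n K => by
    have i1 : Integrable (fun ω => 2 + M n K ω ^ 2 + 1 / 2 * q n K ω) P :=
      ((integrable_const _).add (hMK n K).2.1).add ((hqK n K).1.const_mul _)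
    rw [← ofReal_integral_eq_lintegral_ofReal i1 (ae_of_all _ fun ω => by
      have := hq0 n K ω
      show 0 ≤ 2 + M n K ω ^ 2 + 1 / 2 * q n K ω
      positivity)]
    refine ENNReal.ofReal_le_ofReal ?_
    have i2 : Integrable (fun ω => 2 + M n K ω ^ 2) P := (integrable_const _).add (hMK n K).2.1
    rw [integral_add i2 ((hqK n K).1.const_mul _),
      integral_add (integrable_const _) (hMK n K).2.1, integral_const, integral_const_mul]
    have h1 := (hMK n K).2.2
    have h2 := (hqK n K).2
    have h3 : 0 ≤ ampTrace lam * t := by positivity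
    simp only [probReal_univ, one_smul]
    linarith
  let D' : ℕ → Ω → ℝ≥0∞ := fun n ω => liminf (fun K => D n K ω) atTop
  have hD'm : ∀ n, Measurable (D' n) := fun n => Measurable.liminf (hDm n)
  have hD'le : ∀ n, ∫⁻ ω, D' n ω ∂P ≤ ENNReal.ofReal (2 + 2 * (ampTrace lam * t)) := fun n => by
    refine (lintegral_liminf_le (hDm n)).trans ?_
    refine (liminf_le_liminf (Eventually.of_forall (hDle n))).trans ?_
    simp
  have hae : ∀ᵐ ω ∂P, ENNReal.ofReal (energy ε (X t ω) - energy ε x₀ - t * C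
      - pathIntegral (fun r => heat ε (X r ω)) (fun r => η r ω) t) ≤ liminf (fun n => D' n ω) atTop := by
    filter_upwards [hX.step hV hC hVC, hX.η_monotone,
      ae_all_iff.2 fun n : ℕ => ae_all_iff.2 fun i : ℕ => hB.hasSum_noise hlam (grid t n i)]
      with ω hstep hmono hsum
    have hmono' : ∀ u : H2sym, u.fn ∈ U2 → MonotoneOn (fun s => η s ω u) (Set.Iic t) := fun u hu =>
      (hmono u hu).mono (Set.Iic_subset_Iic.2 ht)
    have h1 := eventually_energy_le hε hC (x := fun s => X s ω) (w := fun s => noise lam B s ω)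
      (η := fun s => η s ω) (fun s hs => hX.X_mem s (hs.trans ht) ω)
      ((hX.X_continuous ω).mono (Set.Iic_subset_Iic.2 ht)) hmono'
      (fun s r hsr hr δ hδ z => hstep s r hsr (hr.trans ht) δ hδ z) one_pos
    rw [hX.X_zero] at h1
    refine le_liminf_of_le (by isBoundedDefault) ?_
    filter_upwards [h1] with n hn
    have h2 : Tendsto (fun K => M n K ω) atTop
        (𝓝 (∑ i ∈ Finset.range n, inner ℝ (noise lam B (grid t n (i + 1)) ω - noise lam B (grid t n i) ω)
            (unitHeat ε (X (grid t n i) ω)))) :=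
      tendsto_finsetSum _ fun i _ => (tendsto_noiseInc (Z := Z n i) (hsum n i) (hsum n (i + 1))).1
    have h3 : Tendsto (fun K => q n K ω) atTop
        (𝓝 (∑ i ∈ Finset.range n, ‖noise lam B (grid t n (i + 1)) ω - noise lam B (grid t n i) ω‖ ^ 2)) :=
      tendsto_finsetSum _ fun i _ => (tendsto_noiseInc (Z := Z n i) (hsum n i) (hsum n (i + 1))).2
    have h4 : Tendsto (fun K => D n K ω) atTop (𝓝 _) :=
      ENNReal.tendsto_ofReal (((h2.pow 2).const_add 2).add (h3.const_mul (1 / 2)))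
    simp only [D']
    rw [h4.liminf_eq]
    refine ENNReal.ofReal_le_ofReal (hn.trans ?_)
    set m := ∑ i ∈ Finset.range n, inner ℝ (noise lam B (grid t n (i + 1)) ω - noise lam B (grid t n i) ω)
            (unitHeat ε (X (grid t n i) ω))
    -- The martingale enters the energy linearly; `m ≤ 1 + m²` turns it into its controlled second
    -- moment.
    nlinarith [sq_nonneg (m - 1)]
  refine (lintegral_mono_ae hae).trans ((lintegral_liminf_le hD'm).trans ?_)
  refine (liminf_le_liminf (Eventually.of_forall hD'le)).trans ?_
  simp

/-- First moment bound for the solution of the rearranged stochastic heat equation. -/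
theorem IsSolution.lintegral_norm_le [IsProbabilityMeasure P] (hB : IsNoise P ℱ B)
    (hlam : 1 / 2 < lam) (hV : IsField T V) (hX : IsSolution P ℱ B lam T V x₀ X η) :
    ∃ K : ℝ≥0, ∀ t ≤ T, ∫⁻ ω, ‖X t ω‖ₑ ∂P ≤ K := by
  obtain ⟨C, hC, hVC, -⟩ := hV.bounded_lipschitz
  have hΛ := ampTrace_nonneg lam
  refine ⟨(1 + ‖x₀‖ + T * C + 1 + (2 + 2 * (ampTrace lam * T))).toNNReal, fun t ht => ?_⟩
  let ε : ℕ → ℝ := fun n => 1 / ((n : ℝ) + 1)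
  have hε0 : ∀ n, 0 < ε n := fun n => by simp only [ε]; positivity
  have hε : Tendsto ε atTop (𝓝[>] 0) := tendsto_nhdsWithin_iff.2
    ⟨tendsto_one_div_add_atTop_nhds_zero_nat, Eventually.of_forall hε0⟩
  let I : ℕ → Ω → ℝ := fun n ω => pathIntegral (fun r => heat (ε n) (X r ω)) (fun r => η r ω) t
  have htT : (t : ℝ) ≤ T := by exact_mod_cast ht
  have hE : ∀ᶠ n in atTop, ∫⁻ ω, ENNReal.ofReal (energy (ε n) (X t ω)) ∂P
      ≤ ENNReal.ofReal (1 + ‖x₀‖ + T * C + 1 + (2 + 2 * (ampTrace lam * T))) := by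
    -- For small `ε` the reflection integral is integrable with expectation below `1`. It is also
    -- non-negative, so this bounds its contribution to the lower integral.
    have h1 := hε.eventually (hX.reflection_integrable t ht)
    have h2 := ((hX.reflection t ht).comp hε).eventually (gt_mem_nhds one_pos)
    filter_upwards [h1, h2] with n hn1 hn2
    have hI0 : 0 ≤ᵐ[P] I n := by
      filter_upwards [hX.η_monotone] with ω hmono
      have hmono' : ∀ u : H2sym, u.fn ∈ U2 → MonotoneOn (fun s => η s ω u) (Set.Iic t) := fun u hu =>
        (hmono u hu).mono (Set.Iic_subset_Iic.2 ht)
      exact ge_of_tendsto' (tendsto_riemannSum (hε0 n)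
        ((hX.X_continuous ω).mono (Set.Iic_subset_Iic.2 ht)) hmono')
        (riemannSum_nonneg (hε0 n) (fun s hs => hX.X_mem s (hs.trans ht) ω) hmono')
    have h3 : ∀ ω, ENNReal.ofReal (energy (ε n) (X t ω)) ≤ ENNReal.ofReal (1 + ‖x₀‖ + T * C)
        + ENNReal.ofReal (I n ω) + ENNReal.ofReal (energy (ε n) (X t ω) - energy (ε n) x₀ - t * C - I n ω) := by
      intro ω
      refine (ENNReal.ofReal_le_ofReal ?_).trans ((ENNReal.ofReal_add_le).trans
        (add_le_add_left ENNReal.ofReal_add_le _))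
      have e1 := energy_le (hε0 n) x₀
      have e2 : (t : ℝ) * C ≤ T * C := by gcongr
      linarith
    refine (lintegral_mono h3).trans ?_
    rw [lintegral_add_left' (by
      exact (aemeasurable_const.add hn1.1.aemeasurable.ennreal_ofReal)),
      lintegral_add_left' aemeasurable_const, lintegral_const, measure_univ, mul_one,
      ← ofReal_integral_eq_lintegral_ofReal hn1 hI0]
    have h4 : 0 ≤ 1 + ‖x₀‖ + T * C := by positivity
    have h5 : 0 ≤ 2 + 2 * (ampTrace lam * T) := by positivity
    rw [ENNReal.ofReal_add (by positivity) h5, ENNReal.ofReal_add h4 zero_le_one]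
    refine add_le_add (add_le_add le_rfl (ENNReal.ofReal_le_ofReal hn2.le)) ?_
    refine (lintegral_energy_excess_le hB hlam hV hX hC hVC (hε0 n) ht).trans
      (ENNReal.ofReal_le_ofReal ?_)
    gcongr
  -- As `ε → 0` the regularised energy tends to `√(1 + ‖X‖²) ≥ ‖X‖`, and Fatou's lemma concludes.
  have hpt : ∀ ω, ‖X t ω‖ₑ ≤ liminf (fun n => ENNReal.ofReal (energy (ε n) (X t ω))) atTop := by
    intro ω
    have h1 := ((tendsto_inner_heat_self (isSymm_of_mem_U2 (hX.X_mem t ht ω))).comp hε).const_add 1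
    have h2 := ENNReal.tendsto_ofReal h1.sqrt
    have h3 : liminf (fun n => ENNReal.ofReal (energy (ε n) (X t ω))) atTop
        = ENNReal.ofReal √(1 + ‖X t ω‖ ^ 2) := h2.liminf_eq
    rw [h3, ← ofReal_norm]
    exact ENNReal.ofReal_le_ofReal (Real.le_sqrt_of_sq_le (by linarith))
  refine (lintegral_mono hpt).trans ((lintegral_liminf_le fun n => ?_).trans ?_)
  · exact (((continuous_energy (hε0 n)).comp_stronglyMeasurable
      ((hX.X_adapted t ht).mono (ℱ.le t))).measurable).ennreal_ofReal
  · exact liminf_le_of_le (by isBoundedDefault) fun b hb =>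
      let ⟨n, hn1, hn2⟩ := (hb.and hE).exists
      hn1.trans hn2

end

section

/-! ### Bounded monotone functions on the extended real line -/

theorem extendEReal_coe (φ : ℝ → ℝ) (r : ℝ) : extendEReal φ r = φ r := by
  simp [extendEReal]

section

variable {φ : ℝ → ℝ} {C : ℝ}

theorem exists_tendsto_extendEReal_top (hm : Monotone φ) (hb : ∀ x, |φ x| ≤ C) :
    Tendsto φ atTop (𝓝 (extendEReal φ ⊤)) ∧ ∀ x, φ x ≤ extendEReal φ ⊤ := by
  have hbdd : BddAbove (Set.range φ) := ⟨C, by rintro _ ⟨x, rfl⟩; exact (abs_le.1 (hb x)).2⟩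
  have h : Tendsto φ atTop (𝓝 (⨆ x, φ x)) := tendsto_atTop_ciSup hm hbdd
  have h1 : extendEReal φ ⊤ = ⨆ x, φ x := by
    rw [extendEReal, if_pos rfl]
    exact h.limUnder_eq
  rw [h1]
  exact ⟨h, le_ciSup hbdd⟩

theorem exists_tendsto_extendEReal_bot (hm : Monotone φ) (hb : ∀ x, |φ x| ≤ C) :
    Tendsto φ atBot (𝓝 (extendEReal φ ⊥)) ∧ ∀ x, extendEReal φ ⊥ ≤ φ x := by
  have hbdd : BddBelow (Set.range φ) := ⟨-C, by rintro _ ⟨x, rfl⟩; exact (abs_le.1 (hb x)).1⟩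
  have h : Tendsto φ atBot (𝓝 (⨅ x, φ x)) := tendsto_atBot_ciInf hm hbdd
  have h1 : extendEReal φ ⊥ = ⨅ x, φ x := by
    rw [extendEReal, if_neg bot_ne_top, if_pos rfl]
    exact h.limUnder_eq
  rw [h1]
  exact ⟨h, ciInf_le hbdd⟩

theorem monotone_extendEReal (hm : Monotone φ) (hb : ∀ x, |φ x| ≤ C) :
    Monotone (extendEReal φ) := by
  have ht := (exists_tendsto_extendEReal_top hm hb).2
  have hl := (exists_tendsto_extendEReal_bot hm hb).2
  intro a b hab
  induction a with
  | bot =>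
    induction b with
    | bot => exact le_rfl
    | coe b => rw [extendEReal_coe]; exact hl b
    | top => exact (hl 0).trans (ht 0)
  | coe a =>
    induction b with
    | bot => simp at hab
    | coe b => rw [extendEReal_coe, extendEReal_coe]; exact hm (by exact_mod_cast hab)
    | top => rw [extendEReal_coe]; exact ht a
  | top => rw [top_le_iff.1 hab]

theorem abs_extendEReal_le (hm : Monotone φ) (hb : ∀ x, |φ x| ≤ C) (z : EReal) :
    |extendEReal φ z| ≤ C := by
  induction z with
  | bot => exact le_of_tendsto' (exists_tendsto_extendEReal_bot hm hb).1.abs hb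
  | coe r => rw [extendEReal_coe]; exact hb r
  | top => exact le_of_tendsto' (exists_tendsto_extendEReal_top hm hb).1.abs hb

theorem continuous_extendEReal (hm : Monotone φ) (hb : ∀ x, |φ x| ≤ C) (hc : Continuous φ) :
    Continuous (extendEReal φ) := by
  have hmono := monotone_extendEReal hm hb
  refine continuous_iff_continuousAt.2 fun z => ?_
  induction z with
  | bot =>
    refine tendsto_order.2 ⟨fun a ha => Eventually.of_forall fun z => ha.trans_le (hmono bot_le),
      fun a ha => ?_⟩
    obtain ⟨M, hM⟩ := ((exists_tendsto_extendEReal_bot hm hb).1.eventually (gt_mem_nhds ha)).exists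
    filter_upwards [Iio_mem_nhds (EReal.bot_lt_coe M)] with z hz
    refine (hmono (le_of_lt hz)).trans_lt ?_
    rwa [extendEReal_coe]
  | coe r =>
    rw [← EReal.isOpenEmbedding_coe.continuousAt_iff]
    refine hc.continuousAt.congr (Eventually.of_forall fun x => ?_)
    exact (extendEReal_coe φ x).symm
  | top =>
    refine tendsto_order.2 ⟨fun a ha => ?_, fun a ha =>
      Eventually.of_forall fun z => (hmono le_top).trans_lt ha⟩
    obtain ⟨M, hM⟩ := ((exists_tendsto_extendEReal_top hm hb).1.eventually (lt_mem_nhds ha)).exists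
    filter_upwards [Ioi_mem_nhds (EReal.coe_lt_top M)] with z hz
    refine lt_of_lt_of_le ?_ (hmono (le_of_lt hz))
    rwa [extendEReal_coe]

/-- Clipping to `[-n, n]` expresses the extension as a limit of values of `φ` at real points. It is
used to obtain the joint measurability of `derivAlong`. -/
theorem tendsto_clip_extendEReal (hm : Monotone φ) (hb : ∀ x, |φ x| ≤ C) (z : EReal) :
    Tendsto (fun n : ℕ => φ (max ((-(n : ℝ) : ℝ) : EReal) (min ((n : ℝ) : EReal) z)).toReal) atTop
      (𝓝 (extendEReal φ z)) := by
  induction z with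
  | bot =>
    have h := (exists_tendsto_extendEReal_bot hm hb).1.comp
      (tendsto_neg_atTop_atBot.comp (tendsto_natCast_atTop_atTop (R := ℝ)))
    refine h.congr fun n => ?_
    rw [min_eq_right bot_le, max_eq_left bot_le, EReal.toReal_coe]
    rfl
  | coe r =>
    rw [extendEReal_coe]
    obtain ⟨N, hN⟩ := exists_nat_ge |r|
    refine tendsto_const_nhds.congr' ?_
    filter_upwards [eventually_ge_atTop N] with n hn
    have h := abs_le.1 (hN.trans (by exact_mod_cast hn : (N : ℝ) ≤ n))
    rw [min_eq_right (by exact_mod_cast h.2), max_eq_right (by exact_mod_cast h.1),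
      EReal.toReal_coe]
  | top =>
    have h := (exists_tendsto_extendEReal_top hm hb).1.comp (tendsto_natCast_atTop_atTop (R := ℝ))
    refine h.congr fun n => ?_
    have h1 : ((-(n : ℝ) : ℝ) : EReal) ≤ (n : ℝ) := by
      rw [EReal.coe_le_coe_iff]
      have : (0 : ℝ) ≤ n := Nat.cast_nonneg n
      linarith
    rw [min_eq_left le_top, max_eq_right h1, EReal.toReal_coe]
    rfl

end

/-! ### The cost coefficients -/

/-- The diagonal coupling has zero cost. The joint Lipschitz condition thereby yields the Lipschitz
condition in `x` at a fixed measure. -/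
theorem W2_self (μ : P2) : W2 μ μ = 0 := by
  have hd : Measurable fun y : ℝ => (y, y) := measurable_id.prodMk measurable_id
  have h : (⨅ π ∈ {π : Measure (ℝ × ℝ) | π.map Prod.fst = μ.1 ∧ π.map Prod.snd = μ.1},
      ∫⁻ p, edist p.1 p.2 ^ 2 ∂π) = 0 := by
    refine le_antisymm (iInf₂_le_of_le (μ.1.map fun y => (y, y)) ⟨?_, ?_⟩ ?_) zero_le
    · rw [Measure.map_map measurable_fst hd]
      exact Measure.map_id
    · rw [Measure.map_map measurable_snd hd]
      exact Measure.map_id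
    · rw [lintegral_map (by fun_prop) hd]
      simp
  rw [W2, h]
  simp

theorem integral_sq_law (u : L2) : ∫ y, y ^ 2 ∂(law u).1 = ‖u‖ ^ 2 := by
  show ∫ y, y ^ 2 ∂(Measure.map u volume) = _
  rw [integral_map (Lp.aestronglyMeasurable u).aemeasurable (by fun_prop),
    ← real_inner_self_eq_norm_sq, MeasureTheory.L2.inner_def]
  refine integral_congr_ae (ae_of_all _ fun x => ?_)
  simp [sq]

namespace IsCostCoefficient

variable {f : ℝ → P2 → ℝ}

theorem exists_bound (hf : IsCostCoefficient f) : ∃ C : ℝ, 0 ≤ C ∧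
    (∀ x μ, |f x μ| ≤ C * √(1 + x ^ 2 + ∫ y, y ^ 2 ∂μ.1)) ∧
    (∀ x μ, |deriv (fun y => f y μ) x| ≤ C) ∧
    ∀ x y μ, |deriv (fun z => f z μ) x - deriv (fun z => f z μ) y| ≤ C * |x - y| := by
  obtain ⟨C₁, h₁⟩ := hf.growth
  obtain ⟨C₂, h₂⟩ := hf.deriv_bounded
  obtain ⟨C₃, h₃⟩ := hf.deriv_lipschitz
  refine ⟨max 0 (max C₁ (max C₂ C₃)), le_max_left _ _, fun x μ => (h₁ x μ).trans ?_,
    fun x μ => (h₂ x μ).trans ?_, fun x y μ => ?_⟩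
  · gcongr
    simp
  · simp
  · have h := h₃ x y μ μ
    rw [W2_self, add_zero] at h
    refine h.trans ?_
    gcongr
    simp

theorem continuous_deriv (hf : IsCostCoefficient f) (μ : P2) : Continuous (deriv fun y => f y μ) := by
  obtain ⟨C, hC, -, -, h⟩ := hf.exists_bound
  refine (LipschitzWith.of_dist_le_mul (K := C.toNNReal) fun x y => ?_).continuous
  rw [Real.dist_eq, Real.dist_eq, Real.coe_toNNReal _ hC]
  exact h x y μ

theorem measurable_deriv (hf : IsCostCoefficient f) :
    Measurable fun p : ℝ × P2 => deriv (fun y => f y p.2) p.1 := by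
  refine measurable_of_tendsto_metrizable (f := fun (n : ℕ) (p : ℝ × P2) =>
    (n : ℝ) • (f (p.1 + (n : ℝ)⁻¹ • 1) p.2 - f p.1 p.2)) (fun n => ?_) (tendsto_pi_nhds.2 fun p => ?_)
  · refine Measurable.const_mul (Measurable.sub ?_ hf.measurable) (n : ℝ)
    exact hf.measurable.comp ((measurable_fst.add_const _).prodMk measurable_snd)
  · have h := ((hf.differentiable p.2 p.1).hasDerivAt.hasFDerivAt.lim_real 1).comp
      (tendsto_natCast_atTop_atTop (R := ℝ))
    simpa [Function.comp_def] using h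

theorem abs_derivAlong_le {C : ℝ} (hf : IsCostCoefficient f)
    (hC : ∀ x μ, |deriv (fun y => f y μ) x| ≤ C) (u : L2) (x : UnitAddCircle) :
    |derivAlong f u x| ≤ C :=
  abs_extendEReal_le (hf.deriv_monotone _) (fun x => hC x _) _

theorem derivAlong_neg {u : L2} (hu : u ∈ U2) (x : UnitAddCircle) :
    derivAlong f u (-x) = derivAlong f u x := by
  rw [derivAlong, canonicalValue_neg hu, derivAlong]

theorem isCanonical_derivAlong (hf : IsCostCoefficient f) {u : L2} (hu : u ∈ U2) :
    IsCanonical (derivAlong f u) := by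
  obtain ⟨C, -, -, hC, -⟩ := hf.exists_bound
  have hc := continuous_extendEReal (hf.deriv_monotone (law u)) (fun x => hC x _)
    (hf.continuous_deriv (law u))
  obtain ⟨h1, h2⟩ := isCanonical_canonicalValue hu
  exact ⟨hc.continuousAt.comp_continuousWithinAt h1,
    fun r hr => hc.continuousAt.comp_continuousWithinAt (h2 r hr)⟩

theorem measurable_derivAlong (hf : IsCostCoefficient f) {α : Type*} [MeasurableSpace α]
    {Y : α → L2} (hY : StronglyMeasurable Y) (hU : ∀ a, Y a ∈ U2) :
    Measurable fun p : α × UnitAddCircle => derivAlong f (Y p.1) p.2 := by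
  obtain ⟨C, -, -, hC, -⟩ := hf.exists_bound
  refine measurable_of_tendsto_metrizable (f := fun (n : ℕ) (p : α × UnitAddCircle) =>
    deriv (fun y => f y (law (Y p.1)))
      (max ((-(n : ℝ) : ℝ) : EReal) (min ((n : ℝ) : EReal) (canonicalValue (Y p.1) p.2))).toReal)
    (fun n => ?_) (tendsto_pi_nhds.2 fun p =>
      tendsto_clip_extendEReal (hf.deriv_monotone _) (fun x => hC x _) _)
  exact hf.measurable_deriv.comp
    ((measurable_const.max (measurable_const.min (measurable_canonicalValue hY hU))).ereal_toReal.prodMk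
      ((measurable_law hY hU).comp measurable_fst))

end IsCostCoefficient

theorem derivAlong_of_finite (f : ℝ → P2 → ℝ) {u : L2} {x : UnitAddCircle}
    (hx : ((canonicalValue u x).toReal : EReal) = canonicalValue u x) :
    derivAlong f u x = deriv (fun y => f y (law u)) (canonicalValue u x).toReal := by
  rw [derivAlong, ← hx, extendEReal_coe, EReal.toReal_coe]

end

section

/-! ### Expansion of the cost along one path -/

instance : SigmaFinite leb :=
  ⟨⟨{ set := fun n : ℕ => Set.Iic (n : ℝ≥0)
      set_mem := fun _ => trivial
      finite := fun n => by rw [leb_Iic]; exact ENNReal.coe_lt_top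
      spanning := Set.eq_univ_of_forall fun t =>
        Set.mem_iUnion.2 ((exists_nat_ge t).imp fun _ h => h) }⟩⟩

/-- `∫₀ᵗ b_s ds`. -/
def drift (b : ℝ≥0 → ℝ) (t : ℝ≥0) : ℝ := ∫ s in Set.Iic t, b s ∂leb

/-- The cost along one path of the control `b - v`, if the uncontrolled state is `ξ` and the
environment is `m`. -/
def pathCost (T : ℝ≥0) (f g : ℝ → P2 → ℝ) (m : ℝ≥0 → P2) (ξ v b : ℝ≥0 → ℝ) : ℝ :=
  g (ξ T + drift b T) (m T)
    + ∫ t in Set.Iic T, (f (ξ t + drift b t) (m t) + 1 / 2 * |b t - v t| ^ 2) ∂leb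

/-- The costate along one path. -/
def pathCostate (T : ℝ≥0) (f g : ℝ → P2 → ℝ) (m : ℝ≥0 → P2) (ξ : ℝ≥0 → ℝ) (s : ℝ≥0) : ℝ :=
  deriv (fun y => g y (m T)) (ξ T) + ∫ t in Set.Icc s T, deriv (fun y => f y (m t)) (ξ t) ∂leb

/-- The derivative of the cost along one path in the direction `b`. -/
def pathLin (T : ℝ≥0) (f g : ℝ → P2 → ℝ) (m : ℝ≥0 → P2) (ξ v b : ℝ≥0 → ℝ) : ℝ :=
  ∫ s in Set.Iic T, (pathCostate T f g m ξ s - v s) * b s ∂leb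

theorem measurable_drift {α : Type*} [MeasurableSpace α] {b : ℝ≥0 × α → ℝ} (hb : Measurable b) :
    Measurable fun p : ℝ≥0 × α => drift (fun s => b (s, p.2)) p.1 := by
  have h1 : Measurable fun q : (ℝ≥0 × α) × ℝ≥0 =>
      ({q : (ℝ≥0 × α) × ℝ≥0 | q.2 ≤ q.1.1}.indicator fun q => b (q.2, q.1.2)) q :=
    (hb.comp (measurable_snd.prodMk (measurable_snd.comp measurable_fst))).indicator
      (measurableSet_le measurable_snd (measurable_fst.comp measurable_fst))
  have h2 := (h1.stronglyMeasurable.integral_prod_right' (ν := leb)).measurable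
  convert h2 using 2 with p
  rw [drift, ← integral_indicator measurableSet_Iic]
  rfl

/-- By the mean value theorem the increment is `φ' (x + c h) h` with `0 < c < 1`. Its excess over
`φ' x h` is non-negative by monotonicity of `φ'` and at most `C h²` by the Lipschitz bound. -/
theorem convex_expansion {φ : ℝ → ℝ} {C : ℝ} (hφ : Differentiable ℝ φ) (hm : Monotone (deriv φ))
    (hL : ∀ x y, |deriv φ x - deriv φ y| ≤ C * |x - y|) (x h : ℝ) :
    deriv φ x * h ≤ φ (x + h) - φ x ∧ φ (x + h) - φ x ≤ deriv φ x * h + C * h ^ 2 := by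
  have hC : 0 ≤ C := by
    have := (abs_nonneg _).trans (hL 1 0)
    simpa using this
  have hd : ∀ s : ℝ, HasDerivAt (fun s => φ (x + s * h)) (deriv φ (x + s * h) * h) s := fun s => by
    have h1 : HasDerivAt (fun s : ℝ => x + s * h) h s := by
      simpa using ((hasDerivAt_id s).mul_const h).const_add x
    exact (hφ (x + s * h)).hasDerivAt.comp s h1
  obtain ⟨c, ⟨hc0, hc1⟩, hc⟩ := exists_hasDerivAt_eq_slope (fun s => φ (x + s * h))
    (fun s => deriv φ (x + s * h) * h) one_pos
    (fun s _ => (hd s).continuousAt.continuousWithinAt) fun s _ => hd s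
  simp only [one_mul, zero_mul, add_zero, sub_zero, div_one] at hc
  rw [← hc]
  have h1 : 0 ≤ (deriv φ (x + c * h) - deriv φ x) * h := by
    rcases le_total 0 h with hh | hh
    · exact mul_nonneg (sub_nonneg.2 (hm (by nlinarith))) hh
    · exact mul_nonneg_of_nonpos_of_nonpos (sub_nonpos.2 (hm (by nlinarith))) hh
  have h2 : |(deriv φ (x + c * h) - deriv φ x) * h| ≤ C * h ^ 2 := by
    rw [abs_mul]
    have h3 := hL (x + c * h) x
    rw [add_sub_cancel_left, abs_mul, abs_of_pos hc0] at h3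
    calc |deriv φ (x + c * h) - deriv φ x| * |h| ≤ C * (c * |h|) * |h| := by gcongr
      _ = c * (C * |h| ^ 2) := by ring
      _ ≤ 1 * (C * |h| ^ 2) := by gcongr
      _ = C * h ^ 2 := by rw [sq_abs, one_mul]
  have h4 := le_abs_self ((deriv φ (x + c * h) - deriv φ x) * h)
  constructor <;> linarith

section

variable {T : ℝ≥0} {f g : ℝ → P2 → ℝ} {m : ℝ≥0 → P2} {ξ v b : ℝ≥0 → ℝ}

theorem abs_drift_le (hb : IntegrableOn b (Set.Iic T) leb) {t : ℝ≥0} (ht : t ≤ T) :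
    |drift b t| ≤ ∫ s in Set.Iic T, |b s| ∂leb :=
  abs_integral_le_integral_abs.trans
    (setIntegral_mono_set hb.abs (ae_of_all _ fun _ => abs_nonneg _)
      (Set.Iic_subset_Iic.2 ht).eventuallyLE)

/-- Cauchy–Schwarz, read off from the discriminant of the non-negative quadratic polynomial `c ↦ ∫
(c - |b|)²`. -/
theorem sq_integral_abs_le (hb : MemLp b 2 (leb.restrict (Set.Iic T))) :
    (∫ s in Set.Iic T, |b s| ∂leb) ^ 2 ≤ T * ∫ s in Set.Iic T, b s ^ 2 ∂leb := by
  have hb1 := (hb.integrable one_le_two).abs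
  have h : ∀ c : ℝ, 0 ≤ (T : ℝ) * (c * c) + (-2 * ∫ s in Set.Iic T, |b s| ∂leb) * c
      + ∫ s in Set.Iic T, b s ^ 2 ∂leb := by
    intro c
    have h1 : 0 ≤ ∫ s in Set.Iic T, (c * c + (-2 * c) * |b s| + b s ^ 2) ∂leb :=
      integral_nonneg fun s => by
        show 0 ≤ c * c + (-2 * c) * |b s| + b s ^ 2
        nlinarith [sq_nonneg (c - |b s|), sq_abs (b s)]
    have i1 : Integrable (fun s => c * c + (-2 * c) * |b s|) (leb.restrict (Set.Iic T)) :=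
      (integrable_const _).add (hb1.const_mul _)
    rw [integral_add i1 hb.integrable_sq, integral_add (integrable_const _) (hb1.const_mul _),
      integral_const, integral_const_mul] at h1
    have h2 : (leb.restrict (Set.Iic T)).real Set.univ = T := by
      rw [Measure.real, Measure.restrict_apply_univ, leb_Iic, ENNReal.coe_toReal]
    rw [h2, smul_eq_mul] at h1
    linarith
  have h2 := discrim_le_zero h
  rw [discrim] at h2
  nlinarith

theorem integrable_deriv_path {C : ℝ} (hf : IsCostCoefficient f)
    (hC : ∀ x μ, |deriv (fun y => f y μ) x| ≤ C) (hm : Measurable m) (hξ : Measurable ξ) :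
    Measurable (fun t => deriv (fun y => f y (m t)) (ξ t)) ∧
      IntegrableOn (fun t => deriv (fun y => f y (m t)) (ξ t)) (Set.Iic T) leb := by
  have h : Measurable (fun t => deriv (fun y => f y (m t)) (ξ t)) :=
    hf.measurable_deriv.comp (hξ.prodMk hm)
  exact ⟨h, Integrable.of_bound h.aestronglyMeasurable C (ae_of_all _ fun t => hC _ _)⟩

/-- Fubini on the triangle `s ≤ t ≤ T`. This converts the effect of a control on later states into a
weight at the time when it is applied, which is the backward integral in the costate. -/
theorem integral_mul_drift {a : ℝ≥0 → ℝ} (ha : IntegrableOn a (Set.Iic T) leb)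
    (hb : IntegrableOn b (Set.Iic T) leb) :
    ∫ t in Set.Iic T, a t * drift b t ∂leb
      = ∫ s in Set.Iic T, (∫ t in Set.Icc s T, a t ∂leb) * b s ∂leb := by
  have h1 : Integrable (Function.uncurry fun t s : ℝ≥0 =>
      ({q : ℝ≥0 × ℝ≥0 | q.2 ≤ q.1}.indicator fun q => a q.1 * b q.2) (t, s))
      ((leb.restrict (Set.Iic T)).prod (leb.restrict (Set.Iic T))) :=
    (ha.mul_prod hb).indicator (measurableSet_le measurable_snd measurable_fst)
  have h2 := integral_integral_swap h1
  have h3 : ∀ t ∈ Set.Iic T, a t * drift b t = ∫ s in Set.Iic T,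
      ({q : ℝ≥0 × ℝ≥0 | q.2 ≤ q.1}.indicator fun q => a q.1 * b q.2) (t, s) ∂leb := by
    intro t ht
    have : (fun s => ({q : ℝ≥0 × ℝ≥0 | q.2 ≤ q.1}.indicator fun q => a q.1 * b q.2) (t, s))
        = (Set.Iic t).indicator fun s => a t * b s := rfl
    rw [this, setIntegral_indicator measurableSet_Iic, integral_const_mul,
      Set.inter_eq_right.2 (Set.Iic_subset_Iic.2 ht), drift]
  have h4 : ∀ s ∈ Set.Iic T, (∫ t in Set.Icc s T, a t ∂leb) * b s = ∫ t in Set.Iic T,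
      ({q : ℝ≥0 × ℝ≥0 | q.2 ≤ q.1}.indicator fun q => a q.1 * b q.2) (t, s) ∂leb := by
    intro s hs
    have : (fun t => ({q : ℝ≥0 × ℝ≥0 | q.2 ≤ q.1}.indicator fun q => a q.1 * b q.2) (t, s))
        = (Set.Ici s).indicator fun t => a t * b s := rfl
    rw [this, setIntegral_indicator measurableSet_Ici, integral_mul_const]
    congr 3
    ext t
    simp [and_comm]
  rw [setIntegral_congr_fun measurableSet_Iic h3, setIntegral_congr_fun measurableSet_Iic h4, h2]

theorem abs_pathCostate_le {C : ℝ} (hC : 0 ≤ C) (hCf : ∀ x μ, |deriv (fun y => f y μ) x| ≤ C)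
    (hCg : ∀ x μ, |deriv (fun y => g y μ) x| ≤ C) (s : ℝ≥0) :
    |pathCostate T f g m ξ s| ≤ C + C * T := by
  refine (abs_add_le _ _).trans (add_le_add (hCg _ _) ?_)
  have h1 : leb (Set.Icc s T) ≤ T := (measure_mono Set.Icc_subset_Iic_self).trans_eq (leb_Iic T)
  have h2 : leb.real (Set.Icc s T) ≤ T := ENNReal.toReal_mono ENNReal.coe_ne_top h1
  refine (norm_setIntegral_le_of_norm_le_const (h1.trans_lt ENNReal.coe_lt_top)
    (C := C) fun t _ => (Real.norm_eq_abs _).trans_le (hCf _ _)).trans ?_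
  gcongr

theorem measurable_integral_Icc {α : Type*} [MeasurableSpace α] {a : ℝ≥0 × α → ℝ}
    (ha : Measurable a) :
    Measurable fun p : ℝ≥0 × α => ∫ t in Set.Icc p.1 T, a (t, p.2) ∂leb := by
  have h1 : Measurable fun q : (ℝ≥0 × α) × ℝ≥0 =>
      ({q : (ℝ≥0 × α) × ℝ≥0 | q.1.1 ≤ q.2 ∧ q.2 ≤ T}.indicator fun q => a (q.2, q.1.2)) q :=
    (ha.comp (measurable_snd.prodMk (measurable_snd.comp measurable_fst))).indicator
      ((measurableSet_le (f := fun q : (ℝ≥0 × α) × ℝ≥0 => q.1.1) (g := fun q => q.2)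
        (by fun_prop) (by fun_prop)).inter
        (measurableSet_le (f := fun q : (ℝ≥0 × α) × ℝ≥0 => q.2) (g := fun _ => T) (by fun_prop) (by fun_prop)))
  have h2 := (h1.stronglyMeasurable.integral_prod_right' (ν := leb)).measurable
  convert h2 using 2 with p
  rw [← integral_indicator measurableSet_Icc]
  rfl

/-- `convex_expansion` is applied to `g` at time `T` and to `f` at each time, and the control cost
expands exactly, as `½ b² - v b`. The linear parts combine into `pathLin`. In the remainder, `C T`
comes from `g`, `C T T` from `f` and `1/2` from the control, each multiplied by `∫ b²`. -/
theorem pathCost_expansion {C : ℝ} (hf : IsCostCoefficient f) (hg : IsCostCoefficient g)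
    (hCf : ∀ x μ, |deriv (fun y => f y μ) x| ≤ C)
    (hLf : ∀ x y μ, |deriv (fun z => f z μ) x - deriv (fun z => f z μ) y| ≤ C * |x - y|)
    (hLg : ∀ x y μ, |deriv (fun z => g z μ) x - deriv (fun z => g z μ) y| ≤ C * |x - y|)
    (hm : Measurable m) (hξ : Measurable ξ) (hv : Measurable v) {Cv : ℝ} (hCv : ∀ t, |v t| ≤ Cv)
    (hbm : Measurable b) (hb : MemLp b 2 (leb.restrict (Set.Iic T)))
    (hint : IntegrableOn (fun t => f (ξ t) (m t)) (Set.Iic T) leb) :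
    pathLin T f g m ξ v b ≤ pathCost T f g m ξ v b - pathCost T f g m ξ v 0 ∧
    pathCost T f g m ξ v b - pathCost T f g m ξ v 0 ≤ pathLin T f g m ξ v b
      + (C * T + C * T * T + 1 / 2) * ∫ s in Set.Iic T, b s ^ 2 ∂leb := by
  have hC : 0 ≤ C := (abs_nonneg _).trans (hCf 0 (m 0))
  set μ := leb.restrict (Set.Iic T) with hμ
  have hb1 : Integrable b μ := hb.integrable one_le_two
  have hb2 : Integrable (fun s => b s ^ 2) μ := hb.integrable_sq
  have hDm : Measurable (drift b) := by
    have := measurable_drift (α := Unit) (b := fun p => b p.1) (hbm.comp measurable_fst)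
    exact this.comp (measurable_id.prodMk (measurable_const (a := ())))
  set M := ∫ s, |b s| ∂μ with hM
  set Q := ∫ s, b s ^ 2 ∂μ with hQ
  have hD : ∀ t ∈ Set.Iic T, |drift b t| ≤ M := fun t ht => abs_drift_le hb1 ht
  have hMQ : M ^ 2 ≤ T * Q := sq_integral_abs_le hb
  have hD2 : ∀ t ∈ Set.Iic T, drift b t ^ 2 ≤ T * Q := fun t ht => by
    refine le_trans ?_ hMQ
    rw [← sq_abs]
    gcongr
    exact hD t ht
  have hDae : ∀ᵐ t ∂μ, |drift b t| ≤ M := ae_restrict_of_forall_mem measurableSet_Iic hD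
  obtain ⟨hdm, hdi⟩ := integrable_deriv_path (T := T) hf hCf hm hξ
  have hdi : Integrable (fun t => deriv (fun y => f y (m t)) (ξ t)) μ := hdi
  have hdD : Integrable (fun t => deriv (fun y => f y (m t)) (ξ t) * drift b t) μ :=
    hdi.mul_bdd hDm.aestronglyMeasurable hDae
  have hvb : Integrable (fun t => v t * b t) μ :=
    hb1.bdd_mul hv.aestronglyMeasurable (ae_of_all _ hCv)
  have hexp := fun t => convex_expansion (hf.differentiable (m t)) (hf.deriv_monotone (m t))
    (fun x y => hLf x y (m t)) (ξ t) (drift b t)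
  have hincm : Measurable fun t => f (ξ t + drift b t) (m t) - f (ξ t) (m t) :=
    (hf.measurable.comp ((hξ.add hDm).prodMk hm)).sub (hf.measurable.comp (hξ.prodMk hm))
  -- Only the increment of `f` is bounded, through the bound on its derivative; the integrability of
  -- `f` along the reference path is a hypothesis.
  have hinc : Integrable (fun t => f (ξ t + drift b t) (m t) - f (ξ t) (m t)) μ := by
    refine Integrable.of_bound hincm.aestronglyMeasurable (C * M + C * (T * Q))
      (ae_restrict_of_forall_mem measurableSet_Iic fun t ht => ?_)
    have h1 : |deriv (fun y => f y (m t)) (ξ t) * drift b t| ≤ C * M := by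
      rw [abs_mul]
      exact mul_le_mul (hCf _ _) (hD t ht) (abs_nonneg _) hC
    have h2 := mul_le_mul_of_nonneg_left (hD2 t ht) hC
    have h3 : 0 ≤ C * drift b t ^ 2 := by positivity
    obtain ⟨h4, h5⟩ := hexp t
    obtain ⟨h6, h7⟩ := abs_le.1 h1
    rw [Real.norm_eq_abs, abs_le]
    constructor <;> linarith
  have hfD : Integrable (fun t => f (ξ t + drift b t) (m t)) μ := by
    refine (hinc.add hint).congr (ae_of_all _ fun t => ?_)
    simp
  have hvL : MemLp v 2 μ := MemLp.of_bound hv.aestronglyMeasurable Cv (ae_of_all _ hCv)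
  have hq : Integrable (fun t => 1 / 2 * |b t - v t| ^ 2) μ := by
    refine ((hb.sub hvL).integrable_sq.const_mul (1 / 2)).congr (ae_of_all _ fun t => ?_)
    simp
  have hq0 : Integrable (fun t => 1 / 2 * |(0 : ℝ≥0 → ℝ) t - v t| ^ 2) μ := by
    refine (hvL.integrable_sq.const_mul (1 / 2)).congr (ae_of_all _ fun t => ?_)
    simp
  have hd0 : ∀ t, drift 0 t = 0 := fun t => by simp [drift]
  have hΔ : pathCost T f g m ξ v b - pathCost T f g m ξ v 0
      = (g (ξ T + drift b T) (m T) - g (ξ T) (m T))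
        + ∫ t, (f (ξ t + drift b t) (m t) - f (ξ t) (m t)) ∂μ + 1 / 2 * Q - ∫ t, v t * b t ∂μ := by
    have h1 : ∫ t, 1 / 2 * |b t - v t| ^ 2 ∂μ - ∫ t, 1 / 2 * |(0 : ℝ≥0 → ℝ) t - v t| ^ 2 ∂μ
        = 1 / 2 * Q - ∫ t, v t * b t ∂μ := by
      rw [← integral_sub hq hq0, hQ, ← integral_const_mul, ← integral_sub (hb2.const_mul _) hvb]
      refine integral_congr_ae (ae_of_all _ fun t => ?_)
      simp only [sq_abs, Pi.zero_apply]
      ring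
    simp only [pathCost, hd0, add_zero]
    rw [integral_add hfD hq, integral_add hint hq0, integral_sub hfD hint]
    linarith
  have hℓ : pathLin T f g m ξ v b = deriv (fun y => g y (m T)) (ξ T) * drift b T
      + ∫ t, deriv (fun y => f y (m t)) (ξ t) * drift b t ∂μ - ∫ t, v t * b t ∂μ := by
    have hKm : Measurable fun s => ∫ t in Set.Icc s T, deriv (fun y => f y (m t)) (ξ t) ∂leb :=
      (measurable_integral_Icc (α := Unit) (T := T)
        (a := fun p => deriv (fun y => f y (m p.1)) (ξ p.1)) (hdm.comp measurable_fst)).comp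
        (measurable_id.prodMk (measurable_const (a := ())))
    have hKb : ∀ s, ‖∫ t in Set.Icc s T, deriv (fun y => f y (m t)) (ξ t) ∂leb‖ ≤ ∫ t, C ∂μ := fun s => by
      refine (norm_integral_le_integral_norm _).trans ?_
      refine (setIntegral_mono_set (t := Set.Iic T) hdi.norm (ae_of_all _ fun _ => norm_nonneg _)
        Set.Icc_subset_Iic_self.eventuallyLE).trans ?_
      exact integral_mono hdi.norm (integrable_const _) fun t => hCf _ _
    have hKi := hb1.bdd_mul hKm.aestronglyMeasurable (ae_of_all _ hKb)
    have i1 : Integrable (fun s => deriv (fun y => g y (m T)) (ξ T) * b s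
        + (∫ t in Set.Icc s T, deriv (fun y => f y (m t)) (ξ t) ∂leb) * b s) μ :=
      (hb1.const_mul _).add hKi
    rw [integral_mul_drift hdi hb1, drift, ← integral_const_mul, ← integral_add (hb1.const_mul _) hKi,
      ← integral_sub i1 hvb, pathLin]
    refine integral_congr_ae (ae_of_all _ fun s => ?_)
    simp only [pathCostate]
    ring
  have hg1 := convex_expansion (hg.differentiable (m T)) (hg.deriv_monotone (m T))
    (fun x y => hLg x y (m T)) (ξ T) (drift b T)
  have hf1 : ∫ t, deriv (fun y => f y (m t)) (ξ t) * drift b t ∂μ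
      ≤ ∫ t, (f (ξ t + drift b t) (m t) - f (ξ t) (m t)) ∂μ :=
    integral_mono hdD hinc fun t => (hexp t).1
  have hf2 : ∫ t, (f (ξ t + drift b t) (m t) - f (ξ t) (m t)) ∂μ
      ≤ ∫ t, deriv (fun y => f y (m t)) (ξ t) * drift b t ∂μ + C * T * T * Q := by
    have h1 : ∫ t, (f (ξ t + drift b t) (m t) - f (ξ t) (m t)) ∂μ
        ≤ ∫ t, (deriv (fun y => f y (m t)) (ξ t) * drift b t + C * (T * Q)) ∂μ := by
      refine integral_mono_ae hinc (hdD.add (integrable_const _))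
        (ae_restrict_of_forall_mem measurableSet_Iic fun t ht => ?_)
      have h2 := mul_le_mul_of_nonneg_left (hD2 t ht) hC
      have h3 := (hexp t).2
      show f (ξ t + drift b t) (m t) - f (ξ t) (m t)
        ≤ deriv (fun y => f y (m t)) (ξ t) * drift b t + C * (T * Q)
      linarith
    rw [integral_add hdD (integrable_const _), integral_const] at h1
    have h2 : μ.real Set.univ = T := by
      rw [hμ, Measure.real, Measure.restrict_apply_univ, leb_Iic, ENNReal.coe_toReal]
    rw [h2, smul_eq_mul] at h1
    linarith
  have hgD := mul_le_mul_of_nonneg_left (hD2 T Set.self_mem_Iic) hC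
  have hQ0 : 0 ≤ Q := integral_nonneg fun s => sq_nonneg _
  rw [hΔ, hℓ]
  constructor
  · linarith [hg1.1]
  · linarith [hg1.2]

end

end

section

section

variable {Ω : Type*}

/-! ### The cost as an integral over `Ω × 𝕊` -/

/-- The path of the state at `p = (ω, x)`, stopped at `T`. -/
def statePath (T : ℝ≥0) (X : ℝ≥0 → Ω → L2) (p : Ω × UnitAddCircle) (t : ℝ≥0) : ℝ :=
  (canonicalValue (X (min t T) p.1) p.2).toReal

/-- The path of the laws, stopped at `T`. -/
def lawPath (T : ℝ≥0) (X : ℝ≥0 → Ω → L2) (p : Ω × UnitAddCircle) (t : ℝ≥0) : P2 :=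
  law (X (min t T) p.1)

/-- The path of the field along the solution at `p = (ω, x)`, stopped at `T`. -/
def fieldPath (T : ℝ≥0) (V : ℝ≥0 → UnitAddCircle → P2 → ℝ) (X : ℝ≥0 → Ω → L2)
    (p : Ω × UnitAddCircle) (t : ℝ≥0) : ℝ :=
  V (min t T) p.2 (law (X (min t T) p.1))

/-- The costate at `p = (ω, x)`. -/
def costatePath (T : ℝ≥0) (f g : ℝ → P2 → ℝ) (X : ℝ≥0 → Ω → L2) (p : Ω × UnitAddCircle) : ℝ≥0 → ℝ :=
  pathCostate T f g (lawPath T X p) (statePath T X p)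

/-- The difference between the costate and the field. -/
def gap (T : ℝ≥0) (f g : ℝ → P2 → ℝ) (V : ℝ≥0 → UnitAddCircle → P2 → ℝ) (X : ℝ≥0 → Ω → L2)
    (q : ℝ≥0 × Ω × UnitAddCircle) : ℝ :=
  costatePath T f g X q.2 q.1 - fieldPath T V X q.2 q.1

/-- The cost of the control `β - V`. -/
def stateCost (T : ℝ≥0) (f g : ℝ → P2 → ℝ) (V : ℝ≥0 → UnitAddCircle → P2 → ℝ) (X : ℝ≥0 → Ω → L2)
    (β : ℝ≥0 × Ω × UnitAddCircle → ℝ) (p : Ω × UnitAddCircle) : ℝ :=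
  pathCost T f g (lawPath T X p) (statePath T X p) (fieldPath T V X p) fun t => β (t, p)

end

theorem exists_gap_le {Ω : Type*} {T : ℝ≥0} {V : ℝ≥0 → UnitAddCircle → P2 → ℝ}
    {X : ℝ≥0 → Ω → L2} {f g : ℝ → P2 → ℝ} (hV : IsField T V) (hf : IsCostCoefficient f) (hg : IsCostCoefficient g) :
    ∃ C : ℝ, 0 ≤ C ∧ (∀ p t, |fieldPath T V X p t| ≤ C) ∧ (∀ p t, |costatePath T f g X p t| ≤ C) ∧
      ∀ q, |gap T f g V X q| ≤ C := by
  obtain ⟨C, hC, hVC, -⟩ := hV.bounded_lipschitz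
  obtain ⟨Cf, hCf, -, h1, -⟩ := hf.exists_bound
  obtain ⟨Cg, hCg, -, h2, -⟩ := hg.exists_bound
  have h3 : ∀ p t, |fieldPath T V X p t| ≤ C := fun p t => hVC _ (min_le_right _ _) _ _
  have h4 : ∀ p t, |costatePath T f g X p t| ≤ max Cf Cg + max Cf Cg * T := fun p t =>
    abs_pathCostate_le (le_max_of_le_left hCf) (fun x μ => (h1 x μ).trans (le_max_left _ _))
      (fun x μ => (h2 x μ).trans (le_max_right _ _)) t
  have h5 : 0 ≤ max Cf Cg + max Cf Cg * T := by
    have : 0 ≤ max Cf Cg := le_max_of_le_left hCf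
    positivity
  refine ⟨(max Cf Cg + max Cf Cg * T) + C, by positivity, fun p t => (h3 p t).trans (by linarith),
    fun p t => (h4 p t).trans (by linarith), fun q => (abs_sub _ _).trans (add_le_add (h4 _ _) (h3 _ _))⟩

variable {Ω : Type*} [mΩ : MeasurableSpace Ω] {P : Measure Ω} {ℱ : Filtration ℝ≥0 mΩ}
  {B : ℕ → ℝ≥0 → Ω → ℝ} {lam : ℝ} {T : ℝ≥0} {V : ℝ≥0 → UnitAddCircle → P2 → ℝ} {x₀ : L2}
  {X : ℝ≥0 → Ω → L2} {η : ℝ≥0 → Ω → Hm2sym} {f g : ℝ → P2 → ℝ}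

/-- The reference measure on `[0, T] × Ω × 𝕊`. -/
abbrev spaceTime (P : Measure Ω) (T : ℝ≥0) : Measure (ℝ≥0 × Ω × UnitAddCircle) :=
  (leb.restrict (Set.Iic T)).prod (P.prod volume)

theorem measurable_assoc {α β γ : Type*} [MeasurableSpace α] [MeasurableSpace β]
    [MeasurableSpace γ] : Measurable fun q : α × β × γ => ((q.1, q.2.1), q.2.2) :=
  (measurable_fst.prodMk (measurable_fst.comp measurable_snd)).prodMk
    (measurable_snd.comp measurable_snd)

/-! ### Joint measurability along the solution -/

section

variable (hX : IsSolution P ℱ B lam T V x₀ X η)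
include hX

theorem IsSolution.measurable_statePath :
    Measurable fun q : ℝ≥0 × Ω × UnitAddCircle => statePath T X q.2 q.1 :=
  ((measurable_canonicalValue hX.stronglyMeasurable_uncurry fun p => hX.min_mem p.1 p.2).comp
    measurable_assoc).ereal_toReal

theorem IsSolution.measurable_lawPath :
    Measurable fun q : ℝ≥0 × Ω × UnitAddCircle => lawPath T X q.2 q.1 :=
  ((measurable_law hX.stronglyMeasurable_uncurry fun p => hX.min_mem p.1 p.2).comp measurable_fst).comp
    measurable_assoc

theorem IsSolution.measurable_fieldPath (hV : IsField T V) :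
    Measurable fun q : ℝ≥0 × Ω × UnitAddCircle => fieldPath T V X q.2 q.1 :=
  (hV.measurable_comp (τ := fun p : ℝ≥0 × Ω => min p.1 T) (by fun_prop)
    (fun p => min_le_right _ _) hX.stronglyMeasurable_uncurry fun p => hX.min_mem p.1 p.2).comp
    measurable_assoc

theorem IsSolution.measurable_costatePath (hf : IsCostCoefficient f) (hg : IsCostCoefficient g) :
    Measurable fun q : ℝ≥0 × Ω × UnitAddCircle => costatePath T f g X q.2 q.1 := by
  have h1 := hg.measurable_deriv.comp (((hX.measurable_statePath.prodMk hX.measurable_lawPath).comp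
    ((measurable_const (a := T)).prodMk measurable_snd) :
      Measurable fun q : ℝ≥0 × Ω × UnitAddCircle => (statePath T X q.2 T, lawPath T X q.2 T)))
  have h2 := measurable_integral_Icc (T := T)
    (hf.measurable_deriv.comp (hX.measurable_statePath.prodMk hX.measurable_lawPath))
  exact h1.add h2

theorem IsSolution.measurable_gap (hV : IsField T V) (hf : IsCostCoefficient f)
    (hg : IsCostCoefficient g) : Measurable (gap T f g V X) :=
  (hX.measurable_costatePath hf hg).sub (hX.measurable_fieldPath hV)

end

/-! ### Integrability of the cost and its expansion -/

section

variable (hX : IsSolution P ℱ B lam T V x₀ X η) {K : ℝ≥0}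
  (hK : ∀ t ≤ T, ∫⁻ ω, ‖X t ω‖ₑ ∂P ≤ K)
include hX hK

/-- Linear growth gives `√(1 + y² + ‖u‖²) ≤ 1 + |y| + ‖u‖`, and the average of `|y|` over the circle
is at most `‖u‖`. First moments of `‖X_t‖` are therefore sufficient. -/
theorem IsSolution.lintegral_cost_le [IsProbabilityMeasure P] (hf : IsCostCoefficient f) :
    ∃ C : ℝ≥0, ∀ t, ∫⁻ p, ‖f (statePath T X p t) (lawPath T X p t)‖ₑ ∂(P.prod volume) ≤ C := by
  obtain ⟨C, hC, hgr, -⟩ := hf.exists_bound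
  refine ⟨C.toNNReal * (1 + K + K), fun t => ?_⟩
  set u : Ω → L2 := X (min t T) with hu
  have huU : ∀ ω, u ω ∈ U2 := hX.min_mem t
  have hum : StronglyMeasurable u := (hX.X_adapted _ (min_le_right t T)).mono (ℱ.le _)
  have hcv : Measurable fun p : Ω × UnitAddCircle => (canonicalValue (u p.1) p.2).toReal :=
    (measurable_canonicalValue hum huU).ereal_toReal
  have hnm : Measurable fun p : Ω × UnitAddCircle => ‖u p.1‖ₑ := hum.enorm.comp measurable_fst
  have hA : Measurable fun p : Ω × UnitAddCircle => 1 + ‖(canonicalValue (u p.1) p.2).toReal‖ₑ :=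
    hcv.enorm.const_add 1
  have hAN : Measurable fun p : Ω × UnitAddCircle =>
      1 + ‖(canonicalValue (u p.1) p.2).toReal‖ₑ + ‖u p.1‖ₑ := hA.add hnm
  have h1 : ∀ p, ‖f (statePath T X p t) (lawPath T X p t)‖ₑ
      ≤ C.toNNReal * (1 + ‖(canonicalValue (u p.1) p.2).toReal‖ₑ + ‖u p.1‖ₑ) := by
    intro p
    set y := (canonicalValue (u p.1) p.2).toReal
    have h2 : |f (statePath T X p t) (lawPath T X p t)| ≤ C * (1 + |y| + ‖u p.1‖) := by
      refine (hgr _ _).trans ?_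
      rw [lawPath, integral_sq_law]
      gcongr
      refine Real.sqrt_le_iff.2 ⟨by positivity, ?_⟩
      have h3 : statePath T X p t = y := rfl
      rw [h3, ← hu, ← sq_abs y]
      nlinarith [abs_nonneg y, norm_nonneg (u p.1), mul_nonneg (abs_nonneg y) (norm_nonneg (u p.1))]
    have h4 : C * (1 + |y| + ‖u p.1‖) = ((C.toNNReal * (1 + ‖y‖₊ + ‖u p.1‖₊) : ℝ≥0) : ℝ) := by
      push_cast
      rw [Real.coe_toNNReal _ hC]
      rfl
    rw [h4, ← Real.norm_eq_abs, ← coe_nnnorm, NNReal.coe_le_coe] at h2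
    have h8 := ENNReal.coe_le_coe.2 h2
    push_cast at h8
    exact h8
  have h5 : ∫⁻ p : Ω × UnitAddCircle, ‖(canonicalValue (u p.1) p.2).toReal‖ₑ ∂(P.prod volume) ≤ K := by
    rw [lintegral_prod _ hcv.enorm.aemeasurable]
    refine (lintegral_mono fun ω => ?_).trans (hK _ (min_le_right t T))
    have h6 : ∫⁻ x, ‖(canonicalValue (u ω) x).toReal‖ₑ = ∫⁻ x, ‖u ω x‖ₑ := by
      refine lintegral_congr_ae ?_
      filter_upwards [ae_canonicalValue_finite (huU ω)] with x hx
      rw [hx]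
    show ∫⁻ x, ‖(canonicalValue (u ω) x).toReal‖ₑ ≤ ‖u ω‖ₑ
    rw [h6, ← eLpNorm_one_eq_lintegral_enorm, Lp.enorm_def]
    exact eLpNorm_le_eLpNorm_of_exponent_le (by norm_num) (Lp.aestronglyMeasurable _)
  have h7 : ∫⁻ p : Ω × UnitAddCircle, ‖u p.1‖ₑ ∂(P.prod volume) ≤ K := by
    rw [lintegral_prod _ hnm.aemeasurable]
    simpa using hK _ (min_le_right t T)
  refine (lintegral_mono h1).trans ?_
  rw [lintegral_const_mul _ hAN, lintegral_add_left hA, lintegral_add_left measurable_const, lintegral_const,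
    measure_univ, mul_one]
  push_cast
  gcongr

theorem IsSolution.integrable_terminal [IsProbabilityMeasure P] (hg : IsCostCoefficient g) :
    Integrable (fun p => g (statePath T X p T) (lawPath T X p T)) (P.prod volume) := by
  obtain ⟨C, hC⟩ := hX.lintegral_cost_le hK hg
  refine ⟨(hg.measurable.comp ((hX.measurable_statePath.prodMk hX.measurable_lawPath).comp
    ((measurable_const (a := T)).prodMk measurable_id))).aestronglyMeasurable,
    (hC T).trans_lt ENNReal.coe_lt_top⟩

theorem IsSolution.integrable_running [IsProbabilityMeasure P] (hf : IsCostCoefficient f) :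
    Integrable (fun q : ℝ≥0 × Ω × UnitAddCircle => f (statePath T X q.2 q.1) (lawPath T X q.2 q.1))
      (spaceTime P T) := by
  obtain ⟨C, hC⟩ := hX.lintegral_cost_le hK hf
  have hm := hf.measurable.comp (hX.measurable_statePath.prodMk hX.measurable_lawPath)
  refine ⟨hm.aestronglyMeasurable, ?_⟩
  refine ((lintegral_prod _ hm.enorm.aemeasurable).le.trans (lintegral_mono hC)).trans_lt ?_
  rw [lintegral_const]
  exact ENNReal.mul_lt_top ENNReal.coe_lt_top (measure_lt_top _ _)

/-- Expansion of the cost around the equilibrium candidate. -/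
theorem IsSolution.stateCost_expansion [IsProbabilityMeasure P] (hV : IsField T V)
    (hf : IsCostCoefficient f) (hg : IsCostCoefficient g) :
    ∃ C : ℝ, ∀ β : ℝ≥0 × Ω × UnitAddCircle → ℝ, Measurable β → MemLp β 2 (spaceTime P T) →
      Integrable (stateCost T f g V X β) (P.prod volume) ∧
      ∫ q, gap T f g V X q * β q ∂(spaceTime P T)
        ≤ ∫ p, stateCost T f g V X β p ∂(P.prod volume) - ∫ p, stateCost T f g V X 0 p ∂(P.prod volume) ∧
      ∫ p, stateCost T f g V X β p ∂(P.prod volume) - ∫ p, stateCost T f g V X 0 p ∂(P.prod volume)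
        ≤ ∫ q, gap T f g V X q * β q ∂(spaceTime P T) + C * ∫ q, β q ^ 2 ∂(spaceTime P T) := by
  obtain ⟨Cf, hCf, -, hf1, hf2⟩ := hf.exists_bound
  obtain ⟨Cg, hCg, -, -, hg2⟩ := hg.exists_bound
  obtain ⟨Cv, hCv, hv, -, hgap⟩ := exists_gap_le (X := X) hV hf hg
  set C := max Cf Cg
  refine ⟨C * T + C * T * T + 1 / 2, fun β hβm hβ => ?_⟩
  have hmeas : ∀ β : ℝ≥0 × Ω × UnitAddCircle → ℝ, Measurable β →
      Measurable (stateCost T f g V X β) := by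
    intro β hβm
    have hx : Measurable fun q : ℝ≥0 × Ω × UnitAddCircle =>
        statePath T X q.2 q.1 + drift (fun s => β (s, q.2)) q.1 :=
      hX.measurable_statePath.add (measurable_drift hβm)
    have h1 := hg.measurable.comp ((hx.prodMk hX.measurable_lawPath).comp
      ((measurable_const (a := T)).prodMk measurable_id))
    have h2 : Measurable fun q : ℝ≥0 × Ω × UnitAddCircle =>
        f (statePath T X q.2 q.1 + drift (fun s => β (s, q.2)) q.1) (lawPath T X q.2 q.1)
          + 1 / 2 * |β q - fieldPath T V X q.2 q.1| ^ 2 := by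
      refine (hf.measurable.comp (hx.prodMk hX.measurable_lawPath)).add
        (Measurable.const_mul (Measurable.pow_const ?_ 2) _)
      exact (hβm.sub (hX.measurable_fieldPath hV)).norm
    have h3 := (h2.stronglyMeasurable.integral_prod_left' (μ := leb.restrict (Set.Iic T))).measurable
    exact h1.add h3
  have hβ2 : Integrable (fun q => β q ^ 2) (spaceTime P T) := hβ.integrable_sq
  have hβ1 : Integrable β (spaceTime P T) := hβ.integrable one_le_two
  have hgm := hX.measurable_gap hV hf hg
  have hgβ : Integrable (fun q => gap T f g V X q * β q) (spaceTime P T) :=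
    hβ1.bdd_mul hgm.aestronglyMeasurable (ae_of_all _ hgap)
  have hrun := hX.integrable_running hK hf
  have hpt : ∀ᵐ p ∂(P.prod (volume : Measure UnitAddCircle)),
      ∫ t in Set.Iic T, gap T f g V X (t, p) * β (t, p) ∂leb
        ≤ stateCost T f g V X β p - stateCost T f g V X 0 p ∧
      stateCost T f g V X β p - stateCost T f g V X 0 p
        ≤ ∫ t in Set.Iic T, gap T f g V X (t, p) * β (t, p) ∂leb
          + (C * T + C * T * T + 1 / 2) * ∫ t in Set.Iic T, β (t, p) ^ 2 ∂leb := by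
    filter_upwards [hβ2.prod_left_ae, hrun.prod_left_ae] with p hp1 hp2
    have hsec : Measurable fun t : ℝ≥0 => (t, p) := measurable_id.prodMk measurable_const
    refine pathCost_expansion (C := C) (Cv := Cv) hf hg (fun x μ => (hf1 x μ).trans (le_max_left _ _))
      (fun x y μ => (hf2 x y μ).trans (by gcongr; exact le_max_left _ _))
      (fun x y μ => (hg2 x y μ).trans (by gcongr; exact le_max_right _ _))
      (hX.measurable_lawPath.comp hsec) (hX.measurable_statePath.comp hsec)
      ((hX.measurable_fieldPath hV).comp hsec) (hv p) (hβm.comp hsec)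
      ((memLp_two_iff_integrable_sq (hβm.comp hsec).aestronglyMeasurable).2 hp1) hp2
  have hi1 := hgβ.integral_prod_right
  have hi2 := hβ2.integral_prod_right
  -- The difference of costs is integrable because it lies between two integrable functions,
  -- uniformly over the growth of `f` and `g`; only the reference cost needs the moment bound.
  have hΔ : Integrable (fun p => stateCost T f g V X β p - stateCost T f g V X 0 p) (P.prod volume) := by
    refine (hi1.abs.add (hi2.abs.const_mul |C * T + C * T * T + 1 / 2|)).mono'
      ((hmeas β hβm).sub (hmeas 0 measurable_const)).aestronglyMeasurable ?_
    filter_upwards [hpt] with p hp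
    simp only [Pi.add_apply, Real.norm_eq_abs, ← abs_mul]
    refine abs_le.2 ⟨?_, ?_⟩
    · have := neg_abs_le (∫ t in Set.Iic T, gap T f g V X (t, p) * β (t, p) ∂leb)
      have := abs_nonneg ((C * T + C * T * T + 1 / 2) * ∫ t in Set.Iic T, β (t, p) ^ 2 ∂leb)
      linarith [hp.1]
    · exact hp.2.trans (add_le_add (le_abs_self _) (le_abs_self _))
  have h0 : Integrable (stateCost T f g V X 0) (P.prod volume) := by
    have hd0 : ∀ t, drift (fun _ => (0 : ℝ)) t = 0 := fun t => by simp [drift]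
    have hq : Integrable (fun q : ℝ≥0 × Ω × UnitAddCircle =>
        f (statePath T X q.2 q.1) (lawPath T X q.2 q.1) + 1 / 2 * |fieldPath T V X q.2 q.1| ^ 2)
        (spaceTime P T) := by
      refine hrun.add (Integrable.of_bound (C := 1 / 2 * Cv ^ 2)
        (Measurable.const_mul (Measurable.pow_const (hX.measurable_fieldPath hV).norm 2)
          _).aestronglyMeasurable (ae_of_all _ fun q => ?_))
      rw [Real.norm_eq_abs, abs_of_nonneg (by positivity)]
      gcongr
      exact hv _ _
    refine ((hX.integrable_terminal hK hg).add hq.integral_prod_right).congr (ae_of_all _ fun p => ?_)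
    simp [stateCost, pathCost, hd0]
  have hβi : Integrable (stateCost T f g V X β) (P.prod volume) :=
    (hΔ.add h0).congr (ae_of_all _ fun p => by simp)
  refine ⟨hβi, ?_, ?_⟩
  · rw [← integral_sub hβi h0, integral_prod_symm _ hgβ]
    exact integral_mono_ae hi1 hΔ (hpt.mono fun p hp => hp.1)
  · rw [← integral_sub hβi h0, integral_prod_symm _ hgβ, integral_prod_symm _ hβ2, ← integral_const_mul,
      ← integral_add hi1 (hi2.const_mul _)]
    exact integral_mono_ae hΔ (hi1.add (hi2.const_mul _)) (hpt.mono fun p hp => hp.2)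

end

end

section

/-! ### Admissible pairs -/

theorem prod_prod_mono {α β Ω : Type*} (a : MeasurableSpace α) (b : MeasurableSpace β)
    {m m' : MeasurableSpace Ω} (h : m ≤ m') : a.prod (m.prod b) ≤ a.prod (m'.prod b) :=
  sup_le_sup le_rfl (MeasurableSpace.comap_mono (sup_le_sup (MeasurableSpace.comap_mono h) le_rfl))

/-- Progressive measurability is stated on the subtype of times before `t`; stopping at `t` turns it
into measurability on a fixed product space. The σ-algebra on `Ω` is arbitrary, here and in the
auxiliary lemmas that follow, so that `ℱ t` can be substituted for it. -/
theorem measurable_min_iff {Ω : Type*} [MeasurableSpace Ω] {t : ℝ≥0}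
    {γ : ℝ≥0 → Ω → UnitAddCircle → ℝ} :
    (Measurable fun p : Set.Iic t × Ω × UnitAddCircle => γ p.1 p.2.1 p.2.2) ↔
      Measurable fun p : ℝ≥0 × Ω × UnitAddCircle => γ (min p.1 t) p.2.1 p.2.2 := by
  constructor
  · intro h
    have h1 : Measurable fun p : ℝ≥0 × Ω × UnitAddCircle =>
        ((⟨min p.1 t, Set.mem_Iic.2 (min_le_right _ _)⟩ : Set.Iic t), p.2) :=
      ((measurable_fst.min measurable_const).subtype_mk).prodMk measurable_snd
    exact h.comp h1
  · intro h
    have h1 : Measurable fun p : Set.Iic t × Ω × UnitAddCircle => ((p.1 : ℝ≥0), p.2) :=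
      (measurable_subtype_coe.comp measurable_fst).prodMk measurable_snd
    convert h.comp h1 using 2 with p
    exact congrArg (fun s => γ s p.2.1 p.2.2) (min_eq_left p.1.2).symm

theorem measurable_statePath_aux {Ω : Type*} [MeasurableSpace Ω] {t : ℝ≥0} {X : ℝ≥0 → Ω → L2}
    (hX : StronglyMeasurable fun p : ℝ≥0 × Ω => X (min p.1 t) p.2)
    (hU : ∀ s ω, X (min s t) ω ∈ U2) :
    Measurable fun p : ℝ≥0 × Ω × UnitAddCircle => (canonicalValue (X (min p.1 t) p.2.1) p.2.2).toReal :=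
  ((measurable_canonicalValue hX fun p => hU p.1 p.2).comp measurable_assoc).ereal_toReal

theorem measurable_fieldPath_aux {Ω : Type*} [MeasurableSpace Ω] {t T : ℝ≥0} {X : ℝ≥0 → Ω → L2}
    {V : ℝ≥0 → UnitAddCircle → P2 → ℝ} (hV : IsField T V) (ht : t ≤ T)
    (hX : StronglyMeasurable fun p : ℝ≥0 × Ω => X (min p.1 t) p.2)
    (hU : ∀ s ω, X (min s t) ω ∈ U2) :
    Measurable fun p : ℝ≥0 × Ω × UnitAddCircle =>
      V (min p.1 t) p.2.2 (law (X (min p.1 t) p.2.1)) :=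
  (hV.measurable_comp (τ := fun p : ℝ≥0 × Ω => min p.1 t) (by fun_prop)
    (fun p => (min_le_right _ _).trans ht) hX fun p => hU p.1 p.2).comp measurable_assoc

theorem measurable_drift_min {Ω : Type*} [MeasurableSpace Ω] {t : ℝ≥0}
    {b : ℝ≥0 → Ω → UnitAddCircle → ℝ}
    (hb : Measurable fun p : ℝ≥0 × Ω × UnitAddCircle => b (min p.1 t) p.2.1 p.2.2) :
    Measurable fun p : ℝ≥0 × Ω × UnitAddCircle => drift (fun s => b s p.2.1 p.2.2) (min p.1 t) := by
  have h := (measurable_drift hb).comp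
    ((measurable_fst.min measurable_const).prodMk measurable_snd :
      Measurable fun p : ℝ≥0 × Ω × UnitAddCircle => (min p.1 t, p.2))
  convert h using 2 with p
  refine setIntegral_congr_fun measurableSet_Iic fun s hs => ?_
  have : min s t = s := min_eq_left (le_trans hs (min_le_right _ _))
  simp only [this]

variable {Ω : Type*} [mΩ : MeasurableSpace Ω] {P : Measure Ω} {ℱ : Filtration ℝ≥0 mΩ}
  {B : ℕ → ℝ≥0 → Ω → ℝ} {lam : ℝ} {T : ℝ≥0} {V : ℝ≥0 → UnitAddCircle → P2 → ℝ} {x₀ : L2}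
  {X : ℝ≥0 → Ω → L2} {η : ℝ≥0 → Ω → Hm2sym} {f g : ℝ → P2 → ℝ}

theorem isProgressiveField_iff {γ : ℝ≥0 → Ω → UnitAddCircle → ℝ} : IsProgressiveField ℱ T γ ↔
    ∀ t ≤ T, Measurable[MeasurableSpace.prod inferInstance (MeasurableSpace.prod (ℱ t) inferInstance)]
      fun p : ℝ≥0 × Ω × UnitAddCircle => γ (min p.1 t) p.2.1 p.2.2 :=
  forall₂_congr fun t _ => @measurable_min_iff Ω (ℱ t) t γ

theorem IsProgressiveField.measurable {γ : ℝ≥0 → Ω → UnitAddCircle → ℝ} (h : IsProgressiveField ℱ T γ) :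
    Measurable fun p : ℝ≥0 × Ω × UnitAddCircle => γ (min p.1 T) p.2.1 p.2.2 :=
  (isProgressiveField_iff.1 h T le_rfl).mono (prod_prod_mono _ _ (ℱ.le T)) le_rfl

theorem IsProgressiveField.add {γ β : ℝ≥0 → Ω → UnitAddCircle → ℝ} (hγ : IsProgressiveField ℱ T γ)
    (hβ : IsProgressiveField ℱ T β) : IsProgressiveField ℱ T fun t ω x => γ t ω x + β t ω x :=
  fun t ht => (hγ t ht).add (hβ t ht)

theorem IsProgressiveField.sub {γ β : ℝ≥0 → Ω → UnitAddCircle → ℝ} (hγ : IsProgressiveField ℱ T γ)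
    (hβ : IsProgressiveField ℱ T β) : IsProgressiveField ℱ T fun t ω x => γ t ω x - β t ω x :=
  fun t ht => (hγ t ht).sub (hβ t ht)

theorem IsProgressiveField.drift {b : ℝ≥0 → Ω → UnitAddCircle → ℝ} (hb : IsProgressiveField ℱ T b) :
    IsProgressiveField ℱ T fun t ω x => drift (fun s => b s ω x) t :=
  isProgressiveField_iff.2 fun t ht =>
    @measurable_drift_min Ω (ℱ t) t b (isProgressiveField_iff.1 hb t ht)

theorem IsSolution.isProgressiveField_state (hX : IsSolution P ℱ B lam T V x₀ X η) :
    IsProgressiveField ℱ T fun t ω x => (canonicalValue (X t ω) x).toReal :=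
  isProgressiveField_iff.2 fun t ht => @measurable_statePath_aux Ω (ℱ t) t X
    (hX.stronglyMeasurable_min ht) fun _ _ => hX.X_mem _ ((min_le_right _ _).trans ht) _

theorem IsSolution.isProgressiveField_field (hX : IsSolution P ℱ B lam T V x₀ X η) (hV : IsField T V) :
    IsProgressiveField ℱ T fun t ω x => V t x (law (X t ω)) :=
  isProgressiveField_iff.2 fun t ht => @measurable_fieldPath_aux Ω (ℱ t) t T X V hV ht
    (hX.stronglyMeasurable_min ht) fun _ _ => hX.X_mem _ ((min_le_right _ _).trans ht) _

theorem lintegral_spaceTime [IsProbabilityMeasure P] {F : ℝ≥0 × Ω × UnitAddCircle → ℝ≥0∞}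
    (hF : Measurable F) :
    ∫⁻ ω, (∫⁻ t in Set.Iic T, (∫⁻ x, F (t, ω, x)) ∂leb) ∂P = ∫⁻ q, F q ∂(spaceTime P T) := by
  rw [lintegral_prod_symm' _ hF, lintegral_prod _ (hF.lintegral_prod_left').aemeasurable]
  refine lintegral_congr fun ω => ?_
  exact lintegral_lintegral_swap (hF.comp
    (measurable_fst.prodMk (measurable_const.prodMk measurable_snd))).aemeasurable

theorem memLp_min_iff [IsProbabilityMeasure P] {γ : ℝ≥0 → Ω → UnitAddCircle → ℝ}
    (hγ : IsProgressiveField ℱ T γ) :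
    MemLp (fun q : ℝ≥0 × Ω × UnitAddCircle => γ (min q.1 T) q.2.1 q.2.2) 2 (spaceTime P T) ↔
      ∫⁻ ω, (∫⁻ t in Set.Iic T, (∫⁻ x, ‖γ t ω x‖ₑ ^ 2) ∂leb) ∂P < ⊤ := by
  have hm := hγ.measurable
  have h1 : ∫⁻ ω, (∫⁻ t in Set.Iic T, (∫⁻ x, ‖γ t ω x‖ₑ ^ 2) ∂leb) ∂P
      = ∫⁻ q, ‖γ (min q.1 T) q.2.1 q.2.2‖ₑ ^ 2 ∂(spaceTime P T) := by
    rw [← lintegral_spaceTime (hm.enorm.pow_const 2)]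
    refine lintegral_congr fun ω => setLIntegral_congr_fun measurableSet_Iic fun t ht => ?_
    simp only [min_eq_left (Set.mem_Iic.1 ht)]
  rw [h1, MemLp, and_iff_right hm.aestronglyMeasurable,
    eLpNorm_lt_top_iff_lintegral_rpow_enorm_lt_top (by norm_num) (by norm_num)]
  simp

/-- The admissible pair with control `b - V`. -/
theorem IsSolution.isAdmissible [IsProbabilityMeasure P] (hX : IsSolution P ℱ B lam T V x₀ X η)
    (hV : IsField T V) {b : ℝ≥0 → Ω → UnitAddCircle → ℝ} (hb : IsProgressiveField ℱ T b)
    (hb2 : MemLp (fun q : ℝ≥0 × Ω × UnitAddCircle => b (min q.1 T) q.2.1 q.2.2) 2 (spaceTime P T)) :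
    IsAdmissible P ℱ T V X
      (fun t ω x => (canonicalValue (X t ω) x).toReal + drift (fun s => b s ω x) t)
      (fun t ω x => b t ω x - V t x (law (X t ω))) := by
  obtain ⟨C, hC, hVC, -⟩ := hV.bounded_lipschitz
  have hγ := hb.sub (hX.isProgressiveField_field hV)
  refine ⟨hX.isProgressiveField_state.add hb.drift, hγ, (memLp_min_iff hγ).1 ?_,
    ae_of_all _ fun ω => ?_⟩
  · exact hb2.sub (MemLp.of_bound (hX.isProgressiveField_field hV).measurable.aestronglyMeasurable C
      (ae_of_all _ fun q => hVC _ (min_le_right _ _) _ _))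
  · filter_upwards [ae_ne_point ((0 : ℝ) : UnitAddCircle), ae_ne_point ((1 / 2 : ℝ) : UnitAddCircle)]
      with x h0 h1 t ht
    rw [EReal.coe_add, coe_toReal_canonicalValue (hX.X_mem t ht ω) h0 h1]
    simp [RSHE.drift]

/-- The cost of an admissible pair `(Γ, γ)`, in terms of `γ + V`. -/
theorem IsSolution.cost_eq [IsProbabilityMeasure P] (hX : IsSolution P ℱ B lam T V x₀ X η)
    {K : ℝ≥0} (hK : ∀ t ≤ T, ∫⁻ ω, ‖X t ω‖ₑ ∂P ≤ K) (hV : IsField T V)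
    (hf : IsCostCoefficient f) (hg : IsCostCoefficient g)
    {Γ γ : ℝ≥0 → Ω → UnitAddCircle → ℝ} (h : IsAdmissible P ℱ T V X Γ γ) :
    ∃ b : ℝ≥0 → Ω → UnitAddCircle → ℝ, (b = fun t ω x => γ t ω x + V t x (law (X t ω))) ∧
      IsProgressiveField ℱ T b ∧
      MemLp (fun q : ℝ≥0 × Ω × UnitAddCircle => b (min q.1 T) q.2.1 q.2.2) 2 (spaceTime P T) ∧
      cost P T f g X Γ γ = ∫ p, stateCost T f g V X
        (fun q : ℝ≥0 × Ω × UnitAddCircle => b (min q.1 T) q.2.1 q.2.2) p ∂(P.prod volume) := by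
  obtain ⟨C, hC, hVC, -⟩ := hV.bounded_lipschitz
  have hbp := h.control_progressive.add (hX.isProgressiveField_field hV)
  have hb2 : MemLp (fun q : ℝ≥0 × Ω × UnitAddCircle => γ (min q.1 T) q.2.1 q.2.2
      + V (min q.1 T) q.2.2 (law (X (min q.1 T) q.2.1))) 2 (spaceTime P T) :=
    ((memLp_min_iff h.control_progressive).2 h.control_sq_integrable).add
      (MemLp.of_bound (hX.isProgressiveField_field hV).measurable.aestronglyMeasurable C
      (ae_of_all _ fun q => hVC _ (min_le_right _ _) _ _))
  refine ⟨_, rfl, hbp, hb2, ?_⟩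
  obtain ⟨_, hexp⟩ := hX.stateCost_expansion hK hV hf hg
  rw [integral_prod _ (hexp _ hbp.measurable hb2).1, cost]
  refine integral_congr_ae ?_
  filter_upwards [h.dynamics] with ω hω
  refine integral_congr_ae ?_
  filter_upwards [hω, ae_ne_point ((0 : ℝ) : UnitAddCircle),
    ae_ne_point ((1 / 2 : ℝ) : UnitAddCircle)] with x hx h0 h1
  -- Away from the points `0` and `1/2` the canonical value is finite, so the dynamics in `EReal`
  -- can be read in `ℝ`.
  have hΓ : ∀ t ≤ T, Γ t ω x = statePath T X (ω, x) t + drift (fun s => γ (min s T) ω x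
      + V (min s T) x (law (X (min s T) ω))) t := by
    intro t ht
    have h2 := hx t ht
    rw [← coe_toReal_canonicalValue (hX.X_mem t ht ω) h0 h1, ← EReal.coe_add, EReal.coe_eq_coe_iff] at h2
    rw [h2, statePath, min_eq_left ht, RSHE.drift]
    congr 1
    refine setIntegral_congr_fun measurableSet_Iic fun s hs => ?_
    simp only [min_eq_left (le_trans (Set.mem_Iic.1 hs) ht)]
  simp only [stateCost, pathCost]
  rw [← hΓ T le_rfl, lawPath, min_self]
  congr 1
  refine setIntegral_congr_fun measurableSet_Iic fun t ht => ?_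
  rw [← hΓ t ht, lawPath, fieldPath, min_eq_left (Set.mem_Iic.1 ht), add_sub_cancel_right]

theorem IsSolution.isAdmissible_self [IsProbabilityMeasure P] (hX : IsSolution P ℱ B lam T V x₀ X η)
    (hV : IsField T V) : IsAdmissible P ℱ T V X (fun t ω x => (canonicalValue (X t ω) x).toReal)
      (fun t ω x => - V t x (law (X t ω))) := by
  have h := hX.isAdmissible hV (b := fun _ _ _ => 0) (fun t _ => measurable_const) MemLp.zero'
  simpa [RSHE.drift] using h

/-- Sufficiency rests on convexity alone: once the linear term vanishes, the lower bound of the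
expansion says that no admissible pair is cheaper. -/
theorem IsSolution.isMeanFieldEquilibrium_of_integral_eq_zero [IsProbabilityMeasure P]
    (hX : IsSolution P ℱ B lam T V x₀ X η) {K : ℝ≥0} (hK : ∀ t ≤ T, ∫⁻ ω, ‖X t ω‖ₑ ∂P ≤ K)
    (hV : IsField T V) (hf : IsCostCoefficient f) (hg : IsCostCoefficient g)
    (h : ∀ b : ℝ≥0 → Ω → UnitAddCircle → ℝ, IsProgressiveField ℱ T b →
      Integrable (fun q : ℝ≥0 × Ω × UnitAddCircle => b (min q.1 T) q.2.1 q.2.2) (spaceTime P T) →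
      ∫ q, gap T f g V X q * b (min q.1 T) q.2.1 q.2.2 ∂(spaceTime P T) = 0) :
    IsMeanFieldEquilibrium P ℱ T f g V X := by
  refine ⟨hX.isAdmissible_self hV, fun Γ γ hΓ => ?_⟩
  obtain ⟨b₀, hb₀, -, -, h₀⟩ := hX.cost_eq hK hV hf hg (hX.isAdmissible_self hV)
  obtain ⟨b, -, hb1, hb2, hb⟩ := hX.cost_eq hK hV hf hg hΓ
  obtain ⟨_, hexp⟩ := hX.stateCost_expansion hK hV hf hg
  have h1 := (hexp _ hb1.measurable hb2).2.1
  rw [h b hb1 (hb2.integrable one_le_two)] at h1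
  rw [h₀, hb, hb₀]
  simp only [neg_add_cancel]
  exact sub_nonneg.1 h1

/-- Perturbing by `θ b` with `θ` of either sign gives `0 ≤ θ I + C Q θ²` for every real `θ`, and the
discriminant forces `I = 0`. -/
theorem IsSolution.integral_eq_zero_of_isMeanFieldEquilibrium [IsProbabilityMeasure P]
    (hX : IsSolution P ℱ B lam T V x₀ X η) {K : ℝ≥0} (hK : ∀ t ≤ T, ∫⁻ ω, ‖X t ω‖ₑ ∂P ≤ K)
    (hV : IsField T V) (hf : IsCostCoefficient f) (hg : IsCostCoefficient g)
    (h : IsMeanFieldEquilibrium P ℱ T f g V X) {b : ℝ≥0 → Ω → UnitAddCircle → ℝ}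
    (hb : IsProgressiveField ℱ T b)
    (hb2 : MemLp (fun q : ℝ≥0 × Ω × UnitAddCircle => b (min q.1 T) q.2.1 q.2.2) 2 (spaceTime P T)) :
    ∫ q, gap T f g V X q * b (min q.1 T) q.2.1 q.2.2 ∂(spaceTime P T) = 0 := by
  obtain ⟨b₀, hb₀, -, -, h₀⟩ := hX.cost_eq hK hV hf hg (hX.isAdmissible_self hV)
  obtain ⟨C, hexp⟩ := hX.stateCost_expansion hK hV hf hg
  set I := ∫ q, gap T f g V X q * b (min q.1 T) q.2.1 q.2.2 ∂(spaceTime P T) with hI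
  set Q := ∫ q : ℝ≥0 × Ω × UnitAddCircle, b (min q.1 T) q.2.1 q.2.2 ^ 2 ∂(spaceTime P T) with hQ
  have key : ∀ θ : ℝ, 0 ≤ (C * Q) * (θ * θ) + I * θ + 0 := by
    intro θ
    have hθ : IsProgressiveField ℱ T fun t ω x => θ * b t ω x := fun t ht => (hb t ht).const_mul θ
    have hθ2 := hb2.const_mul θ
    have hadm := hX.isAdmissible hV hθ hθ2
    obtain ⟨b₁, hb₁, -, -, h₁⟩ := hX.cost_eq hK hV hf hg hadm
    have h2 := h.2 _ _ hadm
    rw [h₀, h₁, hb₀, hb₁] at h2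
    simp only [neg_add_cancel, sub_add_cancel] at h2
    have h3 := (hexp _ hθ.measurable hθ2).2.2
    have h4 : ∫ q, gap T f g V X q * (θ * b (min q.1 T) q.2.1 q.2.2) ∂(spaceTime P T) = θ * I := by
      rw [hI, ← integral_const_mul]
      exact integral_congr_ae (ae_of_all _ fun q => by simp only; ring)
    have h5 : ∫ q : ℝ≥0 × Ω × UnitAddCircle, (θ * b (min q.1 T) q.2.1 q.2.2) ^ 2 ∂(spaceTime P T)
        = θ ^ 2 * Q := by
      rw [hQ, ← integral_const_mul]
      exact integral_congr_ae (ae_of_all _ fun q => by simp only; ring)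
    rw [h4, h5] at h3
    have h6 := sub_nonneg.2 h2
    have h7 := h6.trans h3
    linarith
  have h2 := discrim_le_zero key
  rw [discrim] at h2
  nlinarith

end

section

/-! ### Conditional expectations along a filtration -/

section

variable {E : Type*} {m : MeasurableSpace E} [mE : MeasurableSpace E] {Q : Measure E} [IsProbabilityMeasure Q]

theorem integral_condExp_mul (hm : m ≤ mE) {Z W : E → ℝ}
    (hZ : Integrable Z Q) (hW : StronglyMeasurable[m] W) (hZW : Integrable (fun p => Z p * W p) Q) :
    ∫ p, Z p * W p ∂Q = ∫ p, (Q[Z | m]) p * W p ∂Q := by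
  rw [← integral_condExp hm]
  exact integral_congr_ae (condExp_mul_of_stronglyMeasurable_right hW hZW hZ)

/-- A version of the conditional expectation with values in `[-C, C]`. -/
def clippedCondExp {E : Type*} {mE : MeasurableSpace E} (Q : Measure E) (m : MeasurableSpace E) (C : ℝ) (Z : E → ℝ) (p : E) : ℝ :=
  max (-C) (min C ((Q[Z | m]) p))

theorem measurable_clippedCondExp {E : Type*} (m : MeasurableSpace E) {mE : MeasurableSpace E}
    (Q : Measure E) (C : ℝ) (Z : E → ℝ) :
    Measurable[m] (clippedCondExp Q m C Z) :=
  measurable_const.max (measurable_const.min stronglyMeasurable_condExp.measurable)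

theorem abs_clippedCondExp_le {E : Type*} {mE : MeasurableSpace E} {Q : Measure E} (m : MeasurableSpace E) {C : ℝ} (hC : 0 ≤ C) (Z : E → ℝ) (p : E) :
    |clippedCondExp Q m C Z p| ≤ C :=
  abs_le.2 ⟨le_max_left _ _, max_le (by linarith) (min_le_left _ _)⟩

theorem clippedCondExp_ae_eq {E : Type*} (m : MeasurableSpace E) {mE : MeasurableSpace E}
    {Q : Measure E} {C : ℝ} {Z : E → ℝ} (hZ : ∀ p, |Z p| ≤ C) :
    clippedCondExp Q m C Z =ᵐ[Q] Q[Z | m] := by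
  filter_upwards [ae_bdd_abs_condExp_of_ae_bdd_abs (m := m) (ae_of_all Q hZ)] with p hp
  rw [clippedCondExp, min_eq_right (abs_le.1 hp).2, max_eq_right (abs_le.1 hp).1]

theorem integral_mul_clippedCondExp (hm : m ≤ mE) {C C' : ℝ} {Z W : E → ℝ}
    (hZm : Measurable Z) (hZ : ∀ p, |Z p| ≤ C) (hW : Measurable[m] W) (hWb : ∀ p, |W p| ≤ C') :
    ∫ p, Z p * W p ∂Q = ∫ p, clippedCondExp Q m C Z p * W p ∂Q := by
  have hZi : Integrable Z Q := Integrable.of_bound hZm.aestronglyMeasurable C (ae_of_all _ hZ)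
  rw [integral_condExp_mul hm hZi hW.stronglyMeasurable
    (hZi.mul_bdd (hW.mono hm le_rfl).aestronglyMeasurable (ae_of_all _ hWb))]
  refine integral_congr_ae ?_
  filter_upwards [clippedCondExp_ae_eq m hZ] with p hp
  rw [hp]

theorem integral_abs_le_sqrt {D : E → ℝ} (hD : MemLp D 2 Q) : ∫ p, |D p| ∂Q ≤ √(∫ p, D p ^ 2 ∂Q) := by
  have h := variance_nonneg (fun p => |D p|) Q
  rw [variance_eq_sub (X := fun p => |D p|) hD.norm] at h
  refine Real.le_sqrt_of_sq_le ?_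
  have h2 : ∫ p, ((fun p => |D p|) ^ 2) p ∂Q = ∫ p, D p ^ 2 ∂Q := by
    refine integral_congr_ae (ae_of_all _ fun p => ?_)
    simp
  linarith

end

/-- The largest multiple of `1 / (n + 1)` below `s`. -/
def gridTime (n : ℕ) (s : ℝ≥0) : ℝ≥0 := ⌊s * (n + 1)⌋₊ / (n + 1)

theorem gridTime_le (n : ℕ) (s : ℝ≥0) : gridTime n s ≤ s :=
  div_le_of_le_mul₀ zero_le zero_le (Nat.floor_le zero_le)

theorem tendsto_gridTime (s : ℝ≥0) : Tendsto (fun n => gridTime n s) atTop (𝓝 s) := by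
  rw [← NNReal.tendsto_coe]
  have h := (tendsto_nat_floor_mul_div_atTop (R := ℝ) s.2).comp
    ((tendsto_add_atTop_iff_nat 1).2 (tendsto_natCast_atTop_atTop (R := ℝ)))
  refine h.congr fun n => ?_
  have h1 : ((s : ℝ) * ((n + 1 : ℕ) : ℝ)) = ((s * (n + 1) : ℝ≥0) : ℝ) := by push_cast; rfl
  have h2 : ⌊(s : ℝ) * ((n + 1 : ℕ) : ℝ)⌋₊ = ⌊s * ((n : ℝ≥0) + 1)⌋₊ := by
    rw [h1]
    exact Nonneg.nat_floor_coe _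
  show ((⌊(s : ℝ) * ((n + 1 : ℕ) : ℝ)⌋₊ : ℕ) : ℝ) / ((n + 1 : ℕ) : ℝ) = _
  rw [h2, gridTime]
  push_cast
  rfl

/-- The discretised process involves only countably many times, so joint measurability follows from
measurability at each fixed time. As grid times never exceed the current time, applying this with
the σ-algebra at time `t` gives progressive measurability. -/
theorem measurable_comp_gridTime {E : Type*} [MeasurableSpace E] {N : ℝ≥0 → E → ℝ} {t : ℝ≥0}
    (hN : ∀ s ≤ t, Measurable (N s)) (n : ℕ) :
    Measurable fun q : ℝ≥0 × E => N (gridTime n (min q.1 t)) q.2 := by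
  have h1 : Measurable fun k : ℕ × E => N (min ((k.1 : ℝ≥0) / (n + 1)) t) k.2 :=
    measurable_from_prod_countable_right fun k => by
      exact hN _ (min_le_right ((k : ℝ≥0) / (n + 1)) t)
  have h2 : Measurable fun q : ℝ≥0 × E => ((⌊min q.1 t * (n + 1)⌋₊ : ℕ), q.2) :=
    (((measurable_fst.min measurable_const).mul_const _).nat_floor).prodMk measurable_snd
  convert h1.comp h2 using 2 with q
  have h3 := (gridTime_le n (min q.1 t)).trans (min_le_right _ _)
  exact congrArg (fun s => N s q.2) (min_eq_left h3).symm

/-! ### Identification of the conditional expectation at almost every time -/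

section

variable {E : Type*} [mE : MeasurableSpace E] {Q : Measure E} [IsProbabilityMeasure Q]

/-- If `(Z - U_s)` is orthogonal, in `L²(ds ⊗ Q)`, to the discretizations of `𝔼[Z | 𝒢_s] - U_s`,
then `U_s` is a version of `𝔼[Z | 𝒢_s]` for a.e. `s`. -/
theorem ae_integral_mul_eq_zero {𝒢 : Filtration ℝ≥0 mE} {T : ℝ≥0} {C : ℝ} (hC : 0 ≤ C) {Z : E → ℝ}
    {U : ℝ≥0 × E → ℝ} (hZm : Measurable Z) (hZ : ∀ p, |Z p| ≤ C) (hUm : Measurable U)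
    (hU : ∀ q, |U q| ≤ C) (hU𝒢 : ∀ s ≤ T, Measurable[𝒢 s] fun p => U (s, p))
    (h : ∀ n, ∫ s in Set.Iic T, (∫ p, (Z p - U (s, p)) *
      (clippedCondExp Q (𝒢 (gridTime n s)) C Z p - U (s, p)) ∂Q) ∂leb = 0) :
    ∀ᵐ s ∂(leb.restrict (Set.Iic T)), ∀ (W : E → ℝ) (D : ℝ),
      Measurable[𝒢 s] W → (∀ p, |W p| ≤ D) →
      ∫ p, (Z p - U (s, p)) * W p ∂Q = 0 := by
  set N : ℝ≥0 → E → ℝ := fun s => clippedCondExp Q (𝒢 s) C Z with hN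
  have hN𝒢 : ∀ s, Measurable[𝒢 s] (N s) := fun s => measurable_clippedCondExp _ Q C Z
  have hNm : ∀ s, Measurable (N s) := fun s => (hN𝒢 s).mono (𝒢.le s) le_rfl
  have hNb : ∀ s p, |N s p| ≤ C := fun s p => abs_clippedCondExp_le _ hC Z p
  have hUs : ∀ s, Measurable fun p => U (s, p) := fun s => hUm.comp (measurable_const.prodMk measurable_id)
  have hint : ∀ {a b : E → ℝ} {c d : ℝ}, Measurable a → (∀ p, |a p| ≤ c) → Measurable b →
      (∀ p, |b p| ≤ d) → Integrable (fun p => a p * b p) Q := fun ha hac hb hbd =>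
    (Integrable.of_bound ha.aestronglyMeasurable _ (ae_of_all Q hac)).mul_bdd hb.aestronglyMeasurable
      (ae_of_all _ hbd)
  have hsubb : ∀ {a b : ℝ}, |a| ≤ C → |b| ≤ C → |a - b| ≤ 2 * C := fun ha hb =>
    (abs_sub _ _).trans (by linarith)
  -- Against a test function known at time `s`, `Z` may be replaced by its conditional expectation
  -- `N s`.
  have hpull : ∀ s ≤ T, ∀ (W : E → ℝ) (C' : ℝ), Measurable[𝒢 s] W → (∀ p, |W p| ≤ C') →
      ∫ p, (Z p - U (s, p)) * W p ∂Q = ∫ p, (N s p - U (s, p)) * W p ∂Q := by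
    intro s hs W C' hW hWb
    have hWm := hW.mono (𝒢.le s) le_rfl
    simp only [sub_mul]
    rw [integral_sub (hint hZm hZ hWm hWb) (hint (hUs s) (fun p => hU _) hWm hWb),
      integral_sub (hint (hNm s) (hNb s) hWm hWb) (hint (hUs s) (fun p => hU _) hWm hWb),
      integral_mul_clippedCondExp (𝒢.le s) hZm hZ hW hWb]
  -- The squared `L²` norm of the martingale. Orthogonality of increments makes it non-decreasing,
  -- and its increments measure the `L²` distance between `N r` and `N s`.
  set q : ℝ≥0 → ℝ := fun s => ∫ p, N s p * N s p ∂Q with hq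
  have hcross : ∀ r s, r ≤ s → ∫ p, N s p * N r p ∂Q = q r := by
    intro r s hrs
    rw [← integral_mul_clippedCondExp (𝒢.le s) hZm hZ ((hN𝒢 r).mono (𝒢.mono hrs) le_rfl) (hNb r),
      integral_mul_clippedCondExp (𝒢.le r) hZm hZ (hN𝒢 r) (hNb r)]
  have hdist : ∀ r s, r ≤ s → ∫ p, (N s p - N r p) ^ 2 ∂Q = q s - q r := by
    intro r s hrs
    have h1 : ∀ p, (N s p - N r p) ^ 2 = N s p * N s p - 2 * (N s p * N r p) + N r p * N r p :=
      fun p => by ring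
    have i1 := hint (hNm s) (hNb s) (hNm s) (hNb s)
    have i2 := (hint (hNm s) (hNb s) (hNm r) (hNb r)).const_mul 2
    have i3 : Integrable (fun p => N s p * N s p - 2 * (N s p * N r p)) Q := i1.sub i2
    simp only [h1]
    rw [integral_add i3 (hint (hNm r) (hNb r) (hNm r) (hNb r)), integral_sub i1 i2,
      integral_const_mul, hcross r s hrs]
    simp only [q]
    ring
  have hqm : Monotone q := fun r s hrs => by
    have := integral_nonneg (μ := Q) (f := fun p => (N s p - N r p) ^ 2) fun p => sq_nonneg _
    rw [hdist r s hrs] at this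
    exact sub_nonneg.1 this
  set φ : ℕ → ℝ≥0 → ℝ := fun n s => ∫ p, (Z p - U (s, p)) * (N (gridTime n s) p - U (s, p)) ∂Q with hφ
  set ψ : ℝ≥0 → ℝ := fun s => ∫ p, (N s p - U (s, p)) * (N s p - U (s, p)) ∂Q with hψ
  -- Replacing the grid time by `s` costs an `L²` increment of the martingale. It tends to zero
  -- wherever the monotone function `q` is continuous, hence outside a countable set of times, which
  -- has measure zero.
  have hφψ : ∀ s ≤ T, ∀ n, |φ n s - ψ s| ≤ 2 * C * √(q s - q (gridTime n s)) := by
    intro s hs n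
    have hr := gridTime_le n s
    set r := gridTime n s with hr'
    have h1 : φ n s = ∫ p, (N s p - U (s, p)) * (N r p - U (s, p)) ∂Q :=
      hpull s hs _ (2 * C) (((hN𝒢 r).mono (𝒢.mono hr) le_rfl).sub (hU𝒢 s hs))
        fun p => hsubb (hNb _ _) (hU _)
    have hDb : ∀ p, |N r p - N s p| ≤ 2 * C := fun p => hsubb (hNb _ _) (hNb _ _)
    have hDm : Measurable fun p => N r p - N s p := (hNm r).sub (hNm s)
    have hDL : MemLp (fun p => N r p - N s p) 2 Q :=
      MemLp.of_bound hDm.aestronglyMeasurable _ (ae_of_all _ hDb)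
    have hnu : ∀ p, |N s p - U (s, p)| ≤ 2 * C := fun p => hsubb (hNb _ _) (hU _)
    have h2 : φ n s - ψ s = ∫ p, (N s p - U (s, p)) * (N r p - N s p) ∂Q := by
      rw [h1, hψ, ← integral_sub]
      · exact integral_congr_ae (ae_of_all _ fun p => by simp only; ring)
      · exact hint ((hNm s).sub (hUs s)) hnu ((hNm r).sub (hUs s)) fun p => hsubb (hNb _ _) (hU _)
      · exact hint ((hNm s).sub (hUs s)) hnu ((hNm s).sub (hUs s)) hnu
    rw [h2, ← hdist r s hr]
    have h3 : ∫ p, (N s p - N r p) ^ 2 ∂Q = ∫ p, (N r p - N s p) ^ 2 ∂Q :=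
      integral_congr_ae (ae_of_all _ fun p => by simp only; ring)
    rw [h3]
    refine abs_integral_le_integral_abs.trans ?_
    refine le_trans ?_ (mul_le_mul_of_nonneg_left (integral_abs_le_sqrt hDL) (by positivity))
    rw [← integral_const_mul]
    refine integral_mono (hint ((hNm s).sub (hUs s)) hnu hDm hDb).abs
      ((hDL.integrable one_le_two).abs.const_mul _) fun p => ?_
    show |(N s p - U (s, p)) * (N r p - N s p)| ≤ 2 * C * |N r p - N s p|
    rw [abs_mul]
    exact mul_le_mul_of_nonneg_right (hnu p) (abs_nonneg _)
  have hlim : ∀ᵐ s ∂(leb.restrict (Set.Iic T)), Tendsto (fun n => φ n s) atTop (𝓝 (ψ s)) := by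
    filter_upwards [ae_restrict_mem measurableSet_Iic,
      hqm.countable_not_continuousAt.ae_notMem (leb.restrict (Set.Iic T))] with s hs hc
    have hc : ContinuousAt q s := not_not.1 hc
    have h1 : Tendsto (fun n => 2 * C * √(q s - q (gridTime n s))) atTop (𝓝 0) := by
      have h2 := ((tendsto_const_nhds (x := q s)).sub (hc.tendsto.comp (tendsto_gridTime s))).sqrt
      have h3 := h2.const_mul (2 * C)
      simpa using h3
    rw [tendsto_iff_dist_tendsto_zero]
    exact squeeze_zero (fun n => dist_nonneg) (fun n => hφψ s hs n) h1
  have hφm : ∀ n, AEStronglyMeasurable (φ n) (leb.restrict (Set.Iic T)) := by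
    intro n
    have h1 : Measurable fun x : ℝ≥0 × E => N (gridTime n (min x.1 T)) x.2 :=
      measurable_comp_gridTime (fun s _ => hNm s) n
    have h2 : Measurable fun x : ℝ≥0 × E => (Z x.2 - U x) * (N (gridTime n (min x.1 T)) x.2 - U x) :=
      ((hZm.comp measurable_snd).sub hUm).mul (h1.sub hUm)
    refine (h2.stronglyMeasurable.integral_prod_right' (ν := Q)).aestronglyMeasurable.congr ?_
    filter_upwards [ae_restrict_mem measurableSet_Iic] with s hs
    simp only [φ, min_eq_left (Set.mem_Iic.1 hs)]
  have hφb : ∀ n, ∀ᵐ s ∂(leb.restrict (Set.Iic T)), ‖φ n s‖ ≤ 2 * C * (2 * C) := fun n =>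
    ae_of_all _ fun s => by
      refine (norm_integral_le_of_norm_le_const (μ := Q) (C := 2 * C * (2 * C)) (ae_of_all _ fun p => ?_)).trans ?_
      · rw [Real.norm_eq_abs, abs_mul]
        exact mul_le_mul (hsubb (hZ _) (hU _)) (hsubb (hNb _ _) (hU _)) (abs_nonneg _) (by positivity)
      · simp
  -- In the limit the hypothesis says that the integral of `‖N s - U s‖²` over time vanishes, so `U
  -- s = N s` almost surely, for almost every `s`.
  have hψi : ∫ s in Set.Iic T, ψ s ∂leb = 0 := by
    have h1 := tendsto_integral_of_dominated_convergence (fun _ => 2 * C * (2 * C)) hφm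
      (integrable_const _) hφb hlim
    refine tendsto_nhds_unique h1 ?_
    have h2 : ∀ n, ∫ s in Set.Iic T, φ n s ∂leb = 0 := h
    simp only [h2]
    exact tendsto_const_nhds
  have hψ0 : ∀ s, 0 ≤ ψ s := fun s => integral_nonneg fun p => mul_self_nonneg _
  have hψint : Integrable ψ (leb.restrict (Set.Iic T)) := by
    refine Integrable.of_bound (C := 2 * C * (2 * C)) (aestronglyMeasurable_of_tendsto_ae atTop hφm hlim) ?_
    filter_upwards [hlim, ae_all_iff.2 hφb] with s hs hb
    exact le_of_tendsto' hs.norm hb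
  have hψae := (integral_eq_zero_iff_of_nonneg hψ0 hψint).1 hψi
  filter_upwards [hψae, ae_restrict_mem measurableSet_Iic] with s hs hsT W D hW hWb
  have hnu : ∀ p, |N s p - U (s, p)| ≤ 2 * C := fun p => hsubb (hNb _ _) (hU _)
  have h1 := (integral_eq_zero_iff_of_nonneg (f := fun p => (N s p - U (s, p)) * (N s p - U (s, p)))
    (fun p => mul_self_nonneg _) (hint ((hNm s).sub (hUs s)) hnu ((hNm s).sub (hUs s)) hnu)).1 hs
  rw [hpull s hsT W D hW hWb]
  refine integral_eq_zero_of_ae ?_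
  filter_upwards [h1] with p hp
  have : N s p - U (s, p) = 0 := mul_self_eq_zero.1 hp
  rw [this, zero_mul]
  rfl

end

end

section

/-! ### One-sided continuity -/

theorem IsCanonical.add {a b : UnitAddCircle → ℝ} (ha : IsCanonical a) (hb : IsCanonical b) :
    IsCanonical fun x => a x + b x :=
  ⟨ha.1.add hb.1, fun r hr => (ha.2 r hr).add (hb.2 r hr)⟩

theorem IsCanonical.sub {a b : UnitAddCircle → ℝ} (ha : IsCanonical a) (hb : IsCanonical b) :
    IsCanonical fun x => a x - b x :=
  ⟨ha.1.sub hb.1, fun r hr => (ha.2 r hr).sub (hb.2 r hr)⟩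

theorem isCanonical_integral {α : Type*} [MeasurableSpace α] {ν : Measure α} [IsFiniteMeasure ν]
    {F : UnitAddCircle → α → ℝ} {C : ℝ} (hm : ∀ x, AEStronglyMeasurable (F x) ν)
    (hb : ∀ x a, |F x a| ≤ C) (hc : ∀ᵐ a ∂ν, IsCanonical fun x => F x a) :
    IsCanonical fun x => ∫ a, F x a ∂ν :=
  ⟨continuousWithinAt_of_dominated (F := fun (r : ℝ) a => F (r : UnitAddCircle) a)
    (Eventually.of_forall fun _ => hm _) (Eventually.of_forall fun _ => ae_of_all _ (hb _))
    (integrable_const C) (hc.mono fun _ h => h.1),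
  fun r hr => continuousWithinAt_of_dominated (F := fun (r : ℝ) a => F (r : UnitAddCircle) a)
    (Eventually.of_forall fun _ => hm _) (Eventually.of_forall fun _ => ae_of_all _ (hb _))
    (integrable_const C) (hc.mono fun _ h => h.2 r hr)⟩

/-- A nonzero value at a point of `[0, 1/2]` would persist, by one-sided continuity, on an interval
of positive length. Symmetry covers the rest of the circle. -/
theorem IsCanonical.eq_zero_of_ae {h : UnitAddCircle → ℝ} (hc : IsCanonical h)
    (hs : ∀ x, h (-x) = h x) (hae : ∀ᵐ x, h x = 0) (x : UnitAddCircle) : h x = 0 := by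
  have hae' := ae_coe_of_ae hae
  refine forall_of_forall_Icc (p := fun x => h x = 0) (fun x hx => by rwa [hs] at hx)
    (fun r hr => ?_) x
  by_contra hne
  rcases hr.1.eq_or_lt with h0 | h0
  · subst h0
    obtain ⟨u, hu, hsub⟩ := mem_nhdsGE_iff_exists_Ico_subset.1 (hc.1.eventually_ne hne)
    have h1 : volume (Set.Ico (0 : ℝ) u) = 0 := measure_mono_null hsub hae'
    rw [Real.volume_Ico, ENNReal.ofReal_eq_zero] at h1
    linarith [Set.mem_Ioi.1 hu]
  · obtain ⟨u, hu, hsub⟩ := mem_nhdsLE_iff_exists_Ioc_subset.1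
      ((hc.2 r ⟨h0, hr.2⟩).eventually_ne hne)
    have h1 : volume (Set.Ioc u r) = 0 := measure_mono_null hsub hae'
    rw [Real.volume_Ioc, ENNReal.ofReal_eq_zero] at h1
    linarith [Set.mem_Iio.1 hu]

/-! ### The costate -/

variable {Ω : Type*} [mΩ : MeasurableSpace Ω] {P : Measure Ω} {ℱ : Filtration ℝ≥0 mΩ}
  {B : ℕ → ℝ≥0 → Ω → ℝ} {lam : ℝ} {T : ℝ≥0} {V : ℝ≥0 → UnitAddCircle → P2 → ℝ} {x₀ : L2}
  {X : ℝ≥0 → Ω → L2} {η : ℝ≥0 → Ω → Hm2sym} {f g : ℝ → P2 → ℝ}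

theorem costate_eq_min {Ω : Type*} (T : ℝ≥0) (f g : ℝ → P2 → ℝ) (X : ℝ≥0 → Ω → L2) (t : ℝ≥0)
    (x : UnitAddCircle) (ω : Ω) : costate T f g X t x ω
      = derivAlong g (X T ω) x + ∫ s in Set.Icc t T, derivAlong f (X (min s T) ω) x ∂leb := by
  rw [costate]
  congr 1
  refine setIntegral_congr_fun measurableSet_Icc fun s hs => ?_
  simp only [min_eq_left hs.2]

section

variable (hX : IsSolution P ℱ B lam T V x₀ X η)
include hX

/-- At the excluded points the canonical value may be infinite; then `costatePath` uses
`EReal.toReal`, while `costate` uses the limits of the derivatives. Elsewhere the two conventions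
agree. -/
theorem IsSolution.costatePath_eq (t : ℝ≥0) (ω : Ω) {x : UnitAddCircle}
    (h0 : x ≠ ((0 : ℝ) : UnitAddCircle)) (h1 : x ≠ ((1 / 2 : ℝ) : UnitAddCircle)) :
    costatePath T f g X (ω, x) t = costate T f g X t x ω := by
  have h2 := fun s => coe_toReal_canonicalValue (hX.min_mem s ω) h0 h1
  have h3 := derivAlong_of_finite g (h2 T)
  rw [costate_eq_min, costatePath, pathCostate]
  congr 1
  · rw [min_self] at h3
    rw [h3, lawPath, statePath, min_self]
  · exact integral_congr_ae (ae_of_all _ fun s => (derivAlong_of_finite f (h2 s)).symm)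

theorem IsSolution.measurable_derivAlong_section (hf : IsCostCoefficient f) (x : UnitAddCircle) :
    Measurable fun q : ℝ≥0 × Ω => derivAlong f (X (min q.1 T) q.2) x :=
  (hf.measurable_derivAlong hX.stronglyMeasurable_uncurry fun p => hX.min_mem p.1 p.2).comp
    (measurable_id.prodMk measurable_const)

theorem IsSolution.measurable_costate (hf : IsCostCoefficient f) (hg : IsCostCoefficient g)
    (t : ℝ≥0) (x : UnitAddCircle) : Measurable (costate T f g X t x) := by
  have h1 : Measurable fun ω => derivAlong g (X T ω) x := by
    have h := (hX.measurable_derivAlong_section hg x).comp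
      ((measurable_const (a := T)).prodMk measurable_id)
    simpa [Function.comp_def] using h
  have h2 := (measurable_integral_Icc (T := T) (hX.measurable_derivAlong_section hf x)).comp
    ((measurable_const (a := t)).prodMk measurable_id)
  convert h1.add h2 using 1
  funext ω
  exact costate_eq_min T f g X t x ω

theorem IsSolution.costate_neg (t : ℝ≥0) (x : UnitAddCircle) (ω : Ω) :
    costate T f g X t (-x) ω = costate T f g X t x ω := by
  rw [costate_eq_min, costate_eq_min, IsCostCoefficient.derivAlong_neg (hX.X_mem T le_rfl ω)]
  simp only [IsCostCoefficient.derivAlong_neg (hX.min_mem _ ω)]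

theorem IsSolution.isCanonical_costate (hf : IsCostCoefficient f) (hg : IsCostCoefficient g)
    (t : ℝ≥0) (ω : Ω) : IsCanonical fun x => costate T f g X t x ω := by
  obtain ⟨C, -, -, hC, -⟩ := hf.exists_bound
  have : IsFiniteMeasure (leb.restrict (Set.Icc t T)) :=
    isFiniteMeasure_restrict.2 (((measure_mono Set.Icc_subset_Iic_self).trans_eq
      (leb_Iic T)).trans_lt ENNReal.coe_lt_top).ne
  simp only [costate_eq_min]
  refine (hg.isCanonical_derivAlong (hX.X_mem T le_rfl ω)).add (isCanonical_integral (C := C)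
    (fun x => ?_) (fun x s => hf.abs_derivAlong_le hC _ _)
    (ae_of_all _ fun s => hf.isCanonical_derivAlong (hX.min_mem s ω)))
  exact ((hX.measurable_derivAlong_section hf x).comp
    (measurable_id.prodMk measurable_const)).aestronglyMeasurable

omit hX in
theorem exists_costate_le {Ω : Type*} {X : ℝ≥0 → Ω → L2} (hf : IsCostCoefficient f) (hg : IsCostCoefficient g) :
    ∃ C : ℝ, ∀ t x ω, |costate T f g X t x ω| ≤ C := by
  obtain ⟨Cf, hCf, -, h1, -⟩ := hf.exists_bound
  obtain ⟨Cg, hCg, -, h2, -⟩ := hg.exists_bound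
  refine ⟨Cg + Cf * T, fun t x ω => (abs_add_le _ _).trans (add_le_add
    (hg.abs_derivAlong_le h2 _ _) ?_)⟩
  have h3 : leb (Set.Icc t T) ≤ T := (measure_mono Set.Icc_subset_Iic_self).trans_eq (leb_Iic T)
  have h4 : leb.real (Set.Icc t T) ≤ T := ENNReal.toReal_mono ENNReal.coe_ne_top h3
  refine (norm_setIntegral_le_of_norm_le_const (h3.trans_lt ENNReal.coe_lt_top)
    (C := Cf) fun s _ => (Real.norm_eq_abs _).trans_le (hf.abs_derivAlong_le h1 _ _)).trans ?_
  gcongr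

end

theorem IsProgressiveField.measurable_section {γ : ℝ≥0 → Ω → UnitAddCircle → ℝ}
    (h : IsProgressiveField ℱ T γ) {t : ℝ≥0} (ht : t ≤ T) (x : UnitAddCircle) :
    Measurable[ℱ t] fun ω => γ t ω x := by
  have h1 : @Measurable Ω (Set.Iic t × Ω × UnitAddCircle) (ℱ t)
      (MeasurableSpace.prod inferInstance (MeasurableSpace.prod (ℱ t) inferInstance))
      fun ω => ((⟨t, Set.self_mem_Iic⟩ : Set.Iic t), ω, x) :=
    measurable_const.prodMk (measurable_id.prodMk measurable_const)
  exact (h t ht).comp h1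

/-! ### The two implications -/

/-- After fixing `t` and then `x` by Fubini, `b t · x` is known at time `t`, so the costate may be
replaced by its conditional expectation, which is the field. -/
theorem IsSolution.integral_gap_eq_zero [IsProbabilityMeasure P]
    (hX : IsSolution P ℱ B lam T V x₀ X η) (hV : IsField T V) (hf : IsCostCoefficient f)
    (hg : IsCostCoefficient g) (h : PontryaginCondition P ℱ T f g V X)
    {b : ℝ≥0 → Ω → UnitAddCircle → ℝ} (hb : IsProgressiveField ℱ T b)
    (hbi : Integrable (fun q : ℝ≥0 × Ω × UnitAddCircle => b (min q.1 T) q.2.1 q.2.2) (spaceTime P T)) :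
    ∫ q, gap T f g V X q * b (min q.1 T) q.2.1 q.2.2 ∂(spaceTime P T) = 0 := by
  obtain ⟨C, -, -, -, hgap⟩ := exists_gap_le (X := X) hV hf hg
  obtain ⟨C', hC'⟩ := exists_costate_le (T := T) (X := X) hf hg
  obtain ⟨Cv, -, hVC, -⟩ := hV.bounded_lipschitz
  have hgb := hbi.bdd_mul (hX.measurable_gap hV hf hg).aestronglyMeasurable (ae_of_all _ hgap)
  rw [integral_prod _ hgb]
  refine integral_eq_zero_of_ae ?_
  filter_upwards [h, hgb.prod_right_ae, hbi.prod_right_ae, ae_restrict_mem measurableSet_Iic]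
    with t ⟨R, hR, hVR⟩ hgbt hbt ht
  simp only [min_eq_left (Set.mem_Iic.1 ht)] at hgbt hbt ⊢
  rw [integral_prod_symm _ hgbt]
  refine integral_eq_zero_of_ae ?_
  filter_upwards [hbt.prod_left_ae, ae_ne_point ((0 : ℝ) : UnitAddCircle),
    ae_ne_point ((1 / 2 : ℝ) : UnitAddCircle)] with x hbx h0 h1
  have hβ : Measurable[ℱ t] fun ω => b t ω x := hb.measurable_section ht x
  have hVm : Measurable fun ω => V t x (law (X t ω)) :=
    ((hX.isProgressiveField_field hV).measurable_section ht x).mono (ℱ.le t) le_rfl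
  have i1 : Integrable (fun ω => costate T f g X t x ω * b t ω x) P :=
    hbx.bdd_mul (hX.measurable_costate hf hg t x).aestronglyMeasurable (ae_of_all _ (hC' t x))
  have i2 : Integrable (fun ω => V t x (law (X t ω)) * b t ω x) P :=
    hbx.bdd_mul hVm.aestronglyMeasurable (ae_of_all _ fun ω => hVC t ht _ _)
  have h2 : ∀ ω, gap T f g V X (t, ω, x) * b t ω x
      = costate T f g X t x ω * b t ω x - V t x (law (X t ω)) * b t ω x := by
    intro ω
    rw [gap, hX.costatePath_eq t ω h0 h1, fieldPath, min_eq_left (Set.mem_Iic.1 ht), sub_mul]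
  simp only [h2]
  rw [integral_sub i1 i2, integral_condExp_mul (ℱ.le t) (hR.1 x).1 hβ.stronglyMeasurable i1,
    Pi.zero_apply, sub_eq_zero]
  refine integral_congr_ae ?_
  filter_upwards [hVR, (hR.1 x).2] with ω hω1 hω2
  rw [← hω2, hω1 x]

/-- The product filtration `ℱ_t ⊗ 𝓑(𝕊)`. -/
def prodFiltration (ℱ : Filtration ℝ≥0 mΩ) :
    Filtration ℝ≥0 (inferInstance : MeasurableSpace (Ω × UnitAddCircle)) where
  seq t := (ℱ t).prod inferInstance
  mono' _ _ h := sup_le_sup (MeasurableSpace.comap_mono (ℱ.mono h)) le_rfl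
  le' t := sup_le_sup (MeasurableSpace.comap_mono (ℱ.le t)) le_rfl

theorem IsProgressiveField.measurable_section_prod {γ : ℝ≥0 → Ω → UnitAddCircle → ℝ}
    (h : IsProgressiveField ℱ T γ) {t : ℝ≥0} (ht : t ≤ T) :
    Measurable[prodFiltration ℱ t] fun p : Ω × UnitAddCircle => γ t p.1 p.2 := by
  have h1 : @Measurable (Ω × UnitAddCircle) (Set.Iic t × Ω × UnitAddCircle) (prodFiltration ℱ t)
      (MeasurableSpace.prod inferInstance (MeasurableSpace.prod (ℱ t) inferInstance))
      fun p => ((⟨t, Set.self_mem_Iic⟩ : Set.Iic t), p) :=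
    measurable_const.prodMk measurable_id
  exact (h t ht).comp h1

theorem measurable_deriv_state_aux {Ω : Type*} [MeasurableSpace Ω] {t : ℝ≥0} {X : ℝ≥0 → Ω → L2}
    {f : ℝ → P2 → ℝ} (hf : IsCostCoefficient f)
    (hX : StronglyMeasurable fun p : ℝ≥0 × Ω => X (min p.1 t) p.2)
    (hU : ∀ s ω, X (min s t) ω ∈ U2) :
    Measurable fun p : ℝ≥0 × Ω × UnitAddCircle => deriv (fun y => f y (law (X (min p.1 t) p.2.1)))
      (canonicalValue (X (min p.1 t) p.2.1) p.2.2).toReal :=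
  hf.measurable_deriv.comp ((measurable_statePath_aux hX hU).prodMk
    (((measurable_law hX fun p => hU p.1 p.2).comp measurable_fst).comp measurable_assoc))

theorem IsSolution.isProgressiveField_deriv (hX : IsSolution P ℱ B lam T V x₀ X η)
    (hf : IsCostCoefficient f) : IsProgressiveField ℱ T fun t ω x =>
      deriv (fun y => f y (law (X t ω))) (canonicalValue (X t ω) x).toReal :=
  isProgressiveField_iff.2 fun t ht => @measurable_deriv_state_aux Ω (ℱ t) t X f hf
    (hX.stronglyMeasurable_min ht) fun _ _ => hX.X_mem _ ((min_le_right _ _).trans ht) _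

/-- The costate at time `t` differs from the one at time zero by an adapted integral. This reduces
the family of anticipating variables to a single one, whose conditional expectations form a
martingale. -/
theorem IsSolution.costatePath_zero_sub (hX : IsSolution P ℱ B lam T V x₀ X η)
    (hf : IsCostCoefficient f) {t : ℝ≥0} (ht : t ≤ T) (p : Ω × UnitAddCircle) :
    costatePath T f g X p 0 - costatePath T f g X p t = drift (fun s =>
      deriv (fun y => f y (law (X s p.1))) (canonicalValue (X s p.1) p.2).toReal) t := by
  obtain ⟨C, -, -, hC, -⟩ := hf.exists_bound
  have hsec : Measurable fun t : ℝ≥0 => (t, p) := measurable_id.prodMk measurable_const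
  have hi := (integrable_deriv_path (T := T) hf hC (hX.measurable_lawPath.comp hsec)
    (hX.measurable_statePath.comp hsec)).2
  have h1 := setIntegral_Iic_sub ht hi
  simp only [Function.comp_apply] at h1
  have h2 : Set.Icc 0 T = Set.Iic T := by
    ext s
    simp
  have h3 : drift (fun s => deriv (fun y => f y (law (X s p.1))) (canonicalValue (X s p.1) p.2).toReal) t
      = ∫ s in Set.Iic t, deriv (fun y => f y (lawPath T X p s)) (statePath T X p s) ∂leb := by
    refine setIntegral_congr_fun measurableSet_Iic fun s hs => ?_
    simp only [lawPath, statePath, min_eq_left (le_trans (Set.mem_Iic.1 hs) ht)]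
  rw [h3, costatePath, pathCostate, pathCostate, h2, setIntegral_congr_set (Ioc_ae_eq_Icc).symm]
  linarith

theorem IsSolution.ae_integral_gap_mul_eq_zero [IsProbabilityMeasure P]
    (hX : IsSolution P ℱ B lam T V x₀ X η) {K : ℝ≥0} (hK : ∀ t ≤ T, ∫⁻ ω, ‖X t ω‖ₑ ∂P ≤ K)
    (hV : IsField T V) (hf : IsCostCoefficient f) (hg : IsCostCoefficient g)
    (h : IsMeanFieldEquilibrium P ℱ T f g V X) :
    ∀ᵐ s ∂(leb.restrict (Set.Iic T)), ∀ (W : Ω × UnitAddCircle → ℝ) (D : ℝ),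
      Measurable[prodFiltration ℱ s] W → (∀ p, |W p| ≤ D) →
      ∫ p, gap T f g V X (s, p) * W p ∂(P.prod volume) = 0 := by
  obtain ⟨C, hC, -, hY, hgap⟩ := exists_gap_le (X := X) hV hf hg
  set Z : Ω × UnitAddCircle → ℝ := fun p => costatePath T f g X p 0 with hZ
  set U : ℝ≥0 × Ω × UnitAddCircle → ℝ := fun q => Z q.2 - gap T f g V X (min q.1 T, q.2) with hU
  have hZm : Measurable Z := (hX.measurable_costatePath hf hg).comp
    ((measurable_const (a := (0 : ℝ≥0))).prodMk measurable_id)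
  have hZb : ∀ p, |Z p| ≤ 2 * C := fun p => (hY p 0).trans (by linarith)
  have hUm : Measurable U := (hZm.comp measurable_snd).sub ((hX.measurable_gap hV hf hg).comp
    ((measurable_fst.min measurable_const).prodMk measurable_snd))
  have hUb : ∀ q, |U q| ≤ 2 * C := fun q => (abs_sub _ _).trans (by linarith [hY q.2 0, hgap (min q.1 T, q.2)])
  -- On `[0, T]`, `U` is the running integral of `∂ₓf` up to `s` plus the field, both progressive,
  -- although it is defined through the anticipating `Z`.
  have hUp : IsProgressiveField ℱ T fun s ω x => U (s, ω, x) := by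
    have h1 := ((hX.isProgressiveField_deriv hf).drift).add (hX.isProgressiveField_field hV)
    intro t ht
    convert h1 t ht using 2 with q
    have hq : (q.1 : ℝ≥0) ≤ T := le_trans q.1.2 ht
    have h2 := hX.costatePath_zero_sub (g := g) hf hq q.2
    simp only [U, gap, fieldPath, min_eq_left hq]
    rw [← h2]
    ring
  have hUZ : ∀ s ≤ T, ∀ p, Z p - U (s, p) = gap T f g V X (s, p) := by
    intro s hs p
    simp only [U, min_eq_left hs, sub_sub_cancel]
  have key := ae_integral_mul_eq_zero (Q := P.prod volume) (𝒢 := prodFiltration ℱ) (T := T)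
    (C := 2 * C) (by positivity) hZm hZb hUm hUb (fun s hs => hUp.measurable_section_prod hs) fun n => ?_
  · filter_upwards [key, ae_restrict_mem measurableSet_Iic] with s hs hsT W D hW hWb
    rw [← hs W D hW hWb]
    refine integral_congr_ae (ae_of_all _ fun p => ?_)
    simp only [hUZ s hsT]
  · set N : ℝ≥0 → Ω × UnitAddCircle → ℝ := fun s =>
      clippedCondExp (P.prod volume) (prodFiltration ℱ s) (2 * C) Z with hN
    -- Sampling at earlier grid times makes the test field progressive, so the first-order condition
    -- may be applied to it.
    have hNp : IsProgressiveField ℱ T fun s ω x => N (gridTime n s) (ω, x) :=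
      isProgressiveField_iff.2 fun t _ => @measurable_comp_gridTime (Ω × UnitAddCircle)
        (prodFiltration ℱ t) N t (fun s hs => (measurable_clippedCondExp _ _ _ _).mono
          ((prodFiltration ℱ).mono hs) le_rfl) n
    have hbp := hNp.sub hUp
    have hbb : ∀ s ω x, |N (gridTime n s) (ω, x) - U (s, ω, x)| ≤ 2 * C + 2 * C := fun s ω x =>
      (abs_sub _ _).trans (add_le_add (abs_clippedCondExp_le _ (by positivity) _ _) (hUb _))
    have h1 := hX.integral_eq_zero_of_isMeanFieldEquilibrium hK hV hf hg h hbp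
      (MemLp.of_bound hbp.measurable.aestronglyMeasurable _ (ae_of_all _ fun q => hbb _ _ _))
    rw [integral_prod] at h1
    · rw [← h1]
      refine setIntegral_congr_fun measurableSet_Iic fun s hs => ?_
      refine integral_congr_ae (ae_of_all _ fun p => ?_)
      simp only [hUZ s hs, min_eq_left (Set.mem_Iic.1 hs)]
      rfl
    · exact (Integrable.of_bound hbp.measurable.aestronglyMeasurable _
        (ae_of_all _ fun q => hbb _ _ _)).bdd_mul (hX.measurable_gap hV hf hg).aestronglyMeasurable
        (ae_of_all _ hgap)

theorem measurable_indicator_mul {Ω : Type*} [MeasurableSpace Ω] {A : Set Ω} (hA : MeasurableSet A)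
    {w : UnitAddCircle → ℝ} (hw : Measurable w) :
    Measurable fun p : Ω × UnitAddCircle => A.indicator (1 : Ω → ℝ) p.1 * w p.2 :=
  ((measurable_one.indicator hA).comp measurable_fst).mul (hw.comp measurable_snd)

/-- For fixed `t` and an event `A` known at time `t`, the integral of the gap over `A` vanishes for
almost every `x`, then for every `x` by one-sided continuity. The exceptional set of `x`, which
could depend on `A`, has thus disappeared before the conditional expectation at `x` is identified.
-/
theorem IsSolution.pontryaginCondition [IsProbabilityMeasure P]
    (hX : IsSolution P ℱ B lam T V x₀ X η) {K : ℝ≥0} (hK : ∀ t ≤ T, ∫⁻ ω, ‖X t ω‖ₑ ∂P ≤ K)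
    (hV : IsField T V) (hf : IsCostCoefficient f) (hg : IsCostCoefficient g)
    (h : IsMeanFieldEquilibrium P ℱ T f g V X) : PontryaginCondition P ℱ T f g V X := by
  obtain ⟨C, hC, -, -, hgap⟩ := exists_gap_le (X := X) hV hf hg
  obtain ⟨C', hC'⟩ := exists_costate_le (T := T) (X := X) hf hg
  obtain ⟨Cv, -, hVC, -⟩ := hV.bounded_lipschitz
  filter_upwards [hX.ae_integral_gap_mul_eq_zero hK hV hf hg h, ae_restrict_mem measurableSet_Iic]
    with t ht htT
  have hVm : ∀ x, Measurable[ℱ t] fun ω => V t x (law (X t ω)) :=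
    (hX.isProgressiveField_field hV).measurable_section htT
  have hYi : ∀ x, Integrable (costate T f g X t x) P := fun x =>
    Integrable.of_bound (hX.measurable_costate hf hg t x).aestronglyMeasurable C' (ae_of_all _ (hC' t x))
  have hVi : ∀ x, Integrable (fun ω => V t x (law (X t ω))) P := fun x =>
    Integrable.of_bound ((hVm x).mono (ℱ.le t) le_rfl).aestronglyMeasurable Cv
      (ae_of_all _ fun ω => hVC t htT _ _)
  have hgm : Measurable fun p : Ω × UnitAddCircle => gap T f g V X (t, p) :=
    (hX.measurable_gap hV hf hg).comp (measurable_const.prodMk measurable_id)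
  have hzero : ∀ A, MeasurableSet[ℱ t] A → ∀ x,
      ∫ ω in A, (costate T f g X t x ω - V t x (law (X t ω))) ∂P = 0 := by
    intro A hA x
    have hA' := ℱ.le t A hA
    have hae : ∀ᵐ x, ∫ ω in A, gap T f g V X (t, ω, x) ∂P = 0 := by
      set w : UnitAddCircle → ℝ := fun x => ∫ ω in A, gap T f g V X (t, ω, x) ∂P with hw
      have hwm : Measurable w :=
        (hgm.stronglyMeasurable.integral_prod_left' (μ := P.restrict A)).measurable
      have hwb : ∀ x, |w x| ≤ C := fun x => by
        refine (norm_setIntegral_le_of_norm_le_const (measure_lt_top P A) (C := C)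
          fun ω _ => (Real.norm_eq_abs _).trans_le (hgap _)).trans ?_
        exact mul_le_of_le_one_right hC measureReal_le_one
      -- Testing with `w` itself, the integral of the gap over `A`, produces `∫ w² = 0`.
      have h1 := ht (fun p => A.indicator 1 p.1 * w p.2) C
        (@measurable_indicator_mul Ω (ℱ t) A hA w hwm)
        fun p => by
          rw [abs_mul]
          refine (mul_le_of_le_one_left (abs_nonneg _) ?_).trans (hwb _)
          by_cases hp : p.1 ∈ A <;> simp [hp]
      have hi : Integrable (fun p : Ω × UnitAddCircle => gap T f g V X (t, p) * (A.indicator 1 p.1 * w p.2))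
          (P.prod volume) := by
        refine Integrable.of_bound (C := C * C) (hgm.mul
          (measurable_indicator_mul hA' hwm)).aestronglyMeasurable (ae_of_all _ fun p => ?_)
        rw [Real.norm_eq_abs, abs_mul, abs_mul]
        refine mul_le_mul (hgap _) ((mul_le_of_le_one_left (abs_nonneg _) ?_).trans (hwb _))
          (by positivity) hC
        by_cases hp : p.1 ∈ A <;> simp [hp]
      rw [integral_prod_symm _ hi] at h1
      have h2 : ∀ x, ∫ ω, gap T f g V X (t, ω, x) * (A.indicator 1 ω * w x) ∂P = w x * w x := by
        intro x
        have h3 : ∀ ω, gap T f g V X (t, ω, x) * (A.indicator 1 ω * w x)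
            = A.indicator (fun ω => gap T f g V X (t, ω, x)) ω * w x := by
          intro ω
          by_cases hp : ω ∈ A <;> simp [hp]
        simp only [h3]
        rw [integral_mul_const, integral_indicator hA']
      simp only [h2] at h1
      have h4 := (integral_eq_zero_iff_of_nonneg (f := fun x => w x * w x)
        (fun x => mul_self_nonneg _) (Integrable.of_bound (C := C * C) (hwm.mul hwm).aestronglyMeasurable
          (ae_of_all _ fun x => by
            rw [Real.norm_eq_abs, abs_mul]
            exact mul_le_mul (hwb x) (hwb x) (abs_nonneg _) hC))).1 h1
      filter_upwards [h4] with x hx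
      exact mul_self_eq_zero.1 hx
    have hc : IsCanonical fun x => ∫ ω in A, (costate T f g X t x ω - V t x (law (X t ω))) ∂P :=
      isCanonical_integral (C := C' + Cv) (fun x => ((hYi x).sub (hVi x)).aestronglyMeasurable.restrict)
        (fun x ω => (abs_sub _ _).trans (add_le_add (hC' t x ω) (hVC t htT _ _)))
        (ae_of_all _ fun ω => (hX.isCanonical_costate hf hg t ω).sub (hV.mem_U2 t htT _).2)
    refine hc.eq_zero_of_ae (fun x => ?_) ?_ x
    · have h5 : ∀ μ, V t (-x) μ = V t x μ := fun μ => by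
        exact EReal.coe_eq_coe_iff.1 ((hV.mem_U2 t htT μ).1.1 x)
      simp only [hX.costate_neg, h5]
    · filter_upwards [hae, ae_ne_point ((0 : ℝ) : UnitAddCircle),
        ae_ne_point ((1 / 2 : ℝ) : UnitAddCircle)] with x hx h0 h1
      rw [← hx]
      refine integral_congr_ae (ae_of_all _ fun ω => ?_)
      simp only [gap, hX.costatePath_eq t ω h0 h1, fieldPath, min_eq_left (Set.mem_Iic.1 htT)]
  -- The field along the solution is itself the canonical version of the conditional expectation.
  refine ⟨fun ω x => V t x (law (X t ω)), ⟨fun x => ⟨hYi x, ?_⟩, fun ω => hV.mem_U2 t htT _⟩,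
    ae_of_all _ fun ω x => rfl⟩
  refine ae_eq_condExp_of_forall_setIntegral_eq (ℱ.le t) (hYi x) (fun A _ _ => (hVi x).integrableOn)
    (fun A hA _ => ?_) (hVm x).aestronglyMeasurable
  have h1 := hzero A hA x
  rw [integral_sub (hYi x).integrableOn (hVi x).integrableOn] at h1
  linarith

end

end RSHE

end

theorem mainTheorem5 {Ω : Type*} [mΩ : MeasurableSpace Ω] (P : Measure Ω) [IsProbabilityMeasure P]
    (ℱ : Filtration ℝ≥0 mΩ) (B : ℕ → ℝ≥0 → Ω → ℝ) (hB : RSHE.IsNoise P ℱ B)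
    (lam : ℝ) (hlam : lam ∈ Set.Ioo (1 / 2 : ℝ) 1) (T : ℝ≥0) (hT : 0 < T)
    (f g : ℝ → RSHE.P2 → ℝ) (hf : RSHE.IsCostCoefficient f) (hg : RSHE.IsCostCoefficient g)
    (V : ℝ≥0 → UnitAddCircle → RSHE.P2 → ℝ) (hV : RSHE.IsField T V)
    (x₀ : RSHE.L2) (hx₀ : x₀ ∈ RSHE.U2)
    (X : ℝ≥0 → Ω → RSHE.L2) (η : ℝ≥0 → Ω → RSHE.Hm2sym)
    (hX : RSHE.IsSolution P ℱ B lam T V x₀ X η) :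
    RSHE.IsMeanFieldEquilibrium P ℱ T f g V X ↔ RSHE.PontryaginCondition P ℱ T f g V X := by
  obtain ⟨K, hK⟩ := hX.lintegral_norm_le hB hlam.1 hV
  exact ⟨hX.pontryaginCondition hK hV hf hg, fun h =>
    hX.isMeanFieldEquilibrium_of_integral_eq_zero hK hV hf hg fun b hb hbi =>
      hX.integral_gap_eq_zero hV hf hg h hb hbi⟩
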